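/- Let $\pi=\langle c_1,c_2,c_3,c_4\mid c_1c_2c_3c_4=1\rangle$ be the fundamental group of the 4-punctured sphere. The group of automorphisms of $\pi$ that map every $c_i$ to a conjugate of itself acts by precomposition on conjugacy classes of representations $\rho:\pi\to\mathrm{PSL}_2\mathbb R$, through its quotient by the inner automorphisms, the pure mapping class group. Orbits are orbits of this action. Rotations of the hyperbolic plane $\mathbb H$ are measured anticlockwise. For $\alpha\in(0,2\pi)^4$ with $\alpha_1+\alpha_2+\alpha_3+\alpha_4>6\pi$, the Deroin–Tholozan component $\mathrm{Rep}^{DT}_\alpha$ (the compact component of the relative character variety) is the set of conjugacy classes of representations $\rho$ such that each $\rho(c_i)$ is a rotation of angle $\alpha_i$ and the relative Euler number of $\rho$ is $3$. That is, if $R_i(s)$ is the rotation of angle $s\alpha_i$ about the fixed point of $\rho(c_i)$, then the loop $s\mapsto R_1(s)R_2(s)R_3(s)R_4(s)$, $0\le s\le 1$, represents $3\in\pi_1(\mathrm{PSL}_2\mathbb R)=\mathbb Z$, the generator being a full anticlockwise rotation. Coordinates. Let $b=(c_1c_2)^{-1}$. For $[\rho]\in\mathrm{Rep}^{DT}_\alpha$,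 let $C_i$ and $B$ be the fixed points in $\mathbb H$ of $\rho(c_i)$ and $\rho(b)$. The action coordinate $\beta\in(0,2\pi)$ of $[\rho]$ is the rotation angle of $\rho(b)$. If $C_1\ne C_2$ and $C_3\ne C_4$, the angle coordinate $\gamma\in\mathbb R/2\pi\mathbb Z$ of $[\rho]$ is the anticlockwise angle at $B$ from the ray $BC_3$ to the ray $BC_2$. Otherwise $[\rho]$ is a pole: the north pole if $\beta=\alpha_3+\alpha_4-2\pi$ (then $B=C_3=C_4$), the south pole if $\beta=4\pi-\alpha_1-\alpha_2$ (then $B=C_1=C_2$). For real $p,q,r$, a rotation triangle group $D(p,q,r)$ is the subgroup of $\mathrm{PSL}_2\mathbb R$ generated by the rotations about the vertices of a hyperbolic triangle with interior angles $\pi/p,\pi/q,\pi/r$, by twice the interior angles. Theorem. Let $5\pi/3<\theta<2\pi$, and let $\alpha$ be any ordering of $\{\pi,\theta,\theta,\theta\}$ (Type IV) or of $\{\theta,\theta,\theta,3\theta-4\pi\}$ (Type IV$^*$). Then $\mathrm{Rep}^{DT}_\alpha$ contains a unique orbit of length $4$. It consists of one pole and of three points that have the same action coordinate, as follows. $$\begin{array}{c|c|c|c}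 \alpha & \beta \text{ of the three points} & \gamma \text{ of the three points} & \text{pole, with its } \beta\\ \hline (\theta,\theta,\theta,\pi) & 2\pi/3 & 0,\ 2\pi/3,\ 4\pi/3 & \text{south},\ 4\pi-2\theta\\ (\theta,\theta,\pi,\theta) & 2\pi/3 & \pi/3,\ \pi,\ 5\pi/3 & \text{south},\ 4\pi-2\theta\\ (\pi,\theta,\theta,\theta) & 4\pi/3 & 0,\ 2\pi/3,\ 4\pi/3 & \text{north},\ 2\theta-2\pi\\ (\theta,\pi,\theta,\theta) & 4\pi/3 & \pi/3,\ \pi,\ 5\pi/3 & \text{north},\ 2\theta-2\pi\\ (\theta,\theta,\theta,3\theta-4\pi) & 2\pi/3 & \pi/3,\ \pi,\ 5\pi/3 & \text{north},\ 4\theta-6\pi\\ (\theta,\theta,3\theta-4\pi,\theta) & 2\pi/3 & 0,\ 2\pi/3,\ 4\pi/3 & \text{north},\ 4\theta-6\pi\\ (\theta,3\theta-4\pi,\theta,\theta) & 4\pi/3 & 0,\ 2\pi/3,\ 4\pi/3 & \text{south},\ 8\pi-4\theta\\ (3\theta-4\pi,\theta,\theta,\theta) & 4\pi/3 & \pi/3,\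 \pi,\ 5\pi/3 & \text{south},\ 8\pi-4\theta \end{array}$$ Moreover, the image of every representation whose conjugacy class lies in this orbit is a rotation triangle group $D(2,3,\overline\theta)$, where $\overline\theta=(1-\theta/2\pi)^{-1}$. -/

import Mathlib

open Matrix UpperHalfPlane

noncomputable section

namespace FourPuncturedSphere

/-! ### Rotations of the hyperbolic plane -/

/-- The group `SL(2, ℝ)`, acting on the upper half-plane `ℍ` by Möbius transformations. -/
abbrev SL2R : Type := SpecialLinearGroup (Fin 2) ℝ

/-- The group `PSL(2, ℝ)` of orientation-preserving isometries of `ℍ`. -/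
abbrev PSL2R : Type := ProjectiveSpecialLinearGroup (Fin 2) ℝ

/-- The projection `SL(2, ℝ) → PSL(2, ℝ)`. -/
def proj : SL2R →* PSL2R := QuotientGroup.mk' _

/-- The matrix with rows `(cos (t/2), sin (t/2))` and `(-sin (t/2), cos (t/2))`. It acts on `ℍ` as
the anticlockwise rotation about `I` of angle `t` (its derivative at `I` is `exp (t * I)`). -/
def rot (t : ℝ) : SL2R :=
  ⟨!![Real.cos (t / 2), Real.sin (t / 2); -Real.sin (t / 2), Real.cos (t / 2)], by
    rw [Matrix.det_fin_two_of]
    nlinarith [Real.sin_sq_add_cos_sq (t / 2)]⟩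

/-- `g` is the anticlockwise rotation of angle `t` about the point `z`. -/
def IsRotation (g : PSL2R) (z : ℍ) (t : ℝ) : Prop :=
  ∃ A : SL2R, A • (I : ℍ) = z ∧ g = proj (A * rot t * A⁻¹)

/-- The conformal map from `ℍ` to the unit disc that sends `z` to `0`. It is an
orientation-preserving isometry onto the Poincaré disc and it sends the geodesic rays issued from
`z` to the radii of the disc. -/
def discCoord (z w : ℍ) : ℂ := ((w : ℂ) - (z : ℂ)) / ((w : ℂ) - (starRingEnd ℂ) (z : ℂ))

/-- The oriented (anticlockwise) angle in `(-π, π]` at the vertex `z` from the geodesic ray `zp` to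
the geodesic ray `zq`, for `p ≠ z` and `q ≠ z`. -/
def orientedAngle (z p q : ℍ) : ℝ := Complex.arg (discCoord z q / discCoord z p)

/-- The interior angle in `[0, π]` at the vertex `z` of the hyperbolic triangle `z p q`. -/
def interiorAngle (z p q : ℍ) : ℝ := |orientedAngle z p q|

/-- `G` is a rotation triangle group `D(p, q, r)`: for some hyperbolic triangle with interior angles
`π / p`, `π / q`, `π / r`, it is generated by the rotations about the three vertices by twice the
interior angles. The numbers `p`, `q`, `r` need not be integers. -/
def IsRotationTriangleGroup (G : Subgroup PSL2R) (p q r : ℝ) : Prop :=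
  ∃ (P Q R : ℍ) (a b c : PSL2R), P ≠ Q ∧ Q ≠ R ∧ R ≠ P ∧
    interiorAngle P Q R = Real.pi / p ∧
    interiorAngle Q R P = Real.pi / q ∧
    interiorAngle R P Q = Real.pi / r ∧
    IsRotation a P (2 * Real.pi / p) ∧
    IsRotation b Q (2 * Real.pi / q) ∧
    IsRotation c R (2 * Real.pi / r) ∧
    G = Subgroup.closure {a, b, c}

/-! ### The 4-punctured sphere and its pure mapping class group -/

/-- The fundamental group of the 4-punctured sphere, `⟨c₁, c₂, c₃, c₄ | c₁ c₂ c₃ c₄ = 1⟩`, written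
as the free group on `c₁, c₂, c₃`. -/
abbrev SphereGroup : Type := FreeGroup (Fin 3)

/-- The peripheral generators `c₁, c₂, c₃, c₄`, indexed from `0` to `3`; their product in this
order is `1`. -/
def peripheral : Fin 4 → SphereGroup :=
  ![FreeGroup.of 0, FreeGroup.of 1, FreeGroup.of 2,
    (FreeGroup.of 0 * FreeGroup.of 1 * FreeGroup.of 2)⁻¹]

/-- The simple closed curve `b = (c₁ c₂)⁻¹` that cuts the sphere into two pairs of pants. -/
def curveB : SphereGroup := (peripheral 0 * peripheral 1)⁻¹

/-- The automorphisms of the fundamental group that send every peripheral generator to a conjugate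
of itself. By the Dehn–Nielsen–Baer theorem, they are the automorphisms induced by the
orientation-preserving homeomorphisms that fix every puncture; the pure mapping class group is the
quotient of this group by the inner automorphisms, and the latter act trivially on conjugacy classes
of representations. -/
def PMod : Subgroup (MulAut SphereGroup) where
  carrier := {φ | ∀ i, IsConj (peripheral i) (φ (peripheral i))}
  one_mem' := fun i => IsConj.refl _
  mul_mem' := by
    intro φ ψ hφ hψ i
    exact (hφ i).trans ((φ : SphereGroup →* SphereGroup).map_isConj (hψ i))
  inv_mem' := by
    intro φ hφ i
    have h := ((φ⁻¹ : MulAut SphereGroup) : SphereGroup →* SphereGroup).map_isConj (hφ i)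
    have e : (φ⁻¹ : MulAut SphereGroup) (φ (peripheral i)) = peripheral i :=
      MulAut.inv_apply_self _ φ _
    change IsConj ((φ⁻¹ : MulAut SphereGroup) (peripheral i))
      ((φ⁻¹ : MulAut SphereGroup) (φ (peripheral i))) at h
    rw [e] at h
    exact h.symm

/-! ### Conjugacy classes of representations -/

/-- Representations of the fundamental group into `PSL(2, ℝ)`. -/
abbrev SphereRep : Type := SphereGroup →* PSL2R

/-- Conjugacy of representations. -/
instance conjSetoid : Setoid SphereRep where
  r ρ σ := ∃ g : PSL2R, ∀ x, σ x = g * ρ x * g⁻¹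
  iseqv :=
    { refl := fun ρ => ⟨1, fun x => by simp⟩
      symm := by
        rintro ρ σ ⟨g, h⟩
        exact ⟨g⁻¹, fun x => by rw [h]; group⟩
      trans := by
        rintro ρ σ τ ⟨g, h⟩ ⟨k, h'⟩
        exact ⟨k * g, fun x => by rw [h', h]; group⟩ }

/-- The set of conjugacy classes of representations into `PSL(2, ℝ)`. -/
def RepClass : Type := Quotient conjSetoid

/-- The conjugacy class of a representation. -/
def SphereRep.cls (ρ : SphereRep) : RepClass := Quotient.mk conjSetoid ρ

/-- Automorphisms act on conjugacy classes by `φ • [ρ] = [ρ ∘ φ⁻¹]`. -/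
instance : MulAction (MulAut SphereGroup) RepClass where
  smul φ := Quotient.map (fun ρ : SphereRep => ρ.comp (φ⁻¹ : MulAut SphereGroup).toMonoidHom)
    (fun _ _ h => h.imp fun _ hg x => hg _)
  one_smul x := by
    induction x using Quotient.inductionOn with
    | h ρ => exact congrArg (Quotient.mk conjSetoid) (MonoidHom.ext fun x => rfl)
  mul_smul φ ψ x := by
    induction x using Quotient.inductionOn with
    | h ρ => exact congrArg (Quotient.mk conjSetoid) (MonoidHom.ext fun x => by
        change ρ ((φ * ψ)⁻¹ x) = ρ (ψ⁻¹ (φ⁻¹ x))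
        rw [_root_.mul_inv_rev]; rfl)

/-! ### Deroin–Tholozan components -/

/-- `ρ` maps each `cᵢ` to a rotation of angle `αᵢ` and its relative Euler number is `k`. The
rotation `ρ(cᵢ)` is joined to the identity by the rotations of angle `s αᵢ` about the same point,
`0 ≤ s ≤ 1`. The product of these four paths, in the order of the punctures, is a loop in
`PSL(2, ℝ)`, and `k` is its class in `π₁(PSL(2, ℝ)) = ℤ`, generated by a full anticlockwise rotation.
The class is read off from a continuous determination `u` of the direction of the image of the first
basis vector, which turns by `-π` along the generator. -/
def HasEulerNumber (α : Fin 4 → ℝ) (ρ : SphereRep) (k : ℤ) : Prop :=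
  ∃ (A : Fin 4 → SL2R) (u : ℝ → ℝ),
    (∀ i, ρ (peripheral i) = proj (A i * rot (α i) * (A i)⁻¹)) ∧
    ContinuousOn u (Set.Icc 0 1) ∧ u 0 = 0 ∧ u 1 = -(k * Real.pi) ∧
    ∀ s ∈ Set.Icc (0 : ℝ) 1, ∃ r : ℝ, 0 < r ∧
      ((A 0 * rot (s * α 0) * (A 0)⁻¹) * (A 1 * rot (s * α 1) * (A 1)⁻¹) *
        (A 2 * rot (s * α 2) * (A 2)⁻¹) * (A 3 * rot (s * α 3) * (A 3)⁻¹) : SL2R).1 *ᵥ ![1, 0]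
        = r • ![Real.cos (u s), Real.sin (u s)]

/-- The Deroin–Tholozan component of the relative character variety with peripheral angles
`α ∈ (0, 2π)⁴`, `α₁ + α₂ + α₃ + α₄ > 6π`: the conjugacy classes of supra-maximal representations,
those of relative Euler number `3`. It is the compact connected component; the two triangles of the
triangle chain of any of its points have total area `(α₁ + α₂ + α₃ + α₄) / 2 - 3π`. -/
def DT (α : Fin 4 → ℝ) : Set RepClass :=
  {x | ∃ ρ : SphereRep, ρ.cls = x ∧ HasEulerNumber α ρ 3}

/-! ### Action-angle coordinates for the pants decomposition `b` -/

/-- The triangle chain of `ρ` is made of the triangles `(C₁, C₂, B)` and `(B, C₃, C₄)`, where `Cᵢ` is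
the centre of the rotation `ρ(cᵢ)`, of angle `αᵢ`, and `B` is the centre of the rotation `ρ(b)`,
of angle `β ∈ (0, 2π)`. -/
def IsTriangleChain (α : Fin 4 → ℝ) (ρ : SphereRep) (C : Fin 4 → ℍ) (B : ℍ) (β : ℝ) : Prop :=
  (∀ i, IsRotation (ρ (peripheral i)) (C i) (α i)) ∧
    β ∈ Set.Ioo 0 (2 * Real.pi) ∧ IsRotation (ρ curveB) B β

/-- The class `x` has a regular triangle chain (both triangles are non-degenerate), its action
coordinate is `β`, and its angle coordinate is `γ` modulo `2π`: the anticlockwise angle at `B` from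
the ray `BC₃` to the ray `BC₂`. -/
def HasCoordinates (α : Fin 4 → ℝ) (x : RepClass) (β γ : ℝ) : Prop :=
  ∃ (ρ : SphereRep) (C : Fin 4 → ℍ) (B : ℍ), ρ.cls = x ∧ IsTriangleChain α ρ C B β ∧
    C 0 ≠ C 1 ∧ C 2 ≠ C 3 ∧ (orientedAngle B (C 2) (C 1) : Real.Angle) = (γ : Real.Angle)

/-- The class `x` has a singular triangle chain (one of the two triangles is reduced to a point) and
its action coordinate is `β`. -/
def IsPole (α : Fin 4 → ℝ) (x : RepClass) (β : ℝ) : Prop :=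
  ∃ (ρ : SphereRep) (C : Fin 4 → ℍ) (B : ℍ), ρ.cls = x ∧ IsTriangleChain α ρ C B β ∧
    (C 0 = C 1 ∨ C 2 = C 3)

/-- The north pole is the pole with action coordinate `α₃ + α₄ - 2π`; there `B = C₃ = C₄`. -/
def IsNorthPole (α : Fin 4 → ℝ) (x : RepClass) (β : ℝ) : Prop :=
  IsPole α x β ∧ β = α 2 + α 3 - 2 * Real.pi

/-- The south pole is the pole with action coordinate `4π - α₁ - α₂`; there `B = C₁ = C₂`. -/
def IsSouthPole (α : Fin 4 → ℝ) (x : RepClass) (β : ℝ) : Prop :=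
  IsPole α x β ∧ β = 4 * Real.pi - α 0 - α 1

/-! ### Orbits of length 4 -/

/-- `O` is an orbit of the pure mapping class group of length 4 inside the Deroin–Tholozan
component with peripheral angles `α`. -/
def IsLengthFourOrbit (α : Fin 4 → ℝ) (O : Set RepClass) : Prop :=
  (∃ x, O = MulAction.orbit PMod x) ∧ O ⊆ DT α ∧ O.ncard = 4

/-- `O` consists of a point `p` that satisfies `pole` and of three points with action coordinate
`β` and respective angle coordinates `γ 0`, `γ 1`, `γ 2`. -/
def HasOrbitPoints (α : Fin 4 → ℝ) (O : Set RepClass) (β : ℝ) (γ : Fin 3 → ℝ)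
    (pole : RepClass → Prop) : Prop :=
  ∃ (p : RepClass) (q : Fin 3 → RepClass), O = insert p (Set.range q) ∧ pole p ∧
    ∀ j, HasCoordinates α (q j) β (γ j)

end FourPuncturedSphere

end

open FourPuncturedSphere Real

open FourPuncturedSphere Real
open scoped Pointwise

namespace FourPuncturedSphere

/-! ### Rotations as matrices -/

/-! Everything is read in trace coordinates. Lift `ρ(cᵢ)` to the matrix `rotAt (C i) (α i)`, of
trace `2 cos (αᵢ / 2)`. Relative Euler number 3 forces the product of the four lifts to be `-1`
(`exists_lifted_of_euler`). Conversely, for angles in `[π, 2π)` with sum more than `6π`, the product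
`-1` forces Euler number 3 (`Lifted.hasEulerNumber`). The traces `x, y, z` of `c₁c₂`, `c₂c₃`, `c₁c₃`
determine the class (`HasTraces.eq`): they give the distances between three fixed points, and the
trace of `c₁c₂c₃`, known from `α₄`, gives the orientation. They lie on Fricke's cubic surface, on
which the Dehn twists along `c₁c₂` and `c₂c₃` act by pairs of Vieta involutions. In both families,
with the special angle last, the cubic is symmetric: `x² + y² + z² + xyz = P (x + y + z) + 4 - 3P`.

Uniqueness. On a section `x = const` the twist along `c₁c₂` is an affine map whose linear part has
determinant 1 and trace `x² - 2`, so a period of at most 4 leaves few values of `x` unless the point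
is fixed. A permutation of four points has a fixed point, or is a double transposition or a 4-cycle;
in the last two cases `x` is constant on the orbit. Since `x` and `y` cannot both be constant, one
of the two twists fixes a point of the orbit. The fixed points on the surface are explicit, and only
`(P - 2, 1, 1)` and `(1, P - 2, 1)` survive (`BaseAngles.exists_leaf`).

Existence. Rotations `J` of angle `π` and `b` of angle `2π/3` whose product has angle `θ` lift to
matrices with `J² = b³ = -1`, hence define `F : SL(2, ℤ) → SL(2, ℝ)` (`exists_hom_of_relations`). A
suitable surjection `ψ` of the sphere group onto `SL(2, ℤ)`, with `c₁, c₂, c₃` sent to conjugates of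
the parabolic `genS * genU`, gives a point with traces `(1, 1, 1)`. The mapping class group
preserves the conjugacy classes of the `ψ(cᵢ)`, and such triples form at most four classes under
simultaneous conjugation (`classify_triplesTwo`, `classify_triplesThree`). So the orbit has at most
four points, and twists of `(1, 1, 1)` exhibit four. The image is the triangle group generated by
`J` and `b`.

The other orderings follow by cyclic permutation of the punctures, which normalises `PMod` and only
changes signs of traces. The angle coordinates are extracted from the traces in the disc model
(`HasTraces.hasCoordinates`). -/

/-- The lift to `SL(2, ℝ)` of the rotation of angle `t` about `w`. -/
noncomputable def rotAt (w : ℍ) (t : ℝ) : SL2R := w.toSL2R * rot t * (w.toSL2R)⁻¹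

lemma sl2_mul (g h : SL2R) (i j : Fin 2) : (g * h) i j = g i 0 * h 0 j + g i 1 * h 1 j := by
  exact (congrFun₂ (Matrix.SpecialLinearGroup.coe_mul g h) i j).trans
    (by rw [Matrix.mul_apply, Fin.sum_univ_two])

lemma sl2_inv (g : SL2R) : g⁻¹ 0 0 = g 1 1 ∧ g⁻¹ 0 1 = -g 0 1 ∧ g⁻¹ 1 0 = -g 1 0 ∧
    g⁻¹ 1 1 = g 0 0 := by
  have h : g⁻¹.1 = _ := (Matrix.SpecialLinearGroup.coe_inv g).trans (adjugate_fin_two _)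
  exact ⟨congrFun₂ h 0 0, congrFun₂ h 0 1, congrFun₂ h 1 0, congrFun₂ h 1 1⟩

lemma sl2_neg (g : SL2R) (i j : Fin 2) : (-g) i j = -g i j := rfl

lemma sl2_det (g : SL2R) : g 0 0 * g 1 1 - g 0 1 * g 1 0 = 1 := by
  rw [← Matrix.det_fin_two]; exact g.2

lemma sl2_ext {g h : SL2R} (h00 : g 0 0 = h 0 0) (h01 : g 0 1 = h 0 1) (h10 : g 1 0 = h 1 0)
    (h11 : g 1 1 = h 1 1) : g = h := by
  ext i j
  fin_cases i <;> fin_cases j <;> assumption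

lemma rot_apply (t : ℝ) : rot t 0 0 = cos (t / 2) ∧ rot t 0 1 = sin (t / 2) ∧
    rot t 1 0 = -sin (t / 2) ∧ rot t 1 1 = cos (t / 2) := ⟨rfl, rfl, rfl, rfl⟩

lemma rotAt_apply (w : ℍ) (t : ℝ) :
    rotAt w t 0 0 = cos (t / 2) - sin (t / 2) * (w.re / w.im) ∧
    rotAt w t 0 1 = sin (t / 2) * ((w.re ^ 2 + w.im ^ 2) / w.im) ∧
    rotAt w t 1 0 = -(sin (t / 2) / w.im) ∧
    rotAt w t 1 1 = cos (t / 2) + sin (t / 2) * (w.re / w.im) := by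
  have h := w.im_pos
  have h1 : √w.im ≠ 0 := (Real.sqrt_pos.2 h).ne'
  have h2 : √w.im ^ 2 = w.im := Real.sq_sqrt h.le
  have h0 : w.im ≠ 0 := h.ne'
  have e00 : w.toSL2R 0 0 = √w.im := rfl
  have e01 : w.toSL2R 0 1 = w.re / √w.im := rfl
  have e10 : w.toSL2R 1 0 = 0 := rfl
  have e11 : w.toSL2R 1 1 = 1 / √w.im := rfl
  obtain ⟨r1, r2, r3, r4⟩ := rot_apply t
  obtain ⟨i1, i2, i3, i4⟩ := sl2_inv w.toSL2R
  refine ⟨?_, ?_, ?_, ?_⟩ <;>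
    simp only [rotAt, sl2_mul, r1, r2, r3, r4, i1, i2, i3, i4, e00, e01, e10, e11] <;>
    field_simp <;> (try simp only [h2]) <;> ring

lemma smul_eq_iff (g : SL2R) (z w : ℍ) : g • z = w ↔
    (g 0 0 * z.re + g 0 1 = w.re * (g 1 0 * z.re + g 1 1) - w.im * (g 1 0 * z.im)) ∧
    (g 0 0 * z.im = w.re * (g 1 0 * z.im) + w.im * (g 1 0 * z.re + g 1 1)) := by
  have hd : (g 1 0 : ℂ) * z + (g 1 1 : ℂ) ≠ 0 := mod_cast denom_ne_zero (g : GL (Fin 2) ℝ) z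
  rw [UpperHalfPlane.ext_iff, coe_specialLinearGroup_apply]
  simp only [Algebra.algebraMap_self, RingHom.id_apply]
  rw [div_eq_iff hd, Complex.ext_iff]
  simp

lemma smul_I_eq_I (g : SL2R) (h : g • (I : ℍ) = I) : g 1 1 = g 0 0 ∧ g 1 0 = -g 0 1 := by
  rw [smul_eq_iff] at h
  simp at h
  constructor <;> linarith

/-- The stabiliser of `I` commutes with `rot t`, so the conjugate depends on `A` only through `A •
I`. -/
lemma conj_rot (A : SL2R) (t : ℝ) : A * rot t * A⁻¹ = rotAt (A • I) t := by
  set w := A • (I : ℍ) with hw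
  have hk : (w.toSL2R⁻¹ * A) • (I : ℍ) = I := by
    rw [mul_smul, ← hw, inv_smul_eq_iff, toSL2R_smul_I]
  set k := w.toSL2R⁻¹ * A with hk'
  have hA : A = w.toSL2R * k := by rw [hk']; group
  obtain ⟨h1, h2⟩ := smul_I_eq_I k hk
  have hc : k * rot t = rot t * k := by
    obtain ⟨r1, r2, r3, r4⟩ := rot_apply t
    apply sl2_ext <;> simp only [sl2_mul, r1, r2, r3, r4, h1, h2] <;> ring
  rw [rotAt, hA, _root_.mul_inv_rev]
  calc w.toSL2R * k * rot t * (k⁻¹ * w.toSL2R⁻¹) = w.toSL2R * (k * rot t) * k⁻¹ * w.toSL2R⁻¹ := by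
        group
    _ = _ := by rw [hc]; group

lemma conj_rotAt (g : SL2R) (w : ℍ) (t : ℝ) : g * rotAt w t * g⁻¹ = rotAt (g • w) t := by
  have h := conj_rot (g * w.toSL2R) t
  rw [mul_smul, toSL2R_smul_I] at h
  rw [← h, rotAt]; group

lemma isRotation_iff (g : PSL2R) (z : ℍ) (t : ℝ) : IsRotation g z t ↔ g = proj (rotAt z t) := by
  constructor
  · rintro ⟨A, rfl, rfl⟩
    rw [conj_rot]
  · rintro rfl
    exact ⟨z.toSL2R, toSL2R_smul_I z, rfl⟩

lemma proj_eq_iff (a b : SL2R) : proj a = proj b ↔ a = b ∨ a = -b := by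
  have hz : ∀ c : SL2R, c ∈ Subgroup.center SL2R ↔ c = 1 ∨ c = -1 := by
    intro c
    rw [Matrix.SpecialLinearGroup.mem_center_iff]
    constructor
    · rintro ⟨r, hr, h⟩
      simp only [Fintype.card_fin] at hr
      rcases sq_eq_one_iff.1 hr with h1 | h1
      · left; apply Subtype.ext; rw [← h, h1]; simp
      · right; apply Subtype.ext; rw [← h, h1]; ext i j; fin_cases i <;> fin_cases j <;> simp
    · rintro (rfl | rfl)
      · exact ⟨1, by simp⟩
      · exact ⟨-1, by simp, by ext i j; fin_cases i <;> fin_cases j <;> simp⟩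
  have : proj a = proj b ↔ b⁻¹ * a ∈ Subgroup.center SL2R := by
    rw [eq_comm]; exact QuotientGroup.eq
  rw [this, hz, inv_mul_eq_iff_eq_mul, inv_mul_eq_iff_eq_mul]
  simp

lemma proj_surjective : Function.Surjective proj := QuotientGroup.mk'_surjective _

lemma proj_neg (a : SL2R) : proj (-a) = proj a := (proj_eq_iff _ _).2 (Or.inr rfl)

lemma sin_half_pos {t : ℝ} (h0 : 0 < t) (h1 : t < 2 * π) : 0 < sin (t / 2) :=
  sin_pos_of_pos_of_lt_pi (by linarith) (by linarith)

lemma rotAt_injective {z w : ℍ} {t : ℝ} (h0 : 0 < t) (h1 : t < 2 * π)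
    (h : rotAt z t = rotAt w t) : z = w := by
  have hs := sin_half_pos h0 h1
  have h2 := congrArg (fun g : SL2R => g 1 0) h
  have h3 := congrArg (fun g : SL2R => g 1 1) h
  have hz := z.im_pos
  have hw := w.im_pos
  simp only [(rotAt_apply _ _).2.2.1, (rotAt_apply _ _).2.2.2] at h2 h3
  have hi : z.im = w.im := by
    field_simp at h2; linarith
  refine UpperHalfPlane.ext (Complex.ext ?_ hi)
  rw [hi] at h3
  field_simp at h3
  exact (mul_left_cancel₀ hs.ne' (by linarith : sin (t / 2) * z.re = sin (t / 2) * w.re))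

/-- The lower left entry of `rotAt` is negative for angles in `(0, 2π)`, so two such lifts never
differ by the sign `-1`. -/
lemma proj_rotAt_injective {z w : ℍ} {t : ℝ} (h0 : 0 < t) (h1 : t < 2 * π)
    (h : proj (rotAt z t) = proj (rotAt w t)) : z = w := by
  rcases (proj_eq_iff _ _).1 h with h | h
  · exact rotAt_injective h0 h1 h
  · exfalso
    have h2 := congrArg (fun g : SL2R => g 1 0) h
    simp only [(rotAt_apply _ _).2.2.1, sl2_neg] at h2
    have a1 := div_pos (sin_half_pos h0 h1) z.im_pos
    have a2 := div_pos (sin_half_pos h0 h1) w.im_pos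
    linarith

/-! ### Traces -/

/-- The trace of a matrix of `SL(2, ℝ)`. -/
def tr2 (g : SL2R) : ℝ := g 0 0 + g 1 1

lemma tr2_mul_comm (g h : SL2R) : tr2 (g * h) = tr2 (h * g) := by
  simp only [tr2, sl2_mul]; ring

lemma tr2_conj (k g : SL2R) : tr2 (k * g * k⁻¹) = tr2 g := by
  rw [tr2_mul_comm, inv_mul_cancel_left]

lemma tr2_inv (g : SL2R) : tr2 g⁻¹ = tr2 g := by
  obtain ⟨h1, _, _, h4⟩ := sl2_inv g
  simp only [tr2, h1, h4]; ring

lemma tr2_neg (g : SL2R) : tr2 (-g) = -tr2 g := by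
  simp only [tr2, sl2_neg]; ring

lemma tr2_rotAt (w : ℍ) (t : ℝ) : tr2 (rotAt w t) = 2 * cos (t / 2) := by
  obtain ⟨h1, _, _, h4⟩ := rotAt_apply w t
  simp only [tr2, h1, h4]; ring

/-- This is the hyperbolic law of cosines; it converts traces of products into distances between
fixed points. -/
lemma tr2_rotAt_mul (z w : ℍ) (s t : ℝ) : tr2 (rotAt z s * rotAt w t) =
    2 * cos (s / 2) * cos (t / 2) - 2 * sin (s / 2) * sin (t / 2) * cosh (dist z w) := by
  obtain ⟨h1, h2, h3, h4⟩ := rotAt_apply z s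
  obtain ⟨k1, k2, k3, k4⟩ := rotAt_apply w t
  have hz := z.im_pos.ne'
  have hw := w.im_pos.ne'
  rw [cosh_dist']
  simp only [tr2, sl2_mul, h1, h2, h3, h4, k1, k2, k3, k4]
  field_simp
  ring

/-- The relation between the traces of three matrices, of their products two by two and of their
product. -/
lemma fricke (a b c : SL2R) :
    tr2 (a * b) ^ 2 + tr2 (b * c) ^ 2 + tr2 (a * c) ^ 2 + tr2 (a * b) * tr2 (b * c) * tr2 (a * c) =
    (tr2 a * tr2 b + tr2 c * tr2 (a * b * c)) * tr2 (a * b) +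
    (tr2 b * tr2 c + tr2 a * tr2 (a * b * c)) * tr2 (b * c) +
    (tr2 a * tr2 c + tr2 b * tr2 (a * b * c)) * tr2 (a * c) +
    4 - tr2 a ^ 2 - tr2 b ^ 2 - tr2 c ^ 2 - tr2 (a * b * c) ^ 2 -
      tr2 a * tr2 b * tr2 c * tr2 (a * b * c) := by
  have ha := sl2_det a
  have hb := sl2_det b
  have hc := sl2_det c
  -- The relation is homogenised by the three determinants: it then holds for all matrices, as a
  -- polynomial identity.
  have key : ∀ (da db dc : ℝ), da = a 0 0 * a 1 1 - a 0 1 * a 1 0 →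
      db = b 0 0 * b 1 1 - b 0 1 * b 1 0 → dc = c 0 0 * c 1 1 - c 0 1 * c 1 0 →
    tr2 (a * b) ^ 2 * dc + tr2 (b * c) ^ 2 * da + tr2 (a * c) ^ 2 * db +
      tr2 (a * b) * tr2 (b * c) * tr2 (a * c) =
    (tr2 a * tr2 b * dc + tr2 c * tr2 (a * b * c)) * tr2 (a * b) +
    (tr2 b * tr2 c * da + tr2 a * tr2 (a * b * c)) * tr2 (b * c) +
    (tr2 a * tr2 c * db + tr2 b * tr2 (a * b * c)) * tr2 (a * c) +
    4 * da * db * dc - tr2 a ^ 2 * db * dc - tr2 b ^ 2 * da * dc - tr2 c ^ 2 * da * db -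
      tr2 (a * b * c) ^ 2 - tr2 a * tr2 b * tr2 c * tr2 (a * b * c) := by
    rintro _ _ _ rfl rfl rfl
    simp only [tr2, sl2_mul]; ring
  have := key 1 1 1 ha.symm hb.symm hc.symm
  linarith

/-- The trace of `b c` after the twist of the pair `a, b`. -/
lemma tr2_twist_left (a b c : SL2R) : tr2 (a * b * a⁻¹ * c) =
    tr2 b * tr2 c + tr2 a * tr2 (a * b * c) - tr2 (a * b) * tr2 (a * c) - tr2 (b * c) := by
  have ha := sl2_det a
  obtain ⟨h1, h2, h3, h4⟩ := sl2_inv a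
  have key : ∀ da : ℝ, da = a 0 0 * a 1 1 - a 0 1 * a 1 0 → tr2 (a * b * a⁻¹ * c) =
    tr2 b * tr2 c * da + tr2 a * tr2 (a * b * c) - tr2 (a * b) * tr2 (a * c) -
      tr2 (b * c) * da := by
    rintro _ rfl
    simp only [tr2, sl2_mul, h1, h2, h3, h4]; ring
  have := key 1 ha.symm
  linarith

/-! ### Representations of relative Euler number 3 -/

/-- The product of the lifts to `SL(2, ℝ)` of the rotations of angles `α i` about `C i`. -/
noncomputable def liftProd (α : Fin 4 → ℝ) (C : Fin 4 → ℍ) : SL2R :=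
  rotAt (C 0) (α 0) * rotAt (C 1) (α 1) * rotAt (C 2) (α 2) * rotAt (C 3) (α 3)

/-- `ρ` sends the peripheral generators to the rotations of angles `α i` about `C i`, and the
product of the standard lifts of these to `SL(2, ℝ)` is `-1`. -/
def Lifted (α : Fin 4 → ℝ) (C : Fin 4 → ℍ) (ρ : SphereRep) : Prop :=
  (∀ i, ρ (peripheral i) = proj (rotAt (C i) (α i))) ∧ liftProd α C = -1

/-- The class `p` contains a lifted representation whose products of two of the first three
peripheral matrices have traces `x`, `y`, `z`. -/
def HasTraces (α : Fin 4 → ℝ) (p : RepClass) (x y z : ℝ) : Prop :=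
  ∃ (ρ : SphereRep) (C : Fin 4 → ℍ), ρ.cls = p ∧ Lifted α C ρ ∧
    tr2 (rotAt (C 0) (α 0) * rotAt (C 1) (α 1)) = x ∧
    tr2 (rotAt (C 1) (α 1) * rotAt (C 2) (α 2)) = y ∧
    tr2 (rotAt (C 0) (α 0) * rotAt (C 2) (α 2)) = z

/-- Peripheral angles between `π` and `2π`, with sum more than `6π`. -/
structure Admissible (α : Fin 4 → ℝ) : Prop where
  pi_le : ∀ i, π ≤ α i
  lt_two_pi : ∀ i, α i < 2 * π
  sum_gt : 6 * π < α 0 + α 1 + α 2 + α 3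

namespace Admissible

variable {α : Fin 4 → ℝ} (h : Admissible α)
include h

lemma pos (i : Fin 4) : 0 < α i := lt_of_lt_of_le pi_pos (h.pi_le i)

lemma sin_pos (i : Fin 4) : 0 < sin (α i / 2) := sin_half_pos (h.pos i) (h.lt_two_pi i)

lemma cos_nonpos (i : Fin 4) : cos (α i / 2) ≤ 0 :=
  cos_nonpos_of_pi_div_two_le_of_le (by linarith [h.pi_le i]) (by linarith [h.lt_two_pi i, pi_pos])

end Admissible

lemma peripheral_prod : peripheral 0 * peripheral 1 * peripheral 2 * peripheral 3 = 1 := by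
  simp [peripheral]

/-- Only the parity of the Euler number matters: at time 1 the first basis vector has turned by
`-3π`, hence is reversed, which selects `-1` among the two lifts of the identity. -/
lemma exists_lifted_of_euler {α : Fin 4 → ℝ} {ρ : SphereRep} (h : HasEulerNumber α ρ 3) :
    ∃ C, Lifted α C ρ := by
  obtain ⟨A, u, hA, -, -, hu, hr⟩ := h
  obtain ⟨r, hr0, hr⟩ := hr 1 (by simp)
  refine ⟨fun i => A i • I, fun i => by rw [hA, conj_rot], ?_⟩
  simp only [one_mul, conj_rot] at hr
  change (liftProd α fun i => A i • I).1 *ᵥ ![1, 0] = _ at hr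
  have hc : cos (u 1) = -1 := by
    rw [hu, cos_neg, show ((3 : ℤ) : ℝ) * π = π + 2 * π by push_cast; ring, cos_add_two_pi, cos_pi]
  have h0 := congrFun hr 0
  simp [Matrix.mulVec, dotProduct, Fin.sum_univ_two, hc] at h0
  have h1 : proj (liftProd α fun i => A i • I) = proj 1 := by
    simp only [liftProd, map_mul, ← conj_rot, ← hA]
    rw [← map_mul, ← map_mul, ← map_mul, peripheral_prod, map_one, map_one]
  rcases (proj_eq_iff _ _).1 h1 with h2 | h2
  · rw [h2] at h0
    have h3 : (1 : ℝ) = -r := h0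
    linarith
  · exact h2

lemma exists_hasTraces_of_DT {α : Fin 4 → ℝ} {p : RepClass} (h : p ∈ DT α) :
    ∃ x y z, HasTraces α p x y z := by
  obtain ⟨ρ, hp, h⟩ := h
  obtain ⟨C, hC⟩ := exists_lifted_of_euler h
  exact ⟨_, _, _, ρ, C, hp, hC, rfl, rfl, rfl⟩

lemma Lifted.conj {α : Fin 4 → ℝ} {C : Fin 4 → ℍ} {ρ : SphereRep} (h : Lifted α C ρ) (g : SL2R)
    {σ : SphereRep} (hσ : ∀ x, σ x = proj g * ρ x * (proj g)⁻¹) :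
    Lifted α (fun i => g • C i) σ := by
  refine ⟨fun i => ?_, ?_⟩
  · rw [hσ, h.1, ← conj_rotAt, map_mul, map_mul, map_inv]
  · have : liftProd α (fun i => g • C i) = g * liftProd α C * g⁻¹ := by
      simp only [liftProd, ← conj_rotAt]; group
    rw [this, h.2]; simp

lemma Lifted.eq_of_cls_eq {α : Fin 4 → ℝ} (hα : ∀ i, α i ∈ Set.Ioo 0 (2 * π))
    {C C' : Fin 4 → ℍ} {ρ ρ' : SphereRep}
    (h : Lifted α C ρ) (h' : Lifted α C' ρ') (hc : ρ.cls = ρ'.cls) :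
    ∃ g : SL2R, ∀ i, C' i = g • C i := by
  obtain ⟨g, hg⟩ := Quotient.exact hc
  obtain ⟨g, rfl⟩ := proj_surjective g
  refine ⟨g, fun i => ?_⟩
  exact proj_rotAt_injective (hα i).1 (hα i).2 ((h'.1 i).symm.trans ((h.conj g hg).1 i))

/-- Conjugate representations have congruent fixed points, and the three traces depend only on
distances. -/
lemma HasTraces.unique {α : Fin 4 → ℝ} (hα : ∀ i, α i ∈ Set.Ioo 0 (2 * π)) {p : RepClass}
    {x y z x' y' z' : ℝ} (h : HasTraces α p x y z) (h' : HasTraces α p x' y' z') :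
    x = x' ∧ y = y' ∧ z = z' := by
  obtain ⟨ρ, C, rfl, hC, rfl, rfl, rfl⟩ := h
  obtain ⟨ρ', C', hp, hC', rfl, rfl, rfl⟩ := h'
  obtain ⟨g, hg⟩ := hC.eq_of_cls_eq hα hC' hp.symm
  simp only [hg, tr2_rotAt_mul, dist_smul, and_self]

/-! ### The traces determine the class -/

lemma exists_rotation_to_axis (w : ℍ) : ∃ g : SL2R, g • (I : ℍ) = I ∧
    (g • w).re = 0 ∧ 1 ≤ (g • w).im := by
  -- `Z` is a positive multiple of the conjugate of the direction of `w` in the disc centred at `I`;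
  -- rotation by its argument brings `w` to the positive axis, which is the half-line above `I`.
  set Z : ℂ := ⟨w.re ^ 2 + w.im ^ 2 - 1, 2 * w.re⟩ with hZ
  set t := Z.arg
  have h1 : ‖Z‖ * cos t = w.re ^ 2 + w.im ^ 2 - 1 := Complex.norm_mul_cos_arg Z
  have h2 : ‖Z‖ * sin t = 2 * w.re := Complex.norm_mul_sin_arg Z
  have hN := norm_nonneg Z
  have hw := w.im_pos
  obtain ⟨r1, r2, r3, r4⟩ := rot_apply t
  have hs := sin_sq_add_cos_sq (t / 2)
  have hst := sin_sq_add_cos_sq t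
  have hc2 : cos t = cos (t / 2) ^ 2 - sin (t / 2) ^ 2 := by
    rw [← cos_two_mul']; ring_nf
  have hs2 : sin t = 2 * sin (t / 2) * cos (t / 2) := by
    rw [← sin_two_mul]; ring_nf
  have e := (smul_eq_iff (rot t) w (rot t • w)).1 rfl
  have hv := (rot t • w).im_pos
  refine ⟨rot t, ?_, ?_⟩
  · rw [smul_eq_iff]; simp [r1, r2, r3, r4]
  rw [r1, r2, r3, r4] at e
  set v := rot t • w
  set c := cos (t / 2)
  set s := sin (t / 2)
  obtain ⟨e1, e2⟩ := e
  -- The squared modulus of the denominator `c - s w` of the Möbius action.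
  set D := (c - s * w.re) ^ 2 + (s * w.im) ^ 2 with hD
  have hDi : v.im * D = w.im := by
    rw [hD]; linear_combination (-(s * w.im)) * e1 - (c - s * w.re) * e2 + w.im * hs
  have hD0 : 0 < D := by
    rcases lt_or_ge 0 D with h | h
    · exact h
    · nlinarith
  have hDr : v.re * D = 0 := by
    have h3 : v.re * D = (c * w.re + s) * (c - s * w.re) - c * w.im * (s * w.im) := by
      rw [hD]; linear_combination (-(c - s * w.re)) * e1 + (s * w.im) * e2
    rw [h3]
    linear_combination (1/2 : ℝ) * sin t * h1 - (1/2 : ℝ) * cos t * h2 -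
      (1/2) * (1 - w.re ^ 2 - w.im ^ 2) * hs2 - w.re * hc2
  have hr : v.re = 0 := by
    rcases mul_eq_zero.1 hDr with h | h
    · exact h
    · exact absurd h hD0.ne'
  refine ⟨hr, ?_⟩
  -- Since `‖Z‖ ≥ 0` and `D > 0`, this identity puts the image at height at least 1.
  have hN2 : v.im ^ 2 * D = D + ‖Z‖ := by
    rw [hr] at e1 e2
    have h3 : v.im ^ 2 * D = c ^ 2 * (w.re ^ 2 + w.im ^ 2) + 2 * c * s * w.re + s ^ 2 := by
      rw [hD]
      linear_combination (-(v.im * s * w.im) - (c * w.re + s)) * e1 -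
        (v.im * (c - s * w.re) + c * w.im) * e2
    rw [h3, hD]
    linear_combination (-cos t) * h1 - sin t * h2 + ‖Z‖ * hst - (w.re ^ 2 + w.im ^ 2 - 1) * hc2
      - 2 * w.re * hs2
  by_contra hlt
  push Not at hlt
  nlinarith [mul_pos hv hD0, mul_lt_mul_of_pos_right hlt hv, mul_pos hv hv]

lemma exists_normalize (z w : ℍ) : ∃ g : SL2R, g • z = I ∧ (g • w).re = 0 ∧ 1 ≤ (g • w).im := by
  obtain ⟨g, h1, h2⟩ := exists_rotation_to_axis (z.toSL2R⁻¹ • w)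
  refine ⟨g * z.toSL2R⁻¹, ?_, ?_⟩
  · rw [mul_smul]
    have : z.toSL2R⁻¹ • z = I := by rw [inv_smul_eq_iff, toSL2R_smul_I]
    rw [this, h1]
  · rwa [mul_smul]

/-- The trace of the product of the complex structures at three points, up to a factor `-1`. It is
the oriented area of the parallelogram of the three points in the hyperboloid model. -/
noncomputable def tripleDet (a b c : ℍ) : ℝ :=
  ((b.re ^ 2 + b.im ^ 2) * (a.re - c.re) + (c.re ^ 2 + c.im ^ 2) * (b.re - a.re) +
    (a.re ^ 2 + a.im ^ 2) * (c.re - b.re)) / (a.im * b.im * c.im)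

lemma tr2_rotAt_mul_mul (a b c : ℍ) (r s t : ℝ) : tr2 (rotAt a r * rotAt b s * rotAt c t) =
    2 * cos (r / 2) * cos (s / 2) * cos (t / 2)
    - 2 * sin (r / 2) * sin (s / 2) * cos (t / 2) * cosh (dist a b)
    - 2 * sin (s / 2) * sin (t / 2) * cos (r / 2) * cosh (dist b c)
    - 2 * sin (r / 2) * sin (t / 2) * cos (s / 2) * cosh (dist a c)
    + sin (r / 2) * sin (s / 2) * sin (t / 2) * tripleDet a b c := by
  obtain ⟨h1, h2, h3, h4⟩ := rotAt_apply a r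
  obtain ⟨k1, k2, k3, k4⟩ := rotAt_apply b s
  obtain ⟨l1, l2, l3, l4⟩ := rotAt_apply c t
  have ha := a.im_pos.ne'
  have hb := b.im_pos.ne'
  have hc := c.im_pos.ne'
  rw [cosh_dist', cosh_dist', cosh_dist', tripleDet]
  simp only [tr2, sl2_mul, h1, h2, h3, h4, k1, k2, k3, k4, l1, l2, l3, l4]
  field_simp
  ring

/-- For three half-turns all cosines vanish, and `tripleDet` is the trace of their product, hence a
conjugation invariant. -/
lemma tripleDet_smul (g : SL2R) (a b c : ℍ) :
    tripleDet (g • a) (g • b) (g • c) = tripleDet a b c := by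
  have h : ∀ a b c : ℍ, tripleDet a b c = tr2 (rotAt a π * rotAt b π * rotAt c π) := by
    intro a b c
    rw [tr2_rotAt_mul_mul]; simp
  rw [h, h, ← tr2_conj g (rotAt a π * rotAt b π * rotAt c π), ← conj_rotAt, ← conj_rotAt,
    ← conj_rotAt]
  congr 1; group

lemma cosh_dist_inj {z w z' w' : ℍ} (h : cosh (dist z w) = cosh (dist z' w')) :
    dist z w = dist z' w' :=
  cosh_injOn (Set.mem_Ici.2 dist_nonneg) (Set.mem_Ici.2 dist_nonneg) h

/-- At height `v` on the axis, `cosh` of the distance to `I` is `(v + 1/v) / 2`, which is injective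
for `v ≥ 1`. -/
lemma axis_eq {v v' : ℍ} (h0 : v.re = 0) (h1 : 1 ≤ v.im) (h0' : v'.re = 0) (h1' : 1 ≤ v'.im)
    (h : dist I v = dist I v') : v = v' := by
  replace h := congrArg cosh h
  rw [cosh_dist', cosh_dist', h0, h0'] at h
  simp only [I_im, I_re] at h
  field_simp at h
  have h2 : (v.im - v'.im) * (v.im * v'.im - 1) = 0 := by linarith
  refine UpperHalfPlane.ext (Complex.ext (h0.trans h0'.symm) ?_)
  change v.im = v'.im
  rcases mul_eq_zero.1 h2 with h3 | h3
  · linarith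
  · nlinarith

/-- The distances to two points of the axis leave `w` and its mirror image; the oriented area
separates them. -/
lemma eq_of_dist_axis {v w w' : ℍ} (h0 : v.re = 0) (h1 : 1 < v.im) (h : dist I w = dist I w')
    (h' : dist v w = dist v w') (ht : tripleDet I v w = tripleDet I v w') : w = w' := by
  replace h := congrArg cosh h
  replace h' := congrArg cosh h'
  have hw := w.im_pos
  have hw' := w'.im_pos
  rw [cosh_dist', cosh_dist'] at h h'
  rw [tripleDet, tripleDet] at ht
  simp only [I_im, I_re, h0] at h h' ht
  field_simp at h h' ht
  ring_nf at h h' ht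
  have hY : 0 < v.im ^ 2 - 1 := by nlinarith
  have hi : w.im = w'.im := by
    have : (v.im ^ 2 - 1) * (w.im - w'.im) = 0 := by linear_combination h - h'
    rcases mul_eq_zero.1 this with h3 | h3 <;> linarith
  have hr : w.re = w'.re := by
    rw [hi] at ht
    have : (v.im ^ 2 - 1) * w'.im * (w.re - w'.re) = 0 := by linear_combination -ht
    rcases mul_eq_zero.1 this with h3 | h3
    · exact absurd h3 (mul_pos hY hw').ne'
    · linarith
  exact UpperHalfPlane.ext (Complex.ext hr hi)

/-- Two triples of points with the same distances and the same orientation are congruent. -/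
lemma exists_congruence {a b c a' b' c' : ℍ} (hab : dist a b = dist a' b')
    (hbc : dist b c = dist b' c') (hac : dist a c = dist a' c')
    (ht : tripleDet a b c = tripleDet a' b' c') :
    ∃ g : SL2R, a' = g • a ∧ b' = g • b ∧ c' = g • c := by
  suffices ∃ g g' : SL2R, g • a = g' • a' ∧ g • b = g' • b' ∧ g • c = g' • c' by
    obtain ⟨g, g', h1, h2, h3⟩ := this
    refine ⟨g'⁻¹ * g, ?_, ?_, ?_⟩
    · rw [mul_smul, h1, inv_smul_smul]
    · rw [mul_smul, h2, inv_smul_smul]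
    · rw [mul_smul, h3, inv_smul_smul]
  -- If the first two points coincide they do not fix a direction; the third point is then the one
  -- placed on the axis.
  by_cases h : a = b
  · have h' : a' = b' := by
      rw [h, dist_self] at hab
      exact dist_eq_zero.1 hab.symm
    subst h h'
    obtain ⟨g, h1, h2, h3⟩ := exists_normalize a c
    obtain ⟨g', h1', h2', h3'⟩ := exists_normalize a' c'
    refine ⟨g, g', h1.trans h1'.symm, h1.trans h1'.symm, axis_eq h2 h3 h2' h3' ?_⟩
    rw [← h1, dist_smul, hac, h1, ← h1', dist_smul]
  · obtain ⟨g, h1, h2, h3⟩ := exists_normalize a b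
    obtain ⟨g', h1', h2', h3'⟩ := exists_normalize a' b'
    have hb : g • b = g' • b' := axis_eq h2 h3 h2' h3' (by
      rw [← h1, dist_smul, hab, h1, ← h1', dist_smul])
    refine ⟨g, g', h1.trans h1'.symm, hb, eq_of_dist_axis (v := g • b) h2 ?_ ?_ ?_ ?_⟩
    · refine lt_of_le_of_ne h3 fun h4 => h ?_
      have : g • a = g • b := by
        rw [h1]
        exact UpperHalfPlane.ext (Complex.ext h2.symm h4)
      exact smul_left_cancel g this
    · rw [← h1, dist_smul, hac, h1, ← h1', dist_smul]
    · rw [dist_smul, hbc, hb, dist_smul]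
    · rw [← h1, tripleDet_smul, ht, h1, hb, ← h1', tripleDet_smul]

lemma tr2_three {α : Fin 4 → ℝ} {C : Fin 4 → ℍ} (h : liftProd α C = -1) :
    tr2 (rotAt (C 0) (α 0) * rotAt (C 1) (α 1) * rotAt (C 2) (α 2)) = -(2 * cos (α 3 / 2)) := by
  have : rotAt (C 0) (α 0) * rotAt (C 1) (α 1) * rotAt (C 2) (α 2) = -(rotAt (C 3) (α 3))⁻¹ := by
    rw [← mul_inv_eq_one, inv_neg, inv_inv, mul_neg]
    rw [liftProd] at h
    rw [h, neg_neg]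
  rw [this, tr2_neg, tr2_inv, tr2_rotAt]

lemma sphereRep_ext {ρ σ : SphereRep} (h0 : ρ (peripheral 0) = σ (peripheral 0))
    (h1 : ρ (peripheral 1) = σ (peripheral 1)) (h2 : ρ (peripheral 2) = σ (peripheral 2)) :
    ρ = σ := by
  refine FreeGroup.ext_hom _ _ fun i => ?_
  fin_cases i <;> assumption

/-- The traces determine the class. -/
lemma HasTraces.eq {α : Fin 4 → ℝ} (hα : ∀ i, α i ∈ Set.Ioo 0 (2 * π)) {p p' : RepClass}
    {x y z : ℝ} (h : HasTraces α p x y z) (h' : HasTraces α p' x y z) : p = p' := by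
  obtain ⟨ρ, C, rfl, hC, hx, hy, hz⟩ := h
  obtain ⟨ρ', C', rfl, hC', hx', hy', hz'⟩ := h'
  have hs : ∀ i, sin (α i / 2) ≠ 0 := fun i => (sin_half_pos (hα i).1 (hα i).2).ne'
  have key : ∀ i j, tr2 (rotAt (C i) (α i) * rotAt (C j) (α j)) =
      tr2 (rotAt (C' i) (α i) * rotAt (C' j) (α j)) → dist (C i) (C j) = dist (C' i) (C' j) := by
    intro i j h
    rw [tr2_rotAt_mul, tr2_rotAt_mul] at h
    refine cosh_dist_inj ?_
    refine mul_left_cancel₀ (mul_ne_zero (hs i) (hs j)) ?_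
    linarith
  have h01 := key 0 1 (hx.trans hx'.symm)
  have h12 := key 1 2 (hy.trans hy'.symm)
  have h02 := key 0 2 (hz.trans hz'.symm)
  -- The trace of the product of the first three matrices is fixed by `α 3`; once the distances
  -- agree, it determines `tripleDet`.
  have h3 := (tr2_three hC.2).trans (tr2_three hC'.2).symm
  rw [tr2_rotAt_mul_mul, tr2_rotAt_mul_mul, h01, h12, h02] at h3
  obtain ⟨g, g0, g1, g2⟩ := exists_congruence h01 h12 h02 (by
    refine mul_left_cancel₀ (mul_ne_zero (mul_ne_zero (hs 0) (hs 1)) (hs 2)) ?_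
    linarith)
  refine Quotient.sound ⟨proj g, fun x => ?_⟩
  have hc : ∀ i, C' i = g • C i → ρ' (peripheral i) =
      ((MulAut.conj (proj g)).toMonoidHom.comp ρ) (peripheral i) := by
    intro i hi
    change _ = proj g * ρ (peripheral i) * (proj g)⁻¹
    rw [hC'.1, hC.1, hi, ← conj_rotAt, map_mul, map_mul, map_inv]
  exact DFunLike.congr_fun (sphereRep_ext (hc 0 g0) (hc 1 g1) (hc 2 g2)) x

/-! ### Bounds on the traces -/

lemma tr2_rotAt_mul_le {z w : ℍ} {s t : ℝ} (hs : 0 ≤ sin (s / 2)) (ht : 0 ≤ sin (t / 2)) :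
    tr2 (rotAt z s * rotAt w t) ≤ 2 * cos ((s + t) / 2) := by
  rw [tr2_rotAt_mul, add_div, cos_add]
  nlinarith [mul_le_mul_of_nonneg_left (one_le_cosh (dist z w)) (mul_nonneg hs ht)]

lemma liftProd_rotate {α : Fin 4 → ℝ} {C : Fin 4 → ℍ} (h : liftProd α C = -1) :
    liftProd (fun i => α (i + 1)) (fun i => C (i + 1)) = -1 := by
  have h' : rotAt (C 1) (α 1) * rotAt (C 2) (α 2) * rotAt (C 3) (α 3) = -(rotAt (C 0) (α 0))⁻¹ := by
    have : rotAt (C 1) (α 1) * rotAt (C 2) (α 2) * rotAt (C 3) (α 3) =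
      (rotAt (C 0) (α 0))⁻¹ * liftProd α C := by rw [liftProd]; group
    rw [this, h]; simp
  change rotAt (C 1) (α 1) * rotAt (C 2) (α 2) * rotAt (C 3) (α 3) * rotAt (C 0) (α 0) = -1
  rw [h']; simp

lemma tr2_last_two {α : Fin 4 → ℝ} {C : Fin 4 → ℍ} (h : liftProd α C = -1) :
    tr2 (rotAt (C 2) (α 2) * rotAt (C 3) (α 3)) =
      -tr2 (rotAt (C 0) (α 0) * rotAt (C 1) (α 1)) := by
  have : rotAt (C 2) (α 2) * rotAt (C 3) (α 3) =
      (rotAt (C 0) (α 0) * rotAt (C 1) (α 1))⁻¹ * liftProd α C := by rw [liftProd]; group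
  rw [this, h, mul_neg, mul_one, tr2_neg, tr2_inv]

lemma tr2_upper {α : Fin 4 → ℝ} (hα : Admissible α) (C : Fin 4 → ℍ) (i j : Fin 4) :
    tr2 (rotAt (C i) (α i) * rotAt (C j) (α j)) ≤ 2 * cos ((α i + α j) / 2) :=
  tr2_rotAt_mul_le (hα.sin_pos i).le (hα.sin_pos j).le

lemma Admissible.rotate {α : Fin 4 → ℝ} (hα : Admissible α) :
    Admissible (fun i => α (i + 1)) := by
  refine ⟨fun i => hα.pi_le _, fun i => hα.lt_two_pi _, ?_⟩
  have := hα.sum_gt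
  change 6 * π < α 1 + α 2 + α 3 + α 0
  linarith

lemma Admissible.mem_Ioo {α : Fin 4 → ℝ} (hα : Admissible α) (i : Fin 4) :
    α i ∈ Set.Ioo 0 (2 * π) := ⟨hα.pos i, hα.lt_two_pi i⟩

/-- Upper bounds come from `cosh ≥ 1` in the law of cosines. Lower bounds are the upper bounds of
the complementary pair, whose product is minus an inverse. -/
lemma HasTraces.bounds {α : Fin 4 → ℝ} (hα : Admissible α) {p : RepClass} {x y z : ℝ}
    (h : HasTraces α p x y z) :
    x ≤ 2 * cos ((α 0 + α 1) / 2) ∧ -(2 * cos ((α 2 + α 3) / 2)) ≤ x ∧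
    y ≤ 2 * cos ((α 1 + α 2) / 2) ∧ -(2 * cos ((α 3 + α 0) / 2)) ≤ y := by
  obtain ⟨ρ, C, rfl, hC, rfl, rfl, rfl⟩ := h
  have h1 := tr2_last_two hC.2
  have h2 := tr2_last_two (liftProd_rotate hC.2)
  have h3 := tr2_upper hα C 2 3
  have h4 := tr2_upper hα C 3 0
  refine ⟨tr2_upper hα C 0 1, by linarith, tr2_upper hα C 1 2, ?_⟩
  change tr2 (rotAt (C 3) (α 3) * rotAt (C 0) (α 0)) = -tr2 (rotAt (C 1) (α 1) * rotAt (C 2) (α 2))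
    at h2
  linarith

lemma HasTraces.cubic {α : Fin 4 → ℝ} {p : RepClass} {x y z : ℝ} (h : HasTraces α p x y z) :
    x ^ 2 + y ^ 2 + z ^ 2 + x * y * z =
      4 * (cos (α 0 / 2) * cos (α 1 / 2) - cos (α 2 / 2) * cos (α 3 / 2)) * x +
      4 * (cos (α 1 / 2) * cos (α 2 / 2) - cos (α 0 / 2) * cos (α 3 / 2)) * y +
      4 * (cos (α 0 / 2) * cos (α 2 / 2) - cos (α 1 / 2) * cos (α 3 / 2)) * z +
      4 - 4 * (cos (α 0 / 2) ^ 2 + cos (α 1 / 2) ^ 2 + cos (α 2 / 2) ^ 2 + cos (α 3 / 2) ^ 2) +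
      16 * cos (α 0 / 2) * cos (α 1 / 2) * cos (α 2 / 2) * cos (α 3 / 2) := by
  obtain ⟨ρ, C, rfl, hC, rfl, rfl, rfl⟩ := h
  have := fricke (rotAt (C 0) (α 0)) (rotAt (C 1) (α 1)) (rotAt (C 2) (α 2))
  rw [tr2_three hC.2, tr2_rotAt, tr2_rotAt, tr2_rotAt] at this
  rw [this]; ring

/-! ### The sign of an elliptic matrix -/

/-- Up to the factor `im w`, the trace against the half-turn at `w` is a quadratic form in `w` with
leading coefficient `g 1 0` and discriminant `tr² - 4 < 0`. The form is definite, so one value tells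
its sign. -/
lemma elliptic_pos {g : SL2R} (h1 : |tr2 g| < 2) (w : ℍ)
    (h2 : tr2 (g * rotAt w π) > 0) : 0 < g 1 0 := by
  obtain ⟨r1, r2, r3, r4⟩ := rotAt_apply w π
  have hd := sl2_det g
  have hw := w.im_pos
  have e : tr2 (g * rotAt w π) * w.im = g 1 0 * (w.re ^ 2 + w.im ^ 2) + (g 1 1 - g 0 0) * w.re
      - g 0 1 := by
    simp only [tr2, sl2_mul, r1, r2, r3, r4, sin_pi_div_two, cos_pi_div_two]
    field_simp
    ring
  have hpos := mul_pos h2 hw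
  rw [e] at hpos
  have ht : (g 0 0 + g 1 1) ^ 2 < 4 := by
    have := sq_lt_sq' (abs_lt.1 h1).1 (abs_lt.1 h1).2
    rw [tr2] at this; linarith
  by_contra hneg
  push Not at hneg
  rcases hneg.lt_or_eq with h | h
  · have h3 : 0 < -g 1 0 * (g 1 0 * (w.re ^ 2 + w.im ^ 2) + (g 1 1 - g 0 0) * w.re - g 0 1) :=
      mul_pos (by linarith) hpos
    nlinarith [sq_nonneg (2 * g 1 0 * w.re + (g 1 1 - g 0 0)), mul_pos_of_neg_of_neg h h,
      mul_pos (mul_pos_of_neg_of_neg h h) (mul_pos hw hw)]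
  · rw [h] at hd
    nlinarith [sq_nonneg (g 0 0 - g 1 1)]

lemma two_cos_lt {t : ℝ} (h1 : 0 < t) (h2 : t < 2 * π) : 2 * cos t < 2 := by
  have : cos t < 1 := by
    have h3 := sin_half_pos h1 h2
    have h4 : cos t = 1 - 2 * sin (t / 2) ^ 2 := by
      rw [show t = 2 * (t / 2) by ring, cos_two_mul, cos_sq']; ring_nf
    nlinarith [mul_pos h3 h3]
  linarith

lemma abs_tr2_first {α : Fin 4 → ℝ} (hα : Admissible α) {C : Fin 4 → ℍ}
    (h : liftProd α C = -1) : |tr2 (rotAt (C 0) (α 0) * rotAt (C 1) (α 1))| < 2 := by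
  have h1 := tr2_last_two h
  have h3 := tr2_upper hα C 2 3
  have h4 := tr2_upper hα C 0 1
  have a : ∀ i j, 2 * cos ((α i + α j) / 2) < 2 := fun i j =>
    two_cos_lt (by linarith [hα.pos i, hα.pos j]) (by linarith [hα.lt_two_pi i, hα.lt_two_pi j])
  rw [abs_lt]
  constructor <;> linarith [a 2 3, a 0 1]

/-- The sign is tested at `C 0`, where angles of at least `π` make both terms of the trace
nonnegative. -/
lemma first_two_pos {α : Fin 4 → ℝ} (hα : Admissible α) {C : Fin 4 → ℍ}
    (h : liftProd α C = -1) : 0 < (rotAt (C 0) (α 0) * rotAt (C 1) (α 1)) 1 0 := by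
  refine elliptic_pos (abs_tr2_first hα h) (C 0) ?_
  have e : tr2 (rotAt (C 0) (α 0) * rotAt (C 1) (α 1) * rotAt (C 0) π) =
      -2 * cos (α 0 / 2) * sin (α 1 / 2) * cosh (dist (C 1) (C 0))
      - 2 * sin (α 0 / 2) * cos (α 1 / 2) := by
    rw [tr2_rotAt_mul_mul]
    simp [tripleDet]
    ring
  rw [e]
  have hs0 := hα.sin_pos 0
  have hs1 := hα.sin_pos 1
  have hc0 := hα.cos_nonpos 0
  have hc1 := hα.cos_nonpos 1
  have hch := cosh_pos (dist (C 1) (C 0))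
  have h1 : 0 ≤ -cos (α 0 / 2) * sin (α 1 / 2) * cosh (dist (C 1) (C 0)) := by
    have : 0 ≤ -cos (α 0 / 2) := by linarith
    positivity
  rcases hc1.lt_or_eq with h2 | h2
  · nlinarith [mul_pos hs0 (neg_pos.2 h2)]
  · rcases hc0.lt_or_eq with h3 | h3
    · have := mul_pos (mul_pos (neg_pos.2 h3) hs1) hch
      rw [h2]; nlinarith
    · exfalso
      -- Both cosines vanish only if two angles equal `π`; the other two, less than `2π`, cannot
      -- then bring the sum above `6π`.
      have b : ∀ i, cos (α i / 2) = 0 → α i = π := by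
        intro i hi
        by_contra hne
        have : π < α i := lt_of_le_of_ne (hα.pi_le i) (Ne.symm hne)
        have := cos_neg_of_pi_div_two_lt_of_lt (x := α i / 2) (by linarith)
          (by linarith [hα.lt_two_pi i, pi_pos])
        linarith
      have := hα.sum_gt
      linarith [b 0 h3, b 1 h2, hα.lt_two_pi 2, hα.lt_two_pi 3]

/-! ### Computation of the relative Euler number -/

/-- The linear action of `SL(2, ℝ)` on the plane `ℂ`. -/
noncomputable def act (g : SL2R) (v : ℂ) : ℂ :=
  ⟨g 0 0 * v.re + g 0 1 * v.im, g 1 0 * v.re + g 1 1 * v.im⟩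

lemma act_mul (g h : SL2R) (v : ℂ) : act (g * h) v = act g (act h v) := by
  apply Complex.ext <;> simp only [act, sl2_mul] <;> ring

lemma act_ne_zero (g : SL2R) {v : ℂ} (hv : v ≠ 0) : act g v ≠ 0 := by
  intro h
  apply hv
  have hd := sl2_det g
  have h1 : g 0 0 * v.re + g 0 1 * v.im = 0 := congrArg Complex.re h
  have h2 : g 1 0 * v.re + g 1 1 * v.im = 0 := congrArg Complex.im h
  apply Complex.ext
  · change v.re = 0
    linear_combination g 1 1 * h1 - g 0 1 * h2 - v.re * hd
  · change v.im = 0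
    linear_combination g 0 0 * h2 - g 1 0 * h1 - v.im * hd

lemma act_one (v : ℂ) : act 1 v = v := by
  apply Complex.ext <;> simp [act]

lemma rotAt_zero (w : ℍ) : rotAt w 0 = 1 := by
  obtain ⟨r1, r2, r3, r4⟩ := rotAt_apply w 0
  apply sl2_ext
  · rw [r1]; simp
  · rw [r2]; simp
  · rw [r3]; simp
  · rw [r4]; simp

/-- `k` is a positive definite form in `v` over `|v|²`. Thus, for angles in `(0, 2π)`, the linear
action turns every vector clockwise, by less than `π`, and principal arguments measure the turn
without ambiguity. -/
lemma act_rotAt_div_im (w : ℍ) (t : ℝ) {v : ℂ} (hv : v ≠ 0) : ∃ k : ℝ, 0 < k ∧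
    (act (rotAt w t) v / v).im = -(sin (t / 2) * k) := by
  obtain ⟨r1, r2, r3, r4⟩ := rotAt_apply w t
  have hw := w.im_pos
  have hn : 0 < Complex.normSq v := Complex.normSq_pos.2 hv
  refine ⟨((v.re - w.re * v.im) ^ 2 + (w.im * v.im) ^ 2) / (w.im * Complex.normSq v), ?_, ?_⟩
  · refine div_pos ?_ (mul_pos hw hn)
    by_cases h : v.im = 0
    · have : v.re ≠ 0 := fun h' => hv (Complex.ext h' h)
      rw [h]; simp; positivity
    · positivity
  · rw [Complex.div_im]
    simp only [act, r1, r2, r3, r4]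
    field_simp
    ring

lemma act_rot_mem_slitPlane (w : ℍ) {t : ℝ} (h0 : 0 ≤ t) (h1 : t < 2 * π) {v : ℂ} (hv : v ≠ 0) :
    act (rotAt w t) v / v ∈ Complex.slitPlane := by
  obtain ⟨k, hk, h⟩ := act_rotAt_div_im w t hv
  rcases h0.lt_or_eq with h0 | h0
  · right
    rw [h]
    exact (neg_neg_of_pos (mul_pos (sin_half_pos h0 h1) hk)).ne
  · left
    rw [← h0, rotAt_zero, act_one, div_self hv]; simp

lemma arg_act_rot (w : ℍ) {t : ℝ} (h0 : 0 < t) (h1 : t < 2 * π) {v : ℂ} (hv : v ≠ 0) :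
    (act (rotAt w t) v / v).arg ∈ Set.Ioo (-π) 0 := by
  obtain ⟨k, hk, h⟩ := act_rotAt_div_im w t hv
  refine ⟨Complex.neg_pi_lt_arg _, Complex.arg_neg_iff.2 ?_⟩
  rw [h]
  exact neg_neg_of_pos (mul_pos (sin_half_pos h0 h1) hk)

lemma continuous_act_rotAt (w : ℍ) (a : ℝ) {f : ℝ → ℂ} (hf : Continuous f) :
    Continuous fun s => act (rotAt w (s * a)) (f s) := by
  have h : ∀ s, act (rotAt w (s * a)) (f s) =
      ((cos (s * a / 2) - sin (s * a / 2) * (w.re / w.im)) * (f s).re +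
        sin (s * a / 2) * ((w.re ^ 2 + w.im ^ 2) / w.im) * (f s).im : ℝ) +
      (-(sin (s * a / 2) / w.im) * (f s).re +
        (cos (s * a / 2) + sin (s * a / 2) * (w.re / w.im)) * (f s).im : ℝ) * Complex.I := by
    intro s
    obtain ⟨r1, r2, r3, r4⟩ := rotAt_apply w (s * a)
    rw [Complex.ext_iff]
    simp only [act, r1, r2, r3, r4, Complex.add_re, Complex.ofReal_re, Complex.re_ofReal_mul,
      Complex.I_re, mul_zero, add_zero, Complex.add_im, Complex.ofReal_im, Complex.im_ofReal_mul,
      Complex.I_im, mul_one, zero_add, and_self]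
  simp only [h]
  have h1 := Complex.continuous_re.comp hf
  have h2 := Complex.continuous_im.comp hf
  simp only [Function.comp_def] at h1 h2
  have h3 : Continuous fun s : ℝ => cos (s * a / 2) := by fun_prop
  have h4 : Continuous fun s : ℝ => sin (s * a / 2) := by fun_prop
  fun_prop

lemma exp_arg_add {a b : ℂ} {s t : ℝ} (ha : a = ‖a‖ * Complex.exp (s * Complex.I))
    (hb : b = ‖b‖ * Complex.exp (t * Complex.I)) :
    a * b = ‖a * b‖ * Complex.exp ((s + t : ℝ) * Complex.I) := by
  rw [norm_mul]
  conv_lhs => rw [ha, hb]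
  push_cast
  rw [add_mul, Complex.exp_add]; ring

lemma polar_im {w : ℂ} {t : ℝ} (hw : w = ‖w‖ * Complex.exp (t * Complex.I)) :
    w.im = ‖w‖ * sin t ∧ w.re = ‖w‖ * cos t := by
  constructor
  · conv_lhs => rw [hw]
    rw [Complex.im_ofReal_mul, Complex.exp_ofReal_mul_I_im]
  · conv_lhs => rw [hw]
    rw [Complex.re_ofReal_mul, Complex.exp_ofReal_mul_I_re]

/-- A clockwise turn of at most `π` from the positive real axis stays in the closed lower
half-plane. -/
lemma lt_neg_pi_of_im_pos {w : ℂ} {s t : ℝ} (hs : s ∈ Set.Ioo (-π) 0) (ht : t ∈ Set.Ioo (-π) 0)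
    (hw : w = ‖w‖ * Complex.exp ((s + t : ℝ) * Complex.I)) (him : 0 < w.im) : s + t < -π := by
  by_contra h
  push Not at h
  rw [(polar_im hw).1] at him
  have := sin_nonpos_of_nonpos_of_neg_pi_le (x := s + t) (by linarith [hs.2, ht.2]) h
  nlinarith [norm_nonneg w]

lemma exp_arg_div {a b c : ℂ} (hb : b ≠ 0) : a / c = ‖a / c‖ *
    Complex.exp (((a / b).arg + (b / c).arg : ℝ) * Complex.I) := by
  have hpol : ∀ z : ℂ, z = ‖z‖ * Complex.exp (z.arg * Complex.I) := fun z =>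
    (Complex.norm_mul_exp_arg_mul_I z).symm
  have := exp_arg_add (hpol (a / b)) (hpol (b / c))
  rwa [div_mul_div_cancel₀ hb] at this

lemma last_two_pos {α : Fin 4 → ℝ} (hα : Admissible α) {C : Fin 4 → ℍ}
    (h : liftProd α C = -1) : 0 < (rotAt (C 2) (α 2) * rotAt (C 3) (α 3)) 1 0 := by
  have ha := hα.rotate.rotate
  have hb := liftProd_rotate h
  have hc := liftProd_rotate hb
  have h1 := first_two_pos ha hc
  have e2 : (0 : Fin 4) + 1 + 1 = 2 := rfl
  have e3 : (1 : Fin 4) + 1 + 1 = 3 := rfl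
  simp only [e2, e3] at h1
  exact h1

/-- Each of the four turns lies in `(-π, 0)`. The last two together carry `1` to the upper
half-plane, hence turn by less than `-π`, and so do the first two. The total lies in `(-4π, -2π)`
and ends at `-1`, so it is `-3π`. -/
lemma arg_sum_eq {α : Fin 4 → ℝ} (hα : Admissible α) {C : Fin 4 → ℍ} (h : liftProd α C = -1)
    {v0 v1 v2 v3 : ℂ} (h3 : v3 = act (rotAt (C 3) (α 3)) 1) (h2 : v2 = act (rotAt (C 2) (α 2)) v3)
    (h1 : v1 = act (rotAt (C 1) (α 1)) v2) (h0 : v0 = act (rotAt (C 0) (α 0)) v1) :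
    ((v0 / v1).arg + (v1 / v2).arg) + ((v2 / v3).arg + (v3 / 1).arg) = -(3 * π) := by
  have n3 : v3 ≠ 0 := by rw [h3]; exact act_ne_zero _ one_ne_zero
  have n2 : v2 ≠ 0 := by rw [h2]; exact act_ne_zero _ n3
  have n1 : v1 ≠ 0 := by rw [h1]; exact act_ne_zero _ n2
  have hA : ∀ (i : Fin 4) (v : ℂ), v ≠ 0 →
      (act (rotAt (C i) (α i)) v / v).arg ∈ Set.Ioo (-π) 0 := fun i v hv =>
    arg_act_rot (C i) (hα.pos i) (hα.lt_two_pi i) hv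
  have a0 := hA 0 v1 n1
  have a1 := hA 1 v2 n2
  have a2 := hA 2 v3 n3
  have a3 := hA 3 1 one_ne_zero
  rw [← h0] at a0
  rw [← h1] at a1
  rw [← h2] at a2
  rw [← h3] at a3
  have hw0 : v0 = -1 := by
    rw [h0, h1, h2, h3, ← act_mul, ← act_mul, ← act_mul, ← liftProd, h]
    apply Complex.ext <;> simp [act, sl2_neg]
  have hw2 : 0 < v2.im := by
    have e : (act (rotAt (C 2) (α 2) * rotAt (C 3) (α 3)) 1).im =
        (rotAt (C 2) (α 2) * rotAt (C 3) (α 3)) 1 0 := by simp only [act]; simp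
    rw [h2, h3, ← act_mul, e]
    exact last_two_pos hα h
  have p2 := exp_arg_div (a := v2) (c := 1) n3
  have p02 := exp_arg_div (a := v0) (c := v2) n1
  have p0 := exp_arg_add p02 p2
  rw [div_one v2, div_mul_cancel₀ _ n2] at p0
  rw [div_one v2] at p2
  have b1 := lt_neg_pi_of_im_pos a2 a3 p2 hw2
  have b2 := lt_neg_pi_of_im_pos a0 a1 p02 (by
    rw [hw0, neg_div, one_div, Complex.neg_im, Complex.inv_im, neg_div, neg_neg]
    exact div_pos hw2 (Complex.normSq_pos.2 n2))
  have p0' := (polar_im p0).1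
  have him : v0.im = 0 := by rw [hw0]; simp
  have hno : ‖v0‖ = 1 := by rw [hw0]; simp
  rw [him, hno, one_mul] at p0'
  have b3 := Complex.neg_pi_lt_arg (v0 / v1)
  have b4 := Complex.neg_pi_lt_arg (v1 / v2)
  have b5 := Complex.neg_pi_lt_arg (v2 / v3)
  have b6 := Complex.neg_pi_lt_arg (v3 / 1)
  set t := (v0 / v1).arg + (v1 / v2).arg + ((v2 / v3).arg + (v3 / 1).arg) with ht
  have h4 : sin (t + 3 * π) = 0 := by
    rw [show t + 3 * π = t + π + 2 * π by ring, sin_add_two_pi, sin_add_pi, ← p0', neg_zero]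
  have := (sin_eq_zero_iff_of_lt_of_lt (by linarith) (by linarith)).1 h4
  linarith

/-- The direction is followed as the sum of the principal arguments of the four successive
quotients, which stay in the slit plane and therefore have continuous arguments. -/
lemma Lifted.hasEulerNumber {α : Fin 4 → ℝ} (hα : Admissible α) {C : Fin 4 → ℍ} {ρ : SphereRep}
    (h : Lifted α C ρ) : HasEulerNumber α ρ 3 := by
  let w3 : ℝ → ℂ := fun s => act (rotAt (C 3) (s * α 3)) 1
  let w2 : ℝ → ℂ := fun s => act (rotAt (C 2) (s * α 2)) (w3 s)
  let w1 : ℝ → ℂ := fun s => act (rotAt (C 1) (s * α 1)) (w2 s)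
  let w0 : ℝ → ℂ := fun s => act (rotAt (C 0) (s * α 0)) (w1 s)
  have n3 : ∀ s, w3 s ≠ 0 := fun s => act_ne_zero _ one_ne_zero
  have n2 : ∀ s, w2 s ≠ 0 := fun s => act_ne_zero _ (n3 s)
  have n1 : ∀ s, w1 s ≠ 0 := fun s => act_ne_zero _ (n2 s)
  have n0 : ∀ s, w0 s ≠ 0 := fun s => act_ne_zero _ (n1 s)
  have c3 : Continuous w3 := continuous_act_rotAt _ _ continuous_const
  have c2 : Continuous w2 := continuous_act_rotAt _ _ c3
  have c1 : Continuous w1 := continuous_act_rotAt _ _ c2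
  have c0 : Continuous w0 := continuous_act_rotAt _ _ c1
  let u : ℝ → ℝ := fun s => ((w0 s / w1 s).arg + (w1 s / w2 s).arg) +
    ((w2 s / w3 s).arg + (w3 s / 1).arg)
  have hpol0 : ∀ s, w0 s = ‖w0 s‖ * Complex.exp ((u s : ℝ) * Complex.I) := by
    intro s
    have := exp_arg_add (exp_arg_div (a := w0 s) (c := w2 s) (n1 s))
      (exp_arg_div (a := w2 s) (c := 1) (n3 s))
    rwa [div_one (w2 s), div_mul_cancel₀ _ (n2 s)] at this
  have hprod : ∀ s, w0 s = act (liftProd (fun i => s * α i) C) 1 := by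
    intro s
    rw [liftProd, act_mul, act_mul, act_mul]
  have hcont : ∀ (z : ℍ) (i : Fin 4) (f : ℝ → ℂ), (∀ s, f s ≠ 0) → Continuous f →
      ContinuousOn (fun s => (act (rotAt z (s * α i)) (f s) / f s).arg) (Set.Icc 0 1) := by
    intro z i f hf hc s hs
    have h0 := hα.pos i
    have h1 := hα.lt_two_pi i
    refine ContinuousAt.comp_continuousWithinAt (g := Complex.arg) (Complex.continuousAt_arg
      (act_rot_mem_slitPlane z (mul_nonneg hs.1 h0.le) ?_ (hf s))) ?_
    · nlinarith [hs.2]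
    · exact (((continuous_act_rotAt z (α i) hc).div hc hf).continuousAt).continuousWithinAt
  refine ⟨fun i => (C i).toSL2R, u, fun i => h.1 i, ?_, ?_, ?_, ?_⟩
  · exact ((hcont _ 0 w1 n1 c1).add (hcont _ 1 w2 n2 c2)).add
      ((hcont _ 2 w3 n3 c3).add (hcont _ 3 (fun _ => 1) (fun _ => one_ne_zero) continuous_const))
  · simp only [u, w0, w1, w2, w3, zero_mul, rotAt_zero, act_one]
    simp
  · have e : ∀ a : ℝ, 1 * a = a := one_mul
    push_cast
    exact arg_sum_eq hα h.2 (by simp only [w3, e]) (by simp only [w2, e]) (by simp only [w1, e])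
      (by simp only [w0, e])
  · intro s _
    refine ⟨‖w0 s‖, norm_pos_iff.2 (n0 s), ?_⟩
    obtain ⟨h1, h2⟩ := polar_im (hpol0 s)
    change (liftProd (fun i => s * α i) C).1 *ᵥ ![1, 0] = _
    have e := hprod s
    ext i
    fin_cases i
    · simp [Matrix.mulVec, dotProduct, Fin.sum_univ_two]
      rw [← h2, e]; simp [act]
    · simp [Matrix.mulVec, dotProduct, Fin.sum_univ_two]
      rw [← h1, e]; simp [act]

lemma HasTraces.mem_DT {α : Fin 4 → ℝ} (hα : Admissible α) {p : RepClass} {x y z : ℝ}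
    (h : HasTraces α p x y z) : p ∈ DT α := by
  obtain ⟨ρ, C, hp, hC, -⟩ := h
  exact ⟨ρ, hp, hC.hasEulerNumber hα⟩

/-! ### Invariance under the pure mapping class group -/

lemma peripheral_three : peripheral 3 = (peripheral 0 * peripheral 1 * peripheral 2)⁻¹ := rfl

/-- The lift to `SL(2, ℝ)` of a representation. -/
noncomputable def liftHom (α : Fin 4 → ℝ) (C : Fin 4 → ℍ) : SphereGroup →* SL2R :=
  FreeGroup.lift fun i : Fin 3 => rotAt (C i.castSucc) (α i.castSucc)

lemma liftHom_zero (α : Fin 4 → ℝ) (C : Fin 4 → ℍ) :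
    liftHom α C (peripheral 0) = rotAt (C 0) (α 0) := FreeGroup.lift_apply_of

lemma liftHom_one (α : Fin 4 → ℝ) (C : Fin 4 → ℍ) :
    liftHom α C (peripheral 1) = rotAt (C 1) (α 1) := FreeGroup.lift_apply_of

lemma liftHom_two (α : Fin 4 → ℝ) (C : Fin 4 → ℍ) :
    liftHom α C (peripheral 2) = rotAt (C 2) (α 2) := FreeGroup.lift_apply_of

lemma liftHom_three {α : Fin 4 → ℝ} {C : Fin 4 → ℍ} (h : liftProd α C = -1) :
    liftHom α C (peripheral 3) = -rotAt (C 3) (α 3) := by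
  rw [peripheral_three, map_inv, map_mul, map_mul, liftHom_zero, liftHom_one, liftHom_two,
    inv_eq_iff_mul_eq_one, mul_neg, ← liftProd, h, neg_neg]

lemma Lifted.eq_liftHom {α : Fin 4 → ℝ} {C : Fin 4 → ℍ} {ρ : SphereRep} (h : Lifted α C ρ) :
    ρ = proj.comp (liftHom α C) := by
  apply sphereRep_ext
  · rw [h.1, MonoidHom.comp_apply, liftHom_zero]
  · rw [h.1, MonoidHom.comp_apply, liftHom_one]
  · rw [h.1, MonoidHom.comp_apply, liftHom_two]

/-- The sign of the product survives because `liftHom` sends `c₄` to minus its standard lift, and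
conjugation preserves this minus sign. -/
lemma Lifted.comp {α : Fin 4 → ℝ} {C : Fin 4 → ℍ} {ρ : SphereRep} (h : Lifted α C ρ)
    (f : SphereGroup →* SphereGroup) (g : Fin 4 → SphereGroup)
    (hf : ∀ i, f (peripheral i) = g i * peripheral i * (g i)⁻¹) :
    Lifted α (fun i => liftHom α C (g i) • C i) (ρ.comp f) := by
  have e0 := liftHom_zero α C
  have e1 := liftHom_one α C
  have e2 := liftHom_two α C
  have e3 := liftHom_three h.2
  refine ⟨fun i => ?_, ?_⟩
  · rw [MonoidHom.comp_apply, hf, map_mul, map_mul, map_inv, h.1, ← conj_rotAt, map_mul, map_mul,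
      map_inv]
    conv_lhs => rw [h.eq_liftHom]
    rfl
  · have hp := congrArg (liftHom α C) (congrArg f peripheral_prod)
    rw [map_mul f, map_mul f, map_mul f, hf, hf, hf, hf, map_one, map_one] at hp
    simp only [map_mul, map_inv, e0, e1, e2, e3] at hp
    simp only [liftProd, ← conj_rotAt]
    rw [← hp]
    simp

lemma Lifted.pmod {α : Fin 4 → ℝ} {C : Fin 4 → ℍ} {ρ : SphereRep} (h : Lifted α C ρ)
    {φ : MulAut SphereGroup} (hφ : φ ∈ PMod) :
    ∃ C', Lifted α C' (ρ.comp (φ⁻¹ : MulAut SphereGroup).toMonoidHom) := by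
  have h1 : ∀ i, IsConj (peripheral i) ((φ⁻¹ : MulAut SphereGroup) (peripheral i)) :=
    PMod.inv_mem hφ
  choose g hg using fun i => isConj_iff.1 (h1 i)
  exact ⟨_, h.comp _ g fun i => (hg i).symm⟩

lemma smul_cls (φ : MulAut SphereGroup) (ρ : SphereRep) :
    φ • ρ.cls = SphereRep.cls (ρ.comp (φ⁻¹ : MulAut SphereGroup).toMonoidHom) := rfl

lemma HasTraces.smul {α : Fin 4 → ℝ} {p : RepClass} {x y z : ℝ} (h : HasTraces α p x y z)
    {φ : MulAut SphereGroup} (hφ : φ ∈ PMod) : ∃ x' y' z', HasTraces α (φ • p) x' y' z' := by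
  obtain ⟨ρ, C, rfl, hC, -⟩ := h
  obtain ⟨C', hC'⟩ := hC.pmod hφ
  exact ⟨_, _, _, _, C', rfl, hC', rfl, rfl, rfl⟩

/-! ### Dehn twists -/

/-- An automorphism given by its values and those of its inverse on the generators. -/
noncomputable def mkAut (f g : Fin 3 → SphereGroup)
    (h1 : ∀ i, FreeGroup.lift g (f i) = FreeGroup.of i)
    (h2 : ∀ i, FreeGroup.lift f (g i) = FreeGroup.of i) : MulAut SphereGroup :=
  MonoidHom.toMulEquiv (FreeGroup.lift f) (FreeGroup.lift g)
    (FreeGroup.ext_hom _ _ fun i => by simp [h1]) (FreeGroup.ext_hom _ _ fun i => by simp [h2])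

/-- The inverse of the Dehn twist along `c₁c₂` conjugates `c₁` and `c₂` by `c₁c₂`. -/
noncomputable def twistB : MulAut SphereGroup :=
  mkAut
    ![(peripheral 0 * peripheral 1)⁻¹ * peripheral 0 * (peripheral 0 * peripheral 1),
      (peripheral 0 * peripheral 1)⁻¹ * peripheral 1 * (peripheral 0 * peripheral 1), peripheral 2]
    ![(peripheral 0 * peripheral 1) * peripheral 0 * (peripheral 0 * peripheral 1)⁻¹,
      (peripheral 0 * peripheral 1) * peripheral 1 * (peripheral 0 * peripheral 1)⁻¹, peripheral 2]
    (by intro i; fin_cases i <;> simp [peripheral] <;> group)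
    (by intro i; fin_cases i <;> simp [peripheral] <;> group)

/-- The inverse of the Dehn twist along `c₂c₃` conjugates `c₂` and `c₃` by `c₂c₃`. -/
noncomputable def twistD : MulAut SphereGroup :=
  mkAut
    ![peripheral 0, (peripheral 1 * peripheral 2)⁻¹ * peripheral 1 * (peripheral 1 * peripheral 2),
      (peripheral 1 * peripheral 2)⁻¹ * peripheral 2 * (peripheral 1 * peripheral 2)]
    ![peripheral 0, (peripheral 1 * peripheral 2) * peripheral 1 * (peripheral 1 * peripheral 2)⁻¹,
      (peripheral 1 * peripheral 2) * peripheral 2 * (peripheral 1 * peripheral 2)⁻¹]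
    (by intro i; fin_cases i <;> simp [peripheral] <;> group)
    (by intro i; fin_cases i <;> simp [peripheral] <;> group)

/-- The automorphism whose inverse is the cyclic permutation `c₁ ↦ c₂ ↦ c₃ ↦ c₄ ↦ c₁`. -/
noncomputable def cycle : MulAut SphereGroup :=
  mkAut ![peripheral 3, peripheral 0, peripheral 1] ![peripheral 1, peripheral 2, peripheral 3]
    (by intro i; fin_cases i <;> simp [peripheral])
    (by intro i; fin_cases i <;> simp [peripheral, mul_assoc])

lemma twistB_inv (i : Fin 4) : (twistB⁻¹ : MulAut SphereGroup) (peripheral i) =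
    (![peripheral 0 * peripheral 1, peripheral 0 * peripheral 1, 1, 1] i) * peripheral i *
      (![peripheral 0 * peripheral 1, peripheral 0 * peripheral 1, 1, 1] i)⁻¹ := by
  have h : ∀ x, (twistB⁻¹ : MulAut SphereGroup) x = FreeGroup.lift
    ![(peripheral 0 * peripheral 1) * peripheral 0 * (peripheral 0 * peripheral 1)⁻¹,
      (peripheral 0 * peripheral 1) * peripheral 1 * (peripheral 0 * peripheral 1)⁻¹,
      peripheral 2] x := fun x => rfl
  rw [h]
  fin_cases i <;> (simp [peripheral]; try group)

lemma twistD_inv (i : Fin 4) : (twistD⁻¹ : MulAut SphereGroup) (peripheral i) =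
    (![1, peripheral 1 * peripheral 2, peripheral 1 * peripheral 2, 1] i) * peripheral i *
      (![1, peripheral 1 * peripheral 2, peripheral 1 * peripheral 2, 1] i)⁻¹ := by
  have h : ∀ x, (twistD⁻¹ : MulAut SphereGroup) x = FreeGroup.lift
    ![peripheral 0, (peripheral 1 * peripheral 2) * peripheral 1 * (peripheral 1 * peripheral 2)⁻¹,
      (peripheral 1 * peripheral 2) * peripheral 2 * (peripheral 1 * peripheral 2)⁻¹] x :=
    fun x => rfl
  rw [h]
  fin_cases i <;> (simp [peripheral]; try group)

lemma cycle_inv (i : Fin 4) : (cycle⁻¹ : MulAut SphereGroup) (peripheral i) =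
    peripheral (i + 1) := by
  have h : ∀ x, (cycle⁻¹ : MulAut SphereGroup) x = FreeGroup.lift
    ![peripheral 1, peripheral 2, peripheral 3] x := fun x => rfl
  rw [h]
  fin_cases i
  · exact FreeGroup.lift_apply_of
  · exact FreeGroup.lift_apply_of
  · exact FreeGroup.lift_apply_of
  · simp [peripheral]

lemma mem_PMod_of_inv {φ : MulAut SphereGroup} (g : Fin 4 → SphereGroup)
    (h : ∀ i, (φ⁻¹ : MulAut SphereGroup) (peripheral i) = g i * peripheral i * (g i)⁻¹) :
    φ ∈ PMod := by
  rw [← inv_mem_iff]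
  intro i
  exact isConj_iff.2 ⟨g i, (h i).symm⟩

lemma twistB_mem : twistB ∈ PMod := mem_PMod_of_inv _ twistB_inv

lemma twistD_mem : twistD ∈ PMod := mem_PMod_of_inv _ twistD_inv

/-- The product of the half-traces that appear in the linear terms of the trace relation. -/
noncomputable def coeff (α : Fin 4 → ℝ) (i j k l : Fin 4) : ℝ :=
  4 * (cos (α i / 2) * cos (α j / 2) - cos (α k / 2) * cos (α l / 2))

/-- The twist is a composite of two Vieta involutions: `y` is replaced by the other root of the
cubic, then `z` by the other root for the new `y`. -/
lemma HasTraces.twistB {α : Fin 4 → ℝ} {p : RepClass} {x y z : ℝ} (h : HasTraces α p x y z) :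
    HasTraces α (twistB • p) x (coeff α 1 2 0 3 - x * z - y)
      (coeff α 0 2 1 3 - x * (coeff α 1 2 0 3 - x * z - y) - z) := by
  obtain ⟨ρ, C, rfl, hC, rfl, rfl, rfl⟩ := h
  refine ⟨_, _, rfl, hC.comp _ _ twistB_inv, ?_⟩
  have e0 := liftHom_zero α C
  have e1 := liftHom_one α C
  have h3 := tr2_three hC.2
  simp only [← conj_rotAt]
  simp [e0, e1]
  set a := rotAt (C 0) (α 0)
  set b := rotAt (C 1) (α 1)
  set c := rotAt (C 2) (α 2)
  have ta : tr2 a = 2 * cos (α 0 / 2) := tr2_rotAt _ _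
  have tb : tr2 b = 2 * cos (α 1 / 2) := tr2_rotAt _ _
  have tc : tr2 c = 2 * cos (α 2 / 2) := tr2_rotAt _ _
  have hy : tr2 (a * b * a⁻¹ * c) = coeff α 1 2 0 3 - tr2 (a * b) * tr2 (a * c) - tr2 (b * c) := by
    rw [tr2_twist_left, h3, ta, tb, tc, coeff]; ring
  refine ⟨?_, ?_, ?_⟩
  · rw [← tr2_conj (a * b) (a * b)]; congr 1; group
  · rw [← hy]
  · rw [← hy]
    -- The new first matrix `(ab)a(ab)⁻¹` is also the conjugate of `a` by `aba⁻¹`, so the same trace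
    -- rule applies again.
    have := tr2_twist_left (a * b * a⁻¹) a c
    have e : a * b * a⁻¹ * a * (a * b * a⁻¹)⁻¹ * c = a * b * a * (b⁻¹ * a⁻¹) * c := by group
    rw [e, inv_mul_cancel_right, h3, tr2_conj, ta, tb, tc] at this
    rw [this, coeff]; ring

lemma HasTraces.twistD {α : Fin 4 → ℝ} {p : RepClass} {x y z : ℝ} (h : HasTraces α p x y z) :
    HasTraces α (twistD • p) (coeff α 0 1 2 3 - y * (coeff α 0 2 1 3 - x * y - z) - x) y
      (coeff α 0 2 1 3 - x * y - z) := by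
  obtain ⟨ρ, C, rfl, hC, rfl, rfl, rfl⟩ := h
  refine ⟨_, _, rfl, hC.comp _ _ twistD_inv, ?_⟩
  have e1 := liftHom_one α C
  have e2 := liftHom_two α C
  have h3 := tr2_three hC.2
  simp only [← conj_rotAt]
  simp [e1, e2]
  set a := rotAt (C 0) (α 0)
  set b := rotAt (C 1) (α 1)
  set c := rotAt (C 2) (α 2)
  have ta : tr2 a = 2 * cos (α 0 / 2) := tr2_rotAt _ _
  have tb : tr2 b = 2 * cos (α 1 / 2) := tr2_rotAt _ _
  have tc : tr2 c = 2 * cos (α 2 / 2) := tr2_rotAt _ _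
  have h3' : tr2 (b * c * a) = -(2 * cos (α 3 / 2)) := by
    rw [tr2_mul_comm, ← mul_assoc, h3]
  have hz : tr2 (b * c * b⁻¹ * a) = coeff α 0 2 1 3 - tr2 (a * b) * tr2 (b * c) - tr2 (a * c) := by
    rw [tr2_twist_left, h3', ta, tb, tc, coeff, tr2_mul_comm b a, tr2_mul_comm c a]; ring
  refine ⟨?_, ?_, ?_⟩
  · rw [← hz]
    have := tr2_twist_left (b * c * b⁻¹) b a
    have e : b * c * b⁻¹ * b * (b * c * b⁻¹)⁻¹ * a = b * c * b * (b * c)⁻¹ * a := by group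
    rw [e, inv_mul_cancel_right, h3', tr2_conj, ta, tb, tc, tr2_mul_comm b a,
      tr2_mul_comm _ a] at this
    have e' : a * (b * c * b * (c⁻¹ * b⁻¹)) = a * (b * c * b * (b * c)⁻¹) := by group
    rw [e', this, coeff]; ring
  · rw [← tr2_conj (b * c) (b * c)]; congr 1; group
  · rw [← hz, tr2_mul_comm]

lemma Lifted.cycle {α : Fin 4 → ℝ} {C : Fin 4 → ℍ} {ρ : SphereRep} (h : Lifted α C ρ) :
    Lifted (fun i => α (i + 1)) (fun i => C (i + 1))
      (ρ.comp (cycle⁻¹ : MulAut SphereGroup).toMonoidHom) := by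
  refine ⟨fun i => ?_, liftProd_rotate h.2⟩
  have : (ρ.comp (FourPuncturedSphere.cycle⁻¹ : MulAut SphereGroup).toMonoidHom) (peripheral i) =
    ρ ((FourPuncturedSphere.cycle⁻¹ : MulAut SphereGroup) (peripheral i)) := rfl
  rw [this, cycle_inv, h.1]

/-- The signs come from the product `-1`: the lifts of `c₃c₄` and `c₁c₂` are inverse up to sign, and
that of `c₄` is minus the inverse of the product of the first three. -/
lemma HasTraces.cycle {α : Fin 4 → ℝ} {p : RepClass} {x y z : ℝ} (h : HasTraces α p x y z) :
    HasTraces (fun i => α (i + 1)) (cycle • p) y (-x) (-(coeff α 0 2 1 3 - x * y - z)) := by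
  obtain ⟨ρ, C, rfl, hC, rfl, rfl, rfl⟩ := h
  refine ⟨_, _, rfl, hC.cycle, rfl, tr2_last_two hC.2, ?_⟩
  change tr2 (rotAt (C 1) (α 1) * rotAt (C 3) (α 3)) = _
  have h3 := tr2_three hC.2
  set a := rotAt (C 0) (α 0)
  set b := rotAt (C 1) (α 1)
  set c := rotAt (C 2) (α 2)
  set d := rotAt (C 3) (α 3)
  have hd : d = -(a * b * c)⁻¹ := by
    have := hC.2
    rw [liftProd] at this
    rw [← mul_right_inj (a * b * c), this]; simp
  have ta : tr2 a = 2 * cos (α 0 / 2) := tr2_rotAt _ _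
  have tb : tr2 b = 2 * cos (α 1 / 2) := tr2_rotAt _ _
  have tc : tr2 c = 2 * cos (α 2 / 2) := tr2_rotAt _ _
  have e : b * (a * b * c)⁻¹ = (a * b * c * b⁻¹)⁻¹ := by group
  have h4 : tr2 (a * b * c * b⁻¹) = tr2 (b * c * b⁻¹ * a) := by
    rw [tr2_mul_comm (b * c * b⁻¹) a]; congr 1; group
  have h3' : tr2 (b * c * a) = -(2 * cos (α 3 / 2)) := by
    rw [tr2_mul_comm, ← mul_assoc, h3]
  rw [hd, mul_neg, tr2_neg, e, tr2_inv, h4, tr2_twist_left, h3', ta, tb, tc, coeff,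
    tr2_mul_comm b a, tr2_mul_comm c a]
  ring

/-! ### Cyclic permutation of the punctures -/

lemma cycle_pow_four : cycle ^ 4 = 1 := by
  rw [← inv_eq_one, ← inv_pow]
  have h : ∀ i, ((cycle⁻¹ : MulAut SphereGroup) ^ 4) (peripheral i) = peripheral i := by
    intro i
    have : ((FourPuncturedSphere.cycle⁻¹ : MulAut SphereGroup) ^ 4) (peripheral i) =
      cycle⁻¹ (cycle⁻¹ (cycle⁻¹ (cycle⁻¹ (peripheral i)))) := rfl
    rw [this, cycle_inv, cycle_inv, cycle_inv, cycle_inv]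
    congr 1
    fin_cases i <;> rfl
  apply MulEquiv.toMonoidHom_injective
  refine FreeGroup.ext_hom _ _ fun i => ?_
  fin_cases i
  · exact h 0
  · exact h 1
  · exact h 2

lemma cycle_conj_mem {φ : MulAut SphereGroup} (hφ : φ ∈ PMod) : cycle * φ * cycle⁻¹ ∈ PMod := by
  intro i
  have h : (cycle * φ * cycle⁻¹) (peripheral i) = cycle (φ (peripheral (i + 1))) := by
    rw [← cycle_inv]; rfl
  have h' : peripheral i = cycle (peripheral (i + 1)) := by
    rw [← cycle_inv]; exact (MulAut.apply_inv_self _ cycle _).symm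
  rw [h]
  nth_rewrite 1 [h']
  exact (cycle : SphereGroup →* SphereGroup).map_isConj (hφ (i + 1))

/-! ### Permutations of four points -/

/-- Periods are at most 4, and a permutation without fixed point is a double transposition or a
4-cycle. -/
lemma perm_fin_four (σ : Equiv.Perm (Fin 4)) :
    (∀ i, σ i = i ∨ σ (σ i) = i ∨ σ (σ (σ i)) = i ∨ σ (σ (σ (σ i))) = i) ∧
    ((∃ i, σ i = i) ∨ (∀ i, σ (σ i) = i) ∨
      ∀ i j, j = i ∨ j = σ i ∨ j = σ (σ i) ∨ j = σ (σ (σ i))) := by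
  revert σ; decide

lemma perm_of_card_four {X : Type*} (h : Nat.card X = 4) (σ : Equiv.Perm X) :
    (∀ i, σ i = i ∨ σ (σ i) = i ∨ σ (σ (σ i)) = i ∨ σ (σ (σ (σ i))) = i) ∧
    ((∃ i, σ i = i) ∨ (∀ i, σ (σ i) = i) ∨
      ∀ i j, j = i ∨ j = σ i ∨ j = σ (σ i) ∨ j = σ (σ (σ i))) := by
  have : Finite X := Nat.finite_of_card_ne_zero (by omega)
  let e : X ≃ Fin 4 := Finite.equivFinOfCardEq h
  obtain ⟨h1, h2⟩ := perm_fin_four (e.symm.trans (σ.trans e))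
  refine ⟨fun i => by simpa using h1 (e i), ?_⟩
  rcases h2 with ⟨i, hi⟩ | h2 | h2
  · left
    exact ⟨e.symm i, by simpa [Equiv.eq_symm_apply] using hi⟩
  · right; left
    intro i; simpa using h2 (e i)
  · right; right
    intro i j; simpa using h2 (e i) (e j)

/-! ### Finite orbits of the twists on the cubic surface -/

/-- A transformation of the classes that rotates the sections `x = const` of the cubic surface
`x² + y² + z² + xyz = P (x + y + z) + 4 - 3P`, with `P = 4 - q²`. -/
structure TwistSystem (P q : ℝ) (H : RepClass → ℝ → ℝ → ℝ → Prop) (T : RepClass → RepClass) :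
    Prop where
  unique : ∀ {p x y z x' y' z'}, H p x y z → H p x' y' z' → x = x' ∧ y = y' ∧ z = z'
  eq : ∀ {p p' x y z}, H p x y z → H p' x y z → p = p'
  cubic : ∀ {p x y z}, H p x y z →
    x ^ 2 + y ^ 2 + z ^ 2 + x * y * z = P * (x + y + z) + 4 - 3 * P
  lower : ∀ {p x y z}, H p x y z → -q < x
  upper : ∀ {p x y z}, H p x y z → x < 2
  step : ∀ {p x y z}, H p x y z →
    H (T p) x (P - x * z - y) (P - x * (P - x * z - y) - z)

namespace TwistSystem

variable {P q : ℝ} {H : RepClass → ℝ → ℝ → ℝ → Prop} {T : RepClass → RepClass}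
  (S : TwistSystem P q H T)
include S

/-- A fixed point has `y = z` and `(x + 2) y = P`. Eliminating `y` from the cubic gives `(x - (P -
2)) (x² - q²) = 0`, and the lower bound on `x` excludes `x = -q`. -/
lemma of_fixed (hP : P = 4 - q ^ 2) (hq : q < 2) {p x y z} (h : H p x y z)
    (hT : T p = p) : (x = P - 2 ∧ y = 1 ∧ z = 1) ∨ (x = q ∧ y = 2 - q ∧ z = 2 - q) := by
  have h1 := S.step h
  rw [hT] at h1
  obtain ⟨-, h2, h3⟩ := S.unique h h1
  have hc := S.cubic h
  have hl := S.lower h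
  have hu := S.upper h
  rw [← h2] at h3
  have hx : x + 2 ≠ 0 := by linarith
  have hx' : 2 - x ≠ 0 := by linarith
  have hyz : y = z := by
    have : (2 - x) * (y - z) = 0 := by linear_combination h2 - h3
    rcases mul_eq_zero.1 this with h | h
    · exact absurd h hx'
    · linarith
  subst hyz
  have hy : (x + 2) * y = P := by linarith
  have hf : (x - (P - 2)) * ((x - q) * (x + q)) = 0 := by
    have h4 : x ^ 2 + P * y = P * x + 2 * P * y + 4 - 3 * P := by
      linear_combination hc - y * hy
    have h5 : (x ^ 2 - P * x - 4 + 3 * P) * (x + 2) = P * P := by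
      linear_combination (x + 2) * h4 + P * hy
    have : (x - (P - 2)) * ((x - q) * (x + q)) =
      (x ^ 2 - P * x - 4 + 3 * P) * (x + 2) - P * P := by rw [hP]; ring
    rw [this, h5, sub_self]
  rcases mul_eq_zero.1 hf with h6 | h6
  · left
    have : y = 1 := by
      have hx2 : x = P - 2 := by linarith
      refine mul_left_cancel₀ hx ?_
      rw [hy]; linarith
    exact ⟨by linarith, this, this⟩
  · right
    rcases mul_eq_zero.1 h6 with h6 | h6
    · have : y = 2 - q := by
        refine mul_left_cancel₀ hx ?_
        rw [hy, hP]; have : x = q := by linarith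
        rw [this]; ring
      exact ⟨by linarith, this, this⟩
    · linarith

lemma fixed_of_eq {p x y z} (h : H p x y z) (h1 : P - x * z - y = y)
    (h2 : P - x * y - z = z) : T p = p := by
  have h3 := S.step h
  rw [h1, h2] at h3
  exact S.eq h3 h

/-- For fixed `x` the step is affine in `(y, z)`, with linear part of determinant 1 and trace `x² -
2 = 2 cos φ`. Away from its centre, period 2, 3 or 4 forces `φ` to be the corresponding fraction of
a turn; this lemma and the next two are these cases. -/
lemma of_period_two {p x y z} (h : H p x y z) (hT : T (T p) = p) (hne : T p ≠ p) : x = 0 := by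
  have h1 := S.step (S.step h)
  rw [hT] at h1
  obtain ⟨-, h2, h3⟩ := S.unique h h1
  by_contra hx
  have hu : x * (2 * y + x * z - P) = 0 := by linear_combination x * h2 + h3
  have hv : x * (2 * z + x * y - P) = 0 := by linear_combination x * hu - h2
  have hu : 2 * y + x * z - P = 0 := (mul_eq_zero.1 hu).resolve_left hx
  have hv : 2 * z + x * y - P = 0 := (mul_eq_zero.1 hv).resolve_left hx
  exact hne (S.fixed_of_eq h (by linarith) (by linarith))

lemma of_period_three {p x y z} (h : H p x y z) (hT : T (T (T p)) = p) (hne : T p ≠ p) :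
    x ^ 2 = 1 := by
  have h1 := S.step (S.step (S.step h))
  rw [hT] at h1
  obtain ⟨-, h2, h3⟩ := S.unique h h1
  by_contra hx
  have hx : 1 - x ^ 2 ≠ 0 := fun h => hx (by linarith)
  -- `u` and `v` are the partial derivatives of the cubic in `y` and `z`; they vanish together
  -- exactly at a fixed point of the step.
  set u := 2 * y + x * z - P with hu
  set v := 2 * z + x * y - P with hv
  have e1 : (1 - x ^ 2) * (v - x * u) = 0 := by
    rw [hu, hv]; linear_combination h3 + x * h2
  have e1 : v - x * u = 0 := (mul_eq_zero.1 e1).resolve_left hx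
  have e2 : (1 - x ^ 2) * u = 0 := by
    rw [hu, hv] at e1
    rw [hu]; linear_combination h2 - (x - x ^ 3) * e1
  have e2 : u = 0 := (mul_eq_zero.1 e2).resolve_left hx
  exact hne (S.fixed_of_eq h (by linarith) (by rw [e2] at e1; linarith))

lemma of_period_four {p x y z} (h : H p x y z) (hT : T (T (T (T p))) = p) (hne : T p ≠ p) :
    x ^ 2 = 0 ∨ x ^ 2 = 2 := by
  have h1 := S.step (S.step (S.step (S.step h)))
  rw [hT] at h1
  obtain ⟨-, h2, h3⟩ := S.unique h h1
  by_contra hx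
  push Not at hx
  have hx0 : x ≠ 0 := fun h => hx.1 (by rw [h]; ring)
  have ht : x ^ 2 - 2 ≠ 0 := fun h => hx.2 (by linarith)
  set u := 2 * y + x * z - P with hu
  set k := 2 * z + x * y - P - x * u with hk
  have e1 : x * ((x ^ 2 - 2) * (-u - x * k)) = 0 := by
    rw [hk, hu]; linear_combination h3 + x * h2
  have e1 : -u - x * k = 0 :=
    (mul_eq_zero.1 ((mul_eq_zero.1 e1).resolve_left hx0)).resolve_left ht
  have e2 : (x ^ 2 - 2) * ((-u - x * k) + ((x ^ 2 - 2) * (-u - x * k) - u)) = 0 := by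
    rw [hk, hu]; linear_combination h2
  have e2 := (mul_eq_zero.1 e2).resolve_left ht
  have hu0 : u = 0 := by rw [e1] at e2; linarith
  have hk0 : k = 0 := by
    rw [hu0] at e1
    exact (mul_eq_zero.1 (by linarith : x * k = 0)).resolve_left hx0
  exact hne (S.fixed_of_eq h (by linarith) (by rw [hu0] at hk; linarith))

/-- The possible values of `x` on a finite orbit of length four. -/
lemma allowed (hP : P = 4 - q ^ 2) (hq : q < 2) {O : Set RepClass} (hO : O.ncard = 4)
    (σ : Equiv.Perm O) (hσ : ∀ p, (σ p : RepClass) = T p) {p x y z} (hp : p ∈ O)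
    (h : H p x y z) : x ^ 2 = 0 ∨ x ^ 2 = 1 ∨ x ^ 2 = 2 ∨ x = P - 2 ∨ x = q := by
  have h1 := (perm_of_card_four hO σ).1 ⟨p, hp⟩
  simp only [Subtype.ext_iff, hσ] at h1
  by_cases hT : T p = p
  · rcases S.of_fixed hP hq h hT with h2 | h2
    · exact Or.inr (Or.inr (Or.inr (Or.inl h2.1)))
    · exact Or.inr (Or.inr (Or.inr (Or.inr h2.1)))
  · rcases h1 with h1 | h1 | h1 | h1
    · exact absurd h1 hT
    · left; rw [S.of_period_two h h1 hT]; ring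
    · right; left; exact S.of_period_three h h1 hT
    · rcases S.of_period_four h h1 hT with h2 | h2
      · exact Or.inl h2
      · exact Or.inr (Or.inr (Or.inl h2))

/-- On an orbit of length four without fixed point, `x` is constant. -/
lemma fixed_or_const {O : Set RepClass} (hO : O.ncard = 4) (hH : ∀ p ∈ O, ∃ x y z, H p x y z)
    (σ : Equiv.Perm O) (hσ : ∀ p, (σ p : RepClass) = T p) :
    (∃ p ∈ O, T p = p) ∨ ∃ c, ∀ p ∈ O, ∀ x y z, H p x y z → x = c := by
  rcases (perm_of_card_four hO σ).2 with ⟨p, hp⟩ | h | h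
  · left
    exact ⟨p, p.2, by rw [← hσ, hp]⟩
  · by_cases hf : ∃ p ∈ O, T p = p
    · exact Or.inl hf
    · right
      refine ⟨0, fun p hp x y z hx => S.of_period_two hx ?_ fun h => hf ⟨p, hp, h⟩⟩
      have := h ⟨p, hp⟩
      simpa only [Subtype.ext_iff, hσ] using this
  · right
    have hne : O.Nonempty := Set.nonempty_of_ncard_ne_zero (by omega)
    obtain ⟨p, hp⟩ := hne
    obtain ⟨x, y, z, hx⟩ := hH p hp
    refine ⟨x, fun p' hp' x' y' z' hx' => ?_⟩
    have h1 := h ⟨p, hp⟩ ⟨p', hp'⟩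
    simp only [Subtype.ext_iff, hσ] at h1
    rcases h1 with h1 | h1 | h1 | h1
    · exact (S.unique (h1 ▸ hx) hx').1.symm
    · exact (S.unique (h1 ▸ S.step hx) hx').1.symm
    · exact (S.unique (h1 ▸ S.step (S.step hx)) hx').1.symm
    · exact (S.unique (h1 ▸ S.step (S.step (S.step hx))) hx').1.symm

end TwistSystem

/-- The peripheral angles of the two families, in the order in which the last one is special. The
trace coordinates lie on the surface `x² + y² + z² + xyz = P (x + y + z) + 4 - 3P`. -/
structure BaseAngles (α : Fin 4 → ℝ) (P q : ℝ) : Prop where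
  adm : Admissible α
  hP : P = 4 - q ^ 2
  q_pos : 0 < q
  q_lt : q < 2
  q_ne : q ≠ 1
  coeffA : coeff α 0 1 2 3 = P
  coeffB : coeff α 1 2 0 3 = P
  coeffC : coeff α 0 2 1 3 = P
  const : 4 - 4 * (cos (α 0 / 2) ^ 2 + cos (α 1 / 2) ^ 2 + cos (α 2 / 2) ^ 2 + cos (α 3 / 2) ^ 2) +
      16 * cos (α 0 / 2) * cos (α 1 / 2) * cos (α 2 / 2) * cos (α 3 / 2) = 4 - 3 * P
  lowerX : 2 * cos ((α 2 + α 3) / 2) < q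
  lowerY : 2 * cos ((α 3 + α 0) / 2) < q

namespace BaseAngles

variable {α : Fin 4 → ℝ} {P q : ℝ} (S : BaseAngles α P q)
include S

lemma cubic {p : RepClass} {x y z : ℝ} (h : HasTraces α p x y z) :
    x ^ 2 + y ^ 2 + z ^ 2 + x * y * z = P * (x + y + z) + 4 - 3 * P := by
  have h1 := h.cubic
  have hA := S.coeffA
  have hB := S.coeffB
  have hC := S.coeffC
  have hD := S.const
  simp only [coeff] at hA hB hC
  rw [hA, hB, hC] at h1
  linarith

lemma system_B : TwistSystem P q (HasTraces α) (fun p => twistB • p) where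
  unique h h' := h.unique S.adm.mem_Ioo h'
  eq h h' := h.eq S.adm.mem_Ioo h'
  cubic h := S.cubic h
  lower h := by have := (h.bounds S.adm).2.1; linarith [S.lowerX]
  upper h := by
    have := (h.bounds S.adm).1
    have := two_cos_lt (t := (α 0 + α 1) / 2) (by linarith [S.adm.pos 0, S.adm.pos 1])
      (by linarith [S.adm.lt_two_pi 0, S.adm.lt_two_pi 1])
    linarith
  step h := by
    have := h.twistB
    rwa [S.coeffB, S.coeffC] at this

lemma system_D : TwistSystem P q (fun p y z x => HasTraces α p x y z) (fun p => twistD • p) where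
  unique h h' := by obtain ⟨h1, h2, h3⟩ := h.unique S.adm.mem_Ioo h'; exact ⟨h2, h3, h1⟩
  eq h h' := h.eq S.adm.mem_Ioo h'
  cubic h := by linarith [S.cubic h]
  lower h := by have := (h.bounds S.adm).2.2.2; linarith [S.lowerY]
  upper h := by
    have := (h.bounds S.adm).2.2.1
    have := two_cos_lt (t := (α 1 + α 2) / 2) (by linarith [S.adm.pos 1, S.adm.pos 2])
      (by linarith [S.adm.lt_two_pi 1, S.adm.lt_two_pi 2])
    linarith
  step {p y z x} h := by
    have := h.twistD
    rwa [S.coeffA, S.coeffC, mul_comm x y] at this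

omit S in
/-- The permutation of an orbit induced by an element of the group. -/
lemma exists_perm {O : Set RepClass} (hO : ∃ x, O = MulAction.orbit PMod x)
    {φ : MulAut SphereGroup} (hφ : φ ∈ PMod) :
    ∃ σ : Equiv.Perm O, ∀ p, (σ p : RepClass) = φ • (p : RepClass) := by
  obtain ⟨x, rfl⟩ := hO
  exact ⟨MulAction.toPerm (⟨φ, hφ⟩ : PMod), fun p => rfl⟩

omit S in
-- The spurious fixed point `(q, 2 - q, 2 - q)` must also respect the constraints of the other
-- twist; only `q = 2 - √2` is left.
lemma sqrt_two_of_bad (hP : P = 4 - q ^ 2) (h0 : 0 < q) (h2 : q < 2) (h1 : q ≠ 1)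
    (h : (2 - q) ^ 2 = 0 ∨ (2 - q) ^ 2 = 1 ∨ (2 - q) ^ 2 = 2 ∨ 2 - q = P - 2 ∨ 2 - q = q) :
    (2 - q) ^ 2 = 2 := by
  rcases h with h | h | h | h | h
  · nlinarith
  · exfalso
    have : (q - 1) * (q - 3) = 0 := by linarith
    rcases mul_eq_zero.1 this with h | h
    · exact h1 (by linarith)
    · linarith
  · exact h
  · exfalso
    have : q * (q - 1) = 0 := by rw [hP] at h; linarith
    rcases mul_eq_zero.1 this with h | h
    · linarith
    · exact h1 (by linarith)
  · exact absurd (by linarith) h1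

omit S in
lemma not_allowed (hP : P = 4 - q ^ 2) (h2 : q < 2) (h : (2 - q) ^ 2 = 2) {t : ℝ}
    (ht : t = P - 2 - q) : ¬ (t ^ 2 = 0 ∨ t ^ 2 = 1 ∨ t ^ 2 = 2 ∨ t = P - 2 ∨ t = q) := by
  have hq : q ^ 2 = 4 * q - 2 := by linarith
  -- Here `q = 2 - √2 = 0.5857...`, so `t = 4 - 5q` is about `1.07`, and this bracket separates it
  -- from every allowed value.
  have l1 : 0.585 < q := by nlinarith
  have l2 : q < 0.586 := by nlinarith
  rw [ht, hP, hq]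
  rintro (h | h | h | h | h) <;> nlinarith

omit S in
-- With `x` and `y` fixed, the cubic is a quadratic equation in `z`: three distinct points are
-- already too many.
lemma not_const {O : Set RepClass} (hO : O.ncard = 4)
    (heq : ∀ {p p' x y z}, HasTraces α p x y z → HasTraces α p' x y z → p = p')
    (hcub : ∀ {p x y z}, HasTraces α p x y z →
      x ^ 2 + y ^ 2 + z ^ 2 + x * y * z = P * (x + y + z) + 4 - 3 * P)
    (hH : ∀ p ∈ O, ∃ x y z, HasTraces α p x y z) {c d : ℝ}
    (hc : ∀ p ∈ O, ∀ x y z, HasTraces α p x y z → x = c)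
    (hd : ∀ p ∈ O, ∀ x y z, HasTraces α p x y z → y = d) : False := by
  obtain ⟨a, b, e, ha, hb, he, hab, hae, hbe⟩ := (Set.two_lt_ncard_iff
    (Set.finite_of_ncard_ne_zero (by omega))).1 (by omega : 2 < O.ncard)
  have key : ∀ p ∈ O, ∃ z, HasTraces α p c d z := by
    intro p hp
    obtain ⟨x, y, z, h⟩ := hH p hp
    have h1 := hc p hp x y z h
    have h2 := hd p hp x y z h
    subst h1 h2
    exact ⟨z, h⟩
  obtain ⟨z1, h1⟩ := key a ha
  obtain ⟨z2, h2⟩ := key b hb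
  obtain ⟨z3, h3⟩ := key e he
  have c1 := hcub h1
  have c2 := hcub h2
  have c3 := hcub h3
  have n12 : z1 - z2 ≠ 0 := fun h => hab (heq h1 (by rwa [sub_eq_zero.1 h]))
  have n13 : z1 - z3 ≠ 0 := fun h => hae (heq h1 (by rwa [sub_eq_zero.1 h]))
  have n23 : z2 - z3 ≠ 0 := fun h => hbe (heq h2 (by rwa [sub_eq_zero.1 h]))
  have e12 : z1 + z2 + c * d - P = 0 :=
    (mul_eq_zero.1 (by linear_combination c1 - c2 :
      (z1 - z2) * (z1 + z2 + c * d - P) = 0)).resolve_left n12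
  have e13 : z1 + z3 + c * d - P = 0 :=
    (mul_eq_zero.1 (by linear_combination c1 - c3 :
      (z1 - z3) * (z1 + z3 + c * d - P) = 0)).resolve_left n13
  exact n23 (by linarith)

/-- Every orbit of length four contains one of two explicit points. -/
lemma exists_leaf {O : Set RepClass} (hO : IsLengthFourOrbit α O) :
    ∃ p ∈ O, HasTraces α p (P - 2) 1 1 ∨ HasTraces α p 1 (P - 2) 1 := by
  obtain ⟨h1, h2, h3⟩ := hO
  have hH : ∀ p ∈ O, ∃ x y z, HasTraces α p x y z := fun p hp => exists_hasTraces_of_DT (h2 hp)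
  obtain ⟨σ, hσ⟩ := exists_perm h1 twistB_mem
  obtain ⟨τ, hτ⟩ := exists_perm h1 twistD_mem
  have mB : ∀ p ∈ O, twistB • p ∈ O := fun p hp => by
    rw [← hσ ⟨p, hp⟩]; exact (σ ⟨p, hp⟩).2
  have mD : ∀ p ∈ O, twistD • p ∈ O := fun p hp => by
    rw [← hτ ⟨p, hp⟩]; exact (τ ⟨p, hp⟩).2
  have aB := fun {p x y z} => S.system_B.allowed S.hP S.q_lt h3 σ hσ (p := p) (x := x) (y := y)
    (z := z)
  have aD := fun {p x y z} => S.system_D.allowed S.hP S.q_lt h3 τ hτ (p := p) (x := x) (y := y)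
    (z := z)
  have hH' : ∀ p ∈ O, ∃ y z x, HasTraces α p x y z := fun p hp => by
    obtain ⟨x, y, z, h⟩ := hH p hp; exact ⟨y, z, x, h⟩
  rcases S.system_B.fixed_or_const h3 hH σ hσ with ⟨p, hp, hf⟩ | ⟨c, hc⟩
  · obtain ⟨x, y, z, h⟩ := hH p hp
    rcases S.system_B.of_fixed S.hP S.q_lt h hf with ⟨rfl, rfl, rfl⟩ | ⟨rfl, rfl, rfl⟩
    · exact ⟨p, hp, Or.inl h⟩
    · exfalso
      -- Being allowed for the twist along `c₂c₃` forces `(2 - q)² = 2`; that twist then moves `x`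
      -- to the forbidden value `P - 2 - q`.
      have hq := sqrt_two_of_bad S.hP S.q_pos S.q_lt S.q_ne (aD hp h)
      refine not_allowed S.hP S.q_lt hq ?_ (aB (mD p hp) (S.system_D.step h))
      have := S.hP
      linear_combination (-(2 - x)) * this - hq
  · rcases S.system_D.fixed_or_const h3 hH' τ hτ with ⟨p, hp, hf⟩ | ⟨d, hd⟩
    · obtain ⟨x, y, z, h⟩ := hH p hp
      rcases S.system_D.of_fixed S.hP S.q_lt h hf with ⟨rfl, rfl, rfl⟩ | ⟨rfl, rfl, rfl⟩
      · exact ⟨p, hp, Or.inr h⟩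
      · exfalso
        have hq := sqrt_two_of_bad S.hP S.q_pos S.q_lt S.q_ne (aB hp h)
        refine not_allowed S.hP S.q_lt hq ?_ (aD (mB p hp) (S.system_B.step h))
        linear_combination (-1) * hq
    · exact (not_const h3 (fun h h' => h.eq S.adm.mem_Ioo h') S.cubic hH hc
        (fun p hp x y z h => hd p hp y z x h)).elim

end BaseAngles

/-! ### A presentation of `SL(2, ℤ)` -/

/-- The modular group `SL(2, ℤ)`. -/
abbrev SL2Z : Type := Matrix.SpecialLinearGroup (Fin 2) ℤ

/-- The matrix of order four with rows `(0, 1)`, `(-1, 0)`. -/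
def genS : SL2Z := ⟨!![0, 1; -1, 0], by simp⟩

/-- The matrix of order six with rows `(0, 1)`, `(-1, 1)`. -/
def genU : SL2Z := ⟨!![0, 1; -1, 1], by simp⟩

lemma slz_mul (g h : SL2Z) (i j : Fin 2) : (g * h) i j = g i 0 * h 0 j + g i 1 * h 1 j :=
  (congrFun₂ (Matrix.SpecialLinearGroup.coe_mul g h) i j).trans
    (by rw [Matrix.mul_apply, Fin.sum_univ_two])

lemma slz_inv (g : SL2Z) : g⁻¹ 0 0 = g 1 1 ∧ g⁻¹ 0 1 = -g 0 1 ∧ g⁻¹ 1 0 = -g 1 0 ∧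
    g⁻¹ 1 1 = g 0 0 := by
  have h : g⁻¹.1 = _ := (Matrix.SpecialLinearGroup.coe_inv g).trans (adjugate_fin_two _)
  exact ⟨congrFun₂ h 0 0, congrFun₂ h 0 1, congrFun₂ h 1 0, congrFun₂ h 1 1⟩

lemma slz_ext {g h : SL2Z} (h00 : g 0 0 = h 0 0) (h01 : g 0 1 = h 0 1) (h10 : g 1 0 = h 1 0)
    (h11 : g 1 1 = h 1 1) : g = h := by
  ext i j
  fin_cases i <;> fin_cases j <;> assumption

lemma slz_det (g : SL2Z) : g 0 0 * g 1 1 - g 0 1 * g 1 0 = 1 := by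
  rw [← Matrix.det_fin_two]; exact g.2

lemma genS_mul_genS : genS * genS = -1 := slz_ext (by decide) (by decide) (by decide) (by decide)

lemma genU_pow_three : genU * genU * genU = -1 :=
    slz_ext (by decide) (by decide) (by decide) (by decide)

lemma closure_genS_genU : Subgroup.closure {genS, genU} = ⊤ := by
  rw [eq_top_iff, ← _root_.SpecialLinearGroup.SL2Z_generators, Subgroup.closure_le]
  have hS : genS ∈ Subgroup.closure {genS, genU} := Subgroup.subset_closure (by simp)
  have hU : genU ∈ Subgroup.closure {genS, genU} := Subgroup.subset_closure (by simp)
  rintro x (rfl | rfl)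
  · have : ModularGroup.S = genS⁻¹ := slz_ext (by decide) (by decide) (by decide) (by decide)
    rw [this]; exact inv_mem hS
  · have : ModularGroup.T = genU⁻¹ * genS⁻¹ * genS * genS :=
        slz_ext (by decide) (by decide) (by decide) (by decide)
    rw [this]
    exact mul_mem (mul_mem (mul_mem (inv_mem hU) (inv_mem hS)) hS) hS

section Presentation

variable {K : Type*} [Group K] {σ υ : K}

/-- The products of the elements `σ * υ` and `σ * υ⁻¹`. -/
inductive IsPositiveWord (σ υ : K) : K → Prop
  | one : IsPositiveWord σ υ 1
  | left (m : K) : IsPositiveWord σ υ m → IsPositiveWord σ υ (σ * (υ * m))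
  | right (m : K) : IsPositiveWord σ υ m → IsPositiveWord σ υ (σ * (υ⁻¹ * m))

/-- Up to sign, `συ` and `συ⁻¹` map to unipotent matrices with off-diagonal entry `-1`. Their
products keep the sign pattern, and each factor makes the off-diagonal sum strictly negative: a
nonempty word never becomes `±1`. -/
lemma IsPositiveWord.sign {f : K →* SL2Z} (hσ : f σ = genS) (hυ : f υ = genU) {m : K}
    (h : IsPositiveWord σ υ m) :
    ∃ e : ℤ, (e = 1 ∨ e = -1) ∧ 1 ≤ e * f m 0 0 ∧ 1 ≤ e * f m 1 1 ∧ e * f m 0 1 ≤ 0 ∧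
      e * f m 1 0 ≤ 0 ∧ (m = 1 ∨ e * (f m 0 1 + f m 1 0) < 0) := by
  induction h with
  | one => exact ⟨1, Or.inl rfl, by simp⟩
  | left m _ ih =>
    obtain ⟨e, he, h1, h2, h3, h4, -⟩ := ih
    have e1 : f (σ * (υ * m)) = genS * genU * f m := by
      rw [map_mul, map_mul, hσ, hυ, mul_assoc]
    have e00 : (genS * genU) 0 0 = -1 := by decide
    have e01 : (genS * genU) 0 1 = 1 := by decide
    have e10 : (genS * genU) 1 0 = 0 := by decide
    have e11 : (genS * genU) 1 1 = -1 := by decide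
    rw [e1]
    generalize genS * genU = X at *
    refine ⟨-e, by omega, ?_⟩
    rw [slz_mul, slz_mul, slz_mul, slz_mul, e00, e01, e10, e11]
    refine ⟨by linarith, by linarith, by linarith, by linarith, Or.inr (by linarith)⟩
  | right m _ ih =>
    obtain ⟨e, he, h1, h2, h3, h4, -⟩ := ih
    have e1 : f (σ * (υ⁻¹ * m)) = genS * genU⁻¹ * f m := by
      rw [map_mul, map_mul, map_inv, hσ, hυ, mul_assoc]
    have e00 : (genS * genU⁻¹) 0 0 = 1 := by decide
    have e01 : (genS * genU⁻¹) 0 1 = 0 := by decide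
    have e10 : (genS * genU⁻¹) 1 0 = -1 := by decide
    have e11 : (genS * genU⁻¹) 1 1 = 1 := by decide
    rw [e1]
    generalize genS * genU⁻¹ = X at *
    refine ⟨e, he, ?_⟩
    rw [slz_mul, slz_mul, slz_mul, slz_mul, e00, e01, e10, e11]
    refine ⟨by linarith, by linarith, by linarith, by linarith, Or.inr (by linarith)⟩

/-- Normal forms in the group generated by `σ` and `υ`. -/
def HasNormalForm (σ υ k : K) : Prop :=
  ∃ (m : K) (e i j : ℕ), IsPositiveWord σ υ m ∧ i < 3 ∧ j < 2 ∧
    k = (σ * σ) ^ e * (υ ^ i * (m * σ ^ j))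

/-- The normal forms are stable under left multiplication by `σ²`, `υ` and `σ`, and the inverses of
`σ` and `υ` are words in these. -/
lemma hasNormalForm_of_mem (hυ : υ * υ * υ = σ * σ) (hc : ∀ k : K, σ * σ * k = k * (σ * σ))
    (h4 : σ * σ * (σ * σ) = 1) {k : K} (hk : k ∈ Subgroup.closure {σ, υ}) :
    HasNormalForm σ υ k := by
  generalize hz : σ * σ = z at *
  have hzc' : ∀ (e : ℕ) (g : K), z ^ e * g = g * z ^ e := fun e g =>
    (Commute.pow_left (show Commute z g from hc g) e)
  have hυi : υ⁻¹ = z * (υ * υ) := by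
    rw [inv_eq_iff_mul_eq_one, hc, ← mul_assoc, ← mul_assoc, hυ, h4]
  have hσi : σ⁻¹ = z * σ := by
    rw [inv_eq_iff_mul_eq_one, hc, ← mul_assoc, hz, h4]
  have mz : ∀ k, HasNormalForm σ υ k → HasNormalForm σ υ (z * k) := by
    rintro _ ⟨m, e, i, j, hm, hi, hj, rfl⟩
    exact ⟨m, e + 1, i, j, hm, hi, hj, by rw [hz, pow_succ', mul_assoc]⟩
  have mυ : ∀ k, HasNormalForm σ υ k → HasNormalForm σ υ (υ * k) := by
    rintro _ ⟨m, e, i, j, hm, hi, hj, rfl⟩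
    rw [hz, ← mul_assoc, ← hzc', mul_assoc, ← mul_assoc υ, ← pow_succ']
    by_cases h : i = 2
    · subst h
      refine ⟨m, e + 1, 0, j, hm, by omega, hj, ?_⟩
      rw [hz, pow_succ υ, pow_two, hυ, pow_zero, one_mul, ← mul_assoc, ← pow_succ]
    · exact ⟨m, e, i + 1, j, hm, by omega, hj, by rw [hz]⟩
  have mσ : ∀ k, HasNormalForm σ υ k → HasNormalForm σ υ (σ * k) := by
    rintro _ ⟨m, e, i, j, hm, hi, hj, rfl⟩
    rw [hz, ← mul_assoc, ← hzc', mul_assoc]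
    suffices HasNormalForm σ υ (σ * (υ ^ i * (m * σ ^ j))) by
      clear hi
      induction e with
      | zero => rwa [pow_zero, one_mul]
      | succ e ih => rw [pow_succ', mul_assoc]; exact mz _ ih
    interval_cases i
    · rw [pow_zero, one_mul]
      cases hm with
      | one =>
        rw [one_mul, ← pow_succ']
        interval_cases j
        · exact ⟨1, 0, 0, 1, .one, by omega, by omega, by simp⟩
        · refine ⟨1, 1, 0, 0, .one, by omega, by omega, ?_⟩
          rw [pow_two]; simp
      | left m hm =>
        refine ⟨m, 1, 1, j, hm, by omega, hj, ?_⟩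
        rw [pow_one, pow_one]; simp only [mul_assoc]
      | right m hm =>
        refine ⟨m, 0, 2, j, hm, by omega, hj, ?_⟩
        rw [hυi, pow_zero, one_mul, pow_two]
        calc σ * (σ * (z * (υ * υ) * m) * σ ^ j) = σ * σ * z * (υ * υ * (m * σ ^ j)) := by
              simp only [mul_assoc]
          _ = _ := by rw [hz, h4, one_mul]
    · rw [pow_one]
      refine ⟨_, 0, 0, j, .left m hm, by omega, hj, ?_⟩
      simp only [pow_zero, one_mul, mul_assoc]
    · refine ⟨_, 1, 0, j, .right m hm, by omega, hj, ?_⟩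
      have : υ * υ = z * υ⁻¹ := by rw [hυi, ← mul_assoc, h4, one_mul]
      rw [pow_zero, one_mul, pow_one, pow_two, this, hz]
      calc σ * (z * υ⁻¹ * (m * σ ^ j)) = σ * z * (υ⁻¹ * (m * σ ^ j)) := by simp only [mul_assoc]
        _ = z * σ * (υ⁻¹ * (m * σ ^ j)) := by rw [hc]
        _ = _ := by simp only [mul_assoc]
  induction hk using Subgroup.closure_induction_left with
  | one => exact ⟨1, 0, 0, 0, .one, by omega, by omega, by simp⟩
  | mul_left x hx y _ ih =>
    rcases hx with rfl | rfl
    · exact mσ _ ih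
    · exact mυ _ ih
  | inv_mul_cancel x hx y _ ih =>
    rcases hx with rfl | rfl
    · rw [hσi, mul_assoc]; exact mz _ (mσ _ ih)
    · rw [hυi, mul_assoc, mul_assoc]; exact mz _ (mυ _ (mυ _ ih))

lemma eq_one_of_map_eq_one (hυ : υ * υ * υ = σ * σ) (hc : ∀ k : K, σ * σ * k = k * (σ * σ))
    (h4 : σ * σ * (σ * σ) = 1) {f : K →* SL2Z} (hfσ : f σ = genS) (hfυ : f υ = genU) {k : K}
    (hk : k ∈ Subgroup.closure {σ, υ}) (h1 : f k = 1) : k = 1 := by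
  obtain ⟨m, e, i, j, hm, hi, hj, rfl⟩ := hasNormalForm_of_mem hυ hc h4 hk
  obtain ⟨t, ht, a1, a2, a3, a4, a5⟩ := hm.sign hfσ hfυ
  have hz : ∀ n : ℕ, (n % 2 = 0 → (σ * σ) ^ n = 1) ∧ (n % 2 = 1 → (σ * σ) ^ n = σ * σ) := by
    intro n
    have h2 : (σ * σ) ^ 2 = 1 := by rw [pow_two, h4]
    constructor <;> intro hn <;> rw [← Nat.div_add_mod n 2, pow_add, pow_mul, h2, one_pow, one_mul,
      hn]
    · exact pow_zero _
    · exact pow_one _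
  have key : ∀ w : SL2Z, w = 1 ∨ w = -1 → genU ^ i * (f m * genS ^ j) = w →
      i = 0 ∧ j = 0 ∧ m = 1 := by
    intro w hw h
    have hm' : f m = (genU ^ i)⁻¹ * w * (genS ^ j)⁻¹ := by
      rw [eq_mul_inv_iff_mul_eq, eq_inv_mul_iff_mul_eq, h]
    rw [hm'] at a1 a2 a3 a4 a5
    suffices hs : i = 0 ∧ j = 0 by
      refine ⟨hs.1, hs.2, a5.resolve_right ?_⟩
      obtain ⟨rfl, rfl⟩ := hs
      rcases hw with rfl | rfl <;> simp
    -- The sign pattern of `f m` excludes the five pairs `(i, j)` other than `(0, 0)`, by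
    -- evaluation.
    clear h hm' a5 hm hk h1
    revert a1 a2 a3 a4
    rcases ht with rfl | rfl <;> rcases hw with rfl | rfl <;> interval_cases i <;>
      interval_cases j <;> decide
  have hS : ∀ n : ℕ, (n % 2 = 0 → (-1 : SL2Z) ^ n = 1) ∧ (n % 2 = 1 → (-1 : SL2Z) ^ n = -1) :=
    fun n => ⟨fun h => (Nat.even_iff.2 h).neg_one_pow, fun h => (Nat.odd_iff.2 h).neg_one_pow⟩
  rw [map_mul, map_mul, map_mul, map_pow, map_pow, map_pow, hfσ, hfυ, map_mul, hfσ,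
    genS_mul_genS] at h1
  rcases Nat.mod_two_eq_zero_or_one e with h | h
  · rw [(hS e).1 h, one_mul] at h1
    obtain ⟨rfl, rfl, rfl⟩ := key 1 (Or.inl rfl) h1
    simp [(hz e).1 h]
  · rw [(hS e).2 h, neg_one_mul, neg_eq_iff_eq_neg] at h1
    obtain ⟨rfl, rfl, rfl⟩ := key (-1) (Or.inr rfl) h1
    rw [map_one, pow_zero, pow_zero, mul_one, mul_one] at h1
    exact absurd h1 (by decide)

end Presentation

/-- `SL(2, ℤ)` is the amalgam of two cyclic groups of orders four and six along the centre. -/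
theorem exists_hom_of_relations {G : Type*} [Group G] {s u : G} (hus : u * u * u = s * s)
    (hs : ∀ g : G, s * s * g = g * (s * s)) (h4 : s * s * (s * s) = 1) :
    ∃ F : SL2Z →* G, F genS = s ∧ F genU = u := by
  -- `H` is the graph of the desired homomorphism. The relations hold in the product group, so the
  -- first projection is injective on `H`.
  let H : Subgroup (SL2Z × G) := Subgroup.closure {(genS, s), (genU, u)}
  let f : SL2Z × G →* SL2Z := MonoidHom.fst SL2Z G
  have mS : ((genS, s) : SL2Z × G) ∈ H := Subgroup.subset_closure (by simp)
  have mU : ((genU, u) : SL2Z × G) ∈ H := Subgroup.subset_closure (by simp)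
  have hinj : Function.Injective (f.comp H.subtype) := by
    rw [injective_iff_map_eq_one]
    rintro ⟨k, hk⟩ h1
    refine Subtype.ext (eq_one_of_map_eq_one (σ := (genS, s)) (υ := (genU, u)) (f := f)
      ?_ ?_ ?_ rfl rfl hk h1)
    · exact Prod.ext (genU_pow_three.trans genS_mul_genS.symm) hus
    · rintro ⟨a, b⟩
      refine Prod.ext ?_ (hs b)
      change genS * genS * a = a * (genS * genS)
      rw [genS_mul_genS, neg_one_mul, mul_neg_one]
    · refine Prod.ext ?_ h4
      change genS * genS * (genS * genS) = 1
      rw [genS_mul_genS, neg_one_mul, neg_neg]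
  have hsurj : Function.Surjective (f.comp H.subtype) := by
    rw [← MonoidHom.range_eq_top, eq_top_iff, ← closure_genS_genU, Subgroup.closure_le]
    rintro x (rfl | rfl)
    · exact ⟨⟨_, mS⟩, rfl⟩
    · exact ⟨⟨_, mU⟩, rfl⟩
  let e : H ≃* SL2Z := MulEquiv.ofBijective (f.comp H.subtype) ⟨hinj, hsurj⟩
  refine ⟨((MonoidHom.snd SL2Z G).comp H.subtype).comp e.symm.toMonoidHom, ?_, ?_⟩
  · have : e.symm genS = ⟨_, mS⟩ := e.symm_apply_eq.2 rfl
    change (e.symm genS : SL2Z × G).2 = s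
    rw [this]
  · have : e.symm genU = ⟨_, mU⟩ := e.symm_apply_eq.2 rfl
    change (e.symm genU : SL2Z × G).2 = u
    rw [this]

/-! ### Triples of parabolic elements of `SL(2, ℤ)` -/

/-- The conjugates of `genS * genU` are the matrices `parab p q` with `p`, `q` coprime. -/
def parab (p q : ℤ) : SL2Z :=
  ⟨!![-(1 + p * q), p ^ 2; -q ^ 2, -(1 - p * q)], by rw [Matrix.det_fin_two_of]; ring⟩

lemma parab_apply (p q : ℤ) : parab p q 0 0 = -(1 + p * q) ∧ parab p q 0 1 = p ^ 2 ∧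
    parab p q 1 0 = -q ^ 2 ∧ parab p q 1 1 = -(1 - p * q) := ⟨rfl, rfl, rfl, rfl⟩

lemma genS_mul_genU : genS * genU = parab 1 0 :=
  slz_ext (by decide) (by decide) (by decide) (by decide)

lemma parab_neg (p q : ℤ) : parab (-p) (-q) = parab p q := by
  obtain ⟨a1, a2, a3, a4⟩ := parab_apply p q
  obtain ⟨b1, b2, b3, b4⟩ := parab_apply (-p) (-q)
  apply slz_ext <;> simp only [a1, a2, a3, a4, b1, b2, b3, b4] <;> ring

lemma conj_parab (g : SL2Z) (p q : ℤ) : g * parab p q * g⁻¹ =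
    parab (g 0 0 * p + g 0 1 * q) (g 1 0 * p + g 1 1 * q) := by
  obtain ⟨a1, a2, a3, a4⟩ := parab_apply p q
  obtain ⟨b1, b2, b3, b4⟩ := parab_apply (g 0 0 * p + g 0 1 * q) (g 1 0 * p + g 1 1 * q)
  obtain ⟨i1, i2, i3, i4⟩ := slz_inv g
  have hd := slz_det g
  apply slz_ext <;>
    simp only [slz_mul, a1, a2, a3, a4, b1, b2, b3, b4, i1, i2, i3, i4]
  · linear_combination (-1) * hd
  · ring
  · ring
  · linear_combination (-1) * hd

/-- The trace on `SL(2, ℤ)`. -/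
def trZ (g : SL2Z) : ℤ := g 0 0 + g 1 1

lemma trZ_mul_comm (g h : SL2Z) : trZ (g * h) = trZ (h * g) := by
  simp only [trZ, slz_mul]; ring

lemma trZ_conj (g h : SL2Z) : trZ (g * h * g⁻¹) = trZ h := by
  rw [trZ_mul_comm, ← mul_assoc, inv_mul_cancel, one_mul]

lemma trZ_inv (g : SL2Z) : trZ g⁻¹ = trZ g := by
  obtain ⟨i1, i2, i3, i4⟩ := slz_inv g
  simp only [trZ, i1, i4]; ring

/-- Traces of products of parabolic elements see only the determinants of their vectors, which turns
the classification into arithmetic. -/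
lemma trZ_parab_mul (p q r s : ℤ) :
    trZ (parab p q * parab r s) = 2 - (p * s - q * r) ^ 2 := by
  obtain ⟨a1, a2, a3, a4⟩ := parab_apply p q
  obtain ⟨b1, b2, b3, b4⟩ := parab_apply r s
  simp only [trZ, slz_mul, a1, a2, a3, a4, b1, b2, b3, b4]; ring

lemma trZ_parab_mul_mul (p q r s t u : ℤ) :
    trZ (parab p q * parab r s * parab t u) = -2 + (p * s - q * r) ^ 2 + (r * u - s * t) ^ 2 +
      (p * u - q * t) ^ 2 - (p * s - q * r) * (r * u - s * t) * (p * u - q * t) := by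
  obtain ⟨a1, a2, a3, a4⟩ := parab_apply p q
  obtain ⟨b1, b2, b3, b4⟩ := parab_apply r s
  obtain ⟨c1, c2, c3, c4⟩ := parab_apply t u
  simp only [trZ, slz_mul, a1, a2, a3, a4, b1, b2, b3, b4, c1, c2, c3, c4]; ring

lemma conj_mul_conj {G : Type*} [Group G] (g h k : G) :
    (g * h * g⁻¹) * (g * k * g⁻¹) = g * (h * k) * g⁻¹ := by group

lemma trZ_conj_mul_conj (g h k l : SL2Z) :
    trZ ((g * h * g⁻¹) * (k * l * k⁻¹)) = trZ ((k⁻¹ * g) * h * (k⁻¹ * g)⁻¹ * l) := by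
  rw [← trZ_conj k ((k⁻¹ * g) * h * (k⁻¹ * g)⁻¹ * l)]
  simp only [_root_.mul_inv_rev, inv_inv, mul_assoc, mul_inv_cancel_left]

lemma trZ_first {M : Fin 3 → SL2Z} {N : SL2Z} (h : M 0 * M 1 * M 2 * N = 1) :
    trZ (M 0 * M 1) = trZ (M 2 * N) ∧ trZ (M 1 * M 2) = trZ (M 0 * N) ∧
      trZ (M 0 * M 1 * M 2) = trZ N := by
  have h1 : M 0 * M 1 = (M 2 * N)⁻¹ := by rw [eq_inv_iff_mul_eq_one, ← mul_assoc, h]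
  have h2 : M 0 * M 1 * M 2 = N⁻¹ := by rw [eq_inv_iff_mul_eq_one, h]
  have h3 : M 1 * M 2 = (N * M 0)⁻¹ := by
    rw [eq_inv_iff_mul_eq_one]
    calc M 1 * M 2 * (N * M 0) = (M 0)⁻¹ * (M 0 * M 1 * M 2 * N) * M 0 := by group
      _ = 1 := by rw [h]; group
  rw [h2, h1, h3, trZ_inv, trZ_inv, trZ_inv, trZ_mul_comm N]
  exact ⟨rfl, rfl, rfl⟩

/-- The parabolic triples whose product is conjugate to `genS`. -/
def triplesTwo : Fin 4 → Fin 3 → SL2Z :=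
  ![![parab 1 0, parab 0 1, parab 1 0], ![parab 1 0, parab 0 1, parab 0 1],
    ![parab 1 0, parab 0 1, parab 1 (-1)], ![parab 1 0, parab 1 0, parab 0 1]]

/-- The parabolic triples whose product is conjugate to `-(genS * genU) ^ 3`. -/
def triplesThree : Fin 4 → Fin 3 → SL2Z :=
  ![![parab 1 0, parab 0 1, parab 1 1], ![parab 1 0, parab 0 1, parab 1 (-2)],
    ![parab 1 0, parab 0 1, parab 2 (-1)], ![parab 1 0, parab 1 2, parab 0 1]]

lemma conj_parab_one (g : SL2Z) : g * parab 1 0 * g⁻¹ = parab (g 0 0) (g 1 0) := by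
  rw [conj_parab]; simp

/-- The parabolic elements, in a common frame in which the first one is standard. -/
lemma exists_frame {M g : Fin 3 → SL2Z} (hM : ∀ i, M i = g i * parab 1 0 * (g i)⁻¹) :
    ∃ (k h₁ h₂ : SL2Z), M 0 = k * parab 1 0 * k⁻¹ ∧ M 1 = k * parab (h₁ 0 0) (h₁ 1 0) * k⁻¹ ∧
      M 2 = k * parab (h₂ 0 0) (h₂ 1 0) * k⁻¹ := by
  refine ⟨g 0, (g 0)⁻¹ * g 1, (g 0)⁻¹ * g 2, hM 0, ?_, ?_⟩ <;>
    rw [hM, ← conj_parab_one] <;> group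

/-- Unipotent matrices of `SL(2, ℤ)`. -/
def unip (n : ℤ) : SL2Z := ⟨!![1, n; 0, 1], by simp⟩

lemma conj_unip (n p q : ℤ) : unip n * parab p q * (unip n)⁻¹ = parab (p + n * q) q := by
  rw [conj_parab]
  change parab (1 * p + n * q) (0 * p + 1 * q) = _
  congr 1 <;> ring

lemma traces_frame {M : Fin 3 → SL2Z} {k : SL2Z} {p q r s : ℤ} (h0 : M 0 = k * parab 1 0 * k⁻¹)
    (h1 : M 1 = k * parab p q * k⁻¹) (h2 : M 2 = k * parab r s * k⁻¹) :
    trZ (M 0 * M 1) = 2 - q ^ 2 ∧ trZ (M 1 * M 2) = 2 - (p * s - q * r) ^ 2 ∧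
      trZ (M 0 * M 1 * M 2) = -2 + q ^ 2 + (p * s - q * r) ^ 2 + s ^ 2 -
        q * s * (p * s - q * r) := by
  rw [h0, h1, h2]
  simp only [conj_mul_conj, trZ_conj, trZ_parab_mul, trZ_parab_mul_mul]
  exact ⟨by ring, trivial, by ring⟩

lemma frame_change {M : SL2Z} {k : SL2Z} {p q : ℤ} (h : M = k * parab p q * k⁻¹) (n : ℤ) :
    M = k * unip n * parab (p - n * q) q * (k * unip n)⁻¹ := by
  have h1 := conj_unip n (p - n * q) q
  rw [sub_add_cancel] at h1
  rw [h, ← h1]; group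

lemma frame_neg {M : SL2Z} {k : SL2Z} {p q : ℤ} (h : M = k * parab p q * k⁻¹) :
    M = k * parab (-p) (-q) * k⁻¹ := by rw [parab_neg]; exact h

/-- A frame in which the second parabolic element is standard as well. -/
lemma exists_frame_of_det_one {M g : Fin 3 → SL2Z} (hM : ∀ i, M i = g i * parab 1 0 * (g i)⁻¹)
    (hx : trZ (M 0 * M 1) = 1) : ∃ (k : SL2Z) (p q : ℤ), M 0 = k * parab 1 0 * k⁻¹ ∧
      M 1 = k * parab 0 1 * k⁻¹ ∧ M 2 = k * parab p q * k⁻¹ ∧ (0 < p ∨ p = 0 ∧ 0 ≤ q) := by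
  suffices h : ∃ (k : SL2Z) (p q : ℤ), M 0 = k * parab 1 0 * k⁻¹ ∧
      M 1 = k * parab 0 1 * k⁻¹ ∧ M 2 = k * parab p q * k⁻¹ by
    obtain ⟨k, p, q, e0, e1, e2⟩ := h
    by_cases hpq : 0 < p ∨ p = 0 ∧ 0 ≤ q
    · exact ⟨k, p, q, e0, e1, e2, hpq⟩
    · exact ⟨k, -p, -q, e0, e1, frame_neg e2, by omega⟩
  obtain ⟨k, h₁, h₂, e0, e1, e2⟩ := exists_frame hM
  have hq := (traces_frame e0 e1 e2).1
  rw [hx] at hq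
  have hq' : h₁ 1 0 = 1 ∨ h₁ 1 0 = -1 := Int.eq_one_or_neg_one_of_mul_eq_one (by linarith : h₁ 1 0 *
      h₁ 1 0 = 1)
  obtain ⟨p, q, e1⟩ : ∃ p q, q = 1 ∧ M 1 = k * parab p q * k⁻¹ := by
    rcases hq' with h | h
    · exact ⟨_, _, h, e1⟩
    · exact ⟨_, _, by rw [h]; rfl, frame_neg e1⟩
  obtain ⟨rfl, e1⟩ := e1
  refine ⟨k * unip p, h₂ 0 0 - p * h₂ 1 0, h₂ 1 0, ?_, ?_, frame_change e2 p⟩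
  · simpa using frame_change e0 p
  · simpa using frame_change e1 p

/-- The trace of a parabolic against a conjugate of `-genS` is a sum of two squares, not both zero,
so neighbouring vectors have determinant `0` or `±1`. If the first determinant is `±1`, the first
two vectors become the standard basis and the third solves `p² + pq + q² = 1`. -/
lemma classify_triplesTwo {M g : Fin 3 → SL2Z} (hM : ∀ i, M i = g i * parab 1 0 * (g i)⁻¹)
    {h : SL2Z} (hN : M 0 * M 1 * M 2 * (h * -genS * h⁻¹) = 1) :
    ∃ (k : SL2Z) (j : Fin 4), ∀ i, M i = k * triplesTwo j i * k⁻¹ := by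
  obtain ⟨t1, t2, t3⟩ := trZ_first hN
  have key : ∀ i, 1 ≤ trZ (M i * (h * -genS * h⁻¹)) := by
    intro i
    rw [hM, trZ_conj_mul_conj, conj_parab_one]
    generalize h⁻¹ * g i = l
    obtain ⟨a1, a2, a3, a4⟩ := parab_apply (l 0 0) (l 1 0)
    have hd := slz_det l
    have s1 : (-genS) 0 0 = 0 := by decide
    have s2 : (-genS) 0 1 = -1 := by decide
    have s3 : (-genS) 1 0 = 1 := by decide
    have s4 : (-genS) 1 1 = 0 := by decide
    simp only [trZ, slz_mul, a1, a2, a3, a4, s1, s2, s3, s4]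
    by_contra hlt
    have e1 : l 0 0 = 0 := by nlinarith [sq_nonneg (l 0 0), sq_nonneg (l 1 0)]
    have e2 : l 1 0 = 0 := by nlinarith [sq_nonneg (l 0 0), sq_nonneg (l 1 0)]
    rw [e1, e2] at hd
    simp at hd
  have t3 : trZ (M 0 * M 1 * M 2) = 0 := by rw [t3, trZ_conj]; decide
  have k1 := key 2
  rw [← t1] at k1
  have k2 := key 0
  rw [← t2] at k2
  by_cases hx : trZ (M 0 * M 1) = 1
  · obtain ⟨k, p, q, e0, e1, e2, hpq⟩ := exists_frame_of_det_one hM hx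
    obtain ⟨-, u2, u3⟩ := traces_frame e0 e1 e2
    rw [u2] at k2
    rw [t3] at u3
    have k2 : p ^ 2 ≤ 1 := by linarith
    have u3 : p ^ 2 + p * q + q ^ 2 = 1 := by linarith
    clear u2
    have hp : -1 ≤ p ∧ p ≤ 1 := ⟨by nlinarith, by nlinarith⟩
    have hq : -1 ≤ q ∧ q ≤ 1 := ⟨by nlinarith, by nlinarith⟩
    obtain ⟨hp1, hp2⟩ := hp
    obtain ⟨hq1, hq2⟩ := hq
    interval_cases p <;> interval_cases q <;> first | omega | skip
    · exact ⟨k, 1, fun i => by fin_cases i <;> assumption⟩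
    · exact ⟨k, 2, fun i => by fin_cases i <;> assumption⟩
    · exact ⟨k, 0, fun i => by fin_cases i <;> assumption⟩
  -- Here the first two vectors are parallel and primitive, so the first two matrices coincide.
  · obtain ⟨k, h₁, h₂, e0, e1, e2⟩ := exists_frame hM
    have hd := slz_det h₁
    obtain ⟨u1, u2, u3⟩ := traces_frame e0 e1 e2
    generalize h₁ 0 0 = a, h₁ 1 0 = b at *
    generalize h₂ 0 0 = p, h₂ 1 0 = q at *
    have hb : b = 0 := by
      rw [u1] at k1 hx
      have : -1 ≤ b ∧ b ≤ 1 := ⟨by nlinarith, by nlinarith⟩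
      obtain ⟨h1, h2⟩ := this
      interval_cases b <;> omega
    subst hb
    have ha : a = 1 ∨ a = -1 := by
      rw [mul_zero, sub_zero] at hd
      exact Int.eq_one_or_neg_one_of_mul_eq_one hd
    have e1 : M 1 = k * parab 1 0 * k⁻¹ := by
      rcases ha with rfl | rfl
      · exact e1
      · simpa using frame_neg e1
    obtain ⟨-, -, u3⟩ := traces_frame e0 e1 e2
    rw [t3] at u3
    have u3 : q * q = 1 := by linarith
    obtain ⟨p, q, rfl, e2⟩ : ∃ p q, q = 1 ∧ M 2 = k * parab p q * k⁻¹ := by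
      have hq : q = 1 ∨ q = -1 := Int.eq_one_or_neg_one_of_mul_eq_one u3
      rcases hq with h | h
      · exact ⟨_, _, h, e2⟩
      · exact ⟨_, _, by rw [h]; rfl, frame_neg e2⟩
    refine ⟨k * unip p, 3, fun i => ?_⟩
    have f0 := frame_change e0 p
    have f1 := frame_change e1 p
    have f2 := frame_change e2 p
    simp only [mul_zero, sub_zero, mul_one, sub_self] at f0 f1 f2
    fin_cases i <;> assumption

/-- Against the cube of a parabolic, a determinant `d` of neighbouring vectors satisfies `d² + 3n² =
4`, so `d² = 1` or `4`. For the first pair, `d² = 1` leads to `p² + pq + q² = 3`, and `d² = 4` to a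
single triple. -/
lemma classify_triplesThree {M g : Fin 3 → SL2Z} (hM : ∀ i, M i = g i * parab 1 0 * (g i)⁻¹)
    {h : SL2Z} (hN : M 0 * M 1 * M 2 * (h * -(parab 1 0) ^ 3 * h⁻¹) = 1) :
    ∃ (k : SL2Z) (j : Fin 4), ∀ i, M i = k * triplesThree j i * k⁻¹ := by
  obtain ⟨t1, t2, t3⟩ := trZ_first hN
  have key : ∀ i, ∃ n : ℤ, trZ (M i * (h * -(parab 1 0) ^ 3 * h⁻¹)) = 3 * n ^ 2 - 2 := by
    intro i
    rw [hM, trZ_conj_mul_conj, conj_parab_one]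
    generalize h⁻¹ * g i = l
    obtain ⟨a1, a2, a3, a4⟩ := parab_apply (l 0 0) (l 1 0)
    have s1 : (-(parab 1 0) ^ 3) 0 0 = 1 := by decide
    have s2 : (-(parab 1 0) ^ 3) 0 1 = -3 := by decide
    have s3 : (-(parab 1 0) ^ 3) 1 0 = 0 := by decide
    have s4 : (-(parab 1 0) ^ 3) 1 1 = 1 := by decide
    simp only [trZ, slz_mul, a1, a2, a3, a4, s1, s2, s3, s4]
    exact ⟨l 1 0, by ring⟩
  have t3 : trZ (M 0 * M 1 * M 2) = 2 := by rw [t3, trZ_conj]; decide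
  obtain ⟨n, k1⟩ := key 2
  rw [← t1] at k1
  obtain ⟨m, k2⟩ := key 0
  rw [← t2] at k2
  have values : ∀ a b : ℤ, 2 - a ^ 2 = 3 * b ^ 2 - 2 → a ^ 2 = 1 ∨ a ^ 2 = 4 := by
    intro a b hab
    obtain ⟨h1, h2⟩ : -1 ≤ b ∧ b ≤ 1 := ⟨by nlinarith, by nlinarith⟩
    interval_cases b <;> omega
  by_cases hx : trZ (M 0 * M 1) = 1
  · obtain ⟨k, p, q, e0, e1, e2, hpq⟩ := exists_frame_of_det_one hM hx
    obtain ⟨-, u2, u3⟩ := traces_frame e0 e1 e2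
    have k2 := values _ _ (u2.symm.trans k2)
    rw [t3] at u3
    have k2 : p ^ 2 = 1 ∨ p ^ 2 = 4 := by
      rwa [zero_mul, one_mul, zero_sub, neg_sq] at k2
    have u3 : p ^ 2 + p * q + q ^ 2 = 3 := by linarith
    clear u2
    have hp : -2 ≤ p ∧ p ≤ 2 := ⟨by rcases k2 with h | h <;> nlinarith,
      by rcases k2 with h | h <;> nlinarith⟩
    have hq : -2 ≤ q ∧ q ≤ 2 := ⟨by nlinarith, by nlinarith⟩
    obtain ⟨hp1, hp2⟩ := hp
    obtain ⟨hq1, hq2⟩ := hq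
    interval_cases p <;> interval_cases q <;> first | omega | skip
    · exact ⟨k, 1, fun i => by fin_cases i <;> assumption⟩
    · exact ⟨k, 0, fun i => by fin_cases i <;> assumption⟩
    · exact ⟨k, 2, fun i => by fin_cases i <;> assumption⟩
  · obtain ⟨k, h₁, h₂, e0, e1, e2⟩ := exists_frame hM
    have hd := slz_det h₁
    have hd' := slz_det h₂
    obtain ⟨u1, u2, u3⟩ := traces_frame e0 e1 e2
    generalize h₁ 0 0 = a, h₁ 1 0 = b at *
    generalize h₂ 0 0 = p, h₂ 1 0 = q at *
    have hb := (values b n (u1.symm.trans k1)).resolve_left (fun h => hx (by rw [u1, h]; rfl))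
    have hb' : b = 2 ∨ b = -2 := sq_eq_sq_iff_eq_or_eq_neg.1 (by linarith)
    -- A primitive vector with second entry `±2` has odd first entry, so up to sign a unipotent
    -- conjugation makes it `(1, 2)`.
    have hodd : a % 2 = 1 := by
      rcases Int.emod_two_eq_zero_or_one a with h | h
      · exfalso
        obtain ⟨c, rfl⟩ : ∃ c, a = 2 * c := ⟨a / 2, by omega⟩
        rcases hb' with rfl | rfl <;> rw [mul_assoc] at hd <;> omega
      · exact h
    clear hd u1 u2 u3
    obtain ⟨c, e1⟩ : ∃ c, M 1 = k * parab (1 + c * 2) 2 * k⁻¹ := by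
      rcases hb' with rfl | rfl
      · refine ⟨a / 2, ?_⟩
        rwa [show 1 + a / 2 * 2 = a by omega]
      · refine ⟨-a / 2, ?_⟩
        have e2 := frame_neg e1
        rw [neg_neg] at e2
        rwa [show 1 + -a / 2 * 2 = -a by omega]
    have f0 := frame_change e0 c
    have f1 := frame_change e1 c
    have f2 := frame_change e2 c
    simp only [mul_zero, sub_zero, add_sub_cancel_right] at f0 f1
    obtain ⟨-, v2, v3⟩ := traces_frame f0 f1 f2
    replace v2 := values _ _ (v2.symm.trans k2)
    rw [t3] at v3
    have hp : p - c * q = 0 := by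
      -- In this frame the condition that the triple product has trace 2 collapses to this square.
      have : (p - c * q) ^ 2 = 0 := by linarith
      exact pow_eq_zero_iff two_ne_zero |>.1 this
    rw [hp] at f2 v2
    have hq : q = 1 ∨ q = -1 := by
      rcases v2 with v2 | v2
      · exact Int.eq_one_or_neg_one_of_mul_eq_one (by linarith : q * q = 1)
      · exfalso
        have hq : q = 2 ∨ q = -2 := sq_eq_sq_iff_eq_or_eq_neg.1 (by linarith)
        have hp : p = c * q := by linarith
        rw [hp, mul_right_comm] at hd'
        rcases hq with rfl | rfl <;> omega
    have f2 : M 2 = k * unip c * parab 0 1 * (k * unip c)⁻¹ := by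
      rcases hq with rfl | rfl
      · exact f2
      · simpa using frame_neg f2
    exact ⟨k * unip c, 3, fun i => by fin_cases i <;> assumption⟩

/-! ### Rotations in the disc model -/

/-- The diagonal entry of the matrix of `SU(1, 1)` that corresponds to `g`. -/
noncomputable def cayleyDiag (g : SL2R) : ℂ := ⟨(g 0 0 + g 1 1) / 2, (g 0 1 - g 1 0) / 2⟩

/-- The off-diagonal entry of the matrix of `SU(1, 1)` that corresponds to `g`. -/
noncomputable def cayleyOff (g : SL2R) : ℂ := ⟨(g 0 1 + g 1 0) / 2, (g 0 0 - g 1 1) / 2⟩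

lemma cayleyDiag_mul (g h : SL2R) : cayleyDiag (g * h) =
    cayleyDiag g * cayleyDiag h + cayleyOff g * (starRingEnd ℂ) (cayleyOff h) := by
  apply Complex.ext <;> simp [cayleyDiag, cayleyOff, sl2_mul] <;> ring

lemma cayleyOff_mul (g h : SL2R) : cayleyOff (g * h) =
    cayleyDiag g * cayleyOff h + cayleyOff g * (starRingEnd ℂ) (cayleyDiag h) := by
  apply Complex.ext <;> simp [cayleyDiag, cayleyOff, sl2_mul] <;> ring

lemma cayleyDiag_inv (g : SL2R) : cayleyDiag g⁻¹ = (starRingEnd ℂ) (cayleyDiag g) := by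
  obtain ⟨i1, i2, i3, i4⟩ := sl2_inv g
  apply Complex.ext <;> simp [cayleyDiag, i1, i2, i3, i4] <;> ring

lemma cayleyOff_inv (g : SL2R) : cayleyOff g⁻¹ = -cayleyOff g := by
  obtain ⟨i1, i2, i3, i4⟩ := sl2_inv g
  apply Complex.ext <;> simp [cayleyOff, i1, i2, i3, i4] <;> ring

lemma cayleyDiag_neg (g : SL2R) : cayleyDiag (-g) = -cayleyDiag g := by
  apply Complex.ext <;> simp [cayleyDiag, sl2_neg] <;> ring

lemma cayleyOff_neg (g : SL2R) : cayleyOff (-g) = -cayleyOff g := by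
  apply Complex.ext <;> simp [cayleyOff, sl2_neg] <;> ring

lemma tr2_eq_cayleyDiag (g : SL2R) : tr2 g = 2 * (cayleyDiag g).re := by
  simp [tr2, cayleyDiag]; ring

lemma rotAt_I (t : ℝ) : rotAt I t = rot t := by
  have := conj_rot 1 t
  simpa using this.symm

lemma cayleyDiag_rot (t : ℝ) : cayleyDiag (rot t) = ⟨cos (t / 2), sin (t / 2)⟩ := by
  obtain ⟨r1, r2, r3, r4⟩ := rot_apply t
  apply Complex.ext <;> simp [cayleyDiag, r1, r2, r3, r4]

lemma cayleyOff_rot (t : ℝ) : cayleyOff (rot t) = 0 := by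
  obtain ⟨r1, r2, r3, r4⟩ := rot_apply t
  apply Complex.ext <;> simp [cayleyOff, r1, r2, r3, r4]

lemma cayleyDiag_rotAt_re (w : ℍ) (t : ℝ) : (cayleyDiag (rotAt w t)).re = cos (t / 2) := by
  obtain ⟨r1, r2, r3, r4⟩ := rotAt_apply w t
  simp [cayleyDiag, r1, r4]

/-- The off-diagonal entry of the rotation of angle `π` about `w`. -/
noncomputable def discVec (w : ℍ) : ℂ := ⟨(w.re ^ 2 + w.im ^ 2 - 1) / (2 * w.im), -w.re / w.im⟩

/-- Angle and centre separate: the argument of the off-diagonal entry is the direction of `w` seen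
from `I`, by `discCoord_I`. -/
lemma cayleyOff_rotAt (w : ℍ) (t : ℝ) : cayleyOff (rotAt w t) = sin (t / 2) * discVec w := by
  obtain ⟨r1, r2, r3, r4⟩ := rotAt_apply w t
  have := w.im_pos.ne'
  apply Complex.ext <;>
    simp only [cayleyOff, discVec, r1, r2, r3, r4, Complex.re_ofReal_mul, Complex.im_ofReal_mul] <;>
    field_simp <;> ring

lemma discCoord_I (w : ℍ) : ∃ k : ℝ, 0 < k ∧ discCoord I w = k * discVec w := by
  have hw := w.im_pos
  have h0 : 0 < w.re ^ 2 + (w.im + 1) ^ 2 := by positivity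
  refine ⟨2 * w.im / (w.re ^ 2 + (w.im + 1) ^ 2), by positivity, ?_⟩
  have hne : (w : ℂ) - (starRingEnd ℂ) (I : ℂ) ≠ 0 := by
    intro h
    have := congrArg Complex.im h
    simp at this
    linarith
  rw [discCoord, div_eq_iff hne, UpperHalfPlane.coe_I]
  rw [mul_assoc]
  apply Complex.ext
  · rw [Complex.re_ofReal_mul]; simp [discVec]; field_simp; ring
  · rw [Complex.im_ofReal_mul]; simp [discVec]; field_simp; ring

lemma discVec_eq_zero {w : ℍ} (h : discVec w = 0) : w = I := by
  have h1 := congrArg Complex.im h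
  have h2 := congrArg Complex.re h
  have hw := w.im_pos
  simp only [discVec, Complex.zero_im, Complex.zero_re, div_eq_zero_iff, neg_eq_zero, hw.ne',
      or_false,
    mul_eq_zero, OfNat.ofNat_ne_zero] at h1 h2
  refine UpperHalfPlane.ext (Complex.ext (by simpa using h1) ?_)
  rw [h1] at h2
  have : (w.im - 1) * (w.im + 1) = 0 := by linarith
  rcases mul_eq_zero.1 this with h | h
  · simpa using (by linarith : w.im = 1)
  · linarith

/-- The map to the disc changes by a rotation under an isometry. -/
lemma discCoord_smul (g : SL2R) (z : ℍ) :
    ∃ c : ℂ, c ≠ 0 ∧ ∀ w, discCoord (g • z) (g • w) = c * discCoord z w := by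
  have hd : ∀ w : ℍ, (g 1 0 : ℂ) * w + (g 1 1 : ℂ) ≠ 0 :=
    fun w => mod_cast denom_ne_zero (g : GL (Fin 2) ℝ) w
  have hdet : (g 0 0 : ℂ) * g 1 1 - g 0 1 * g 1 0 = 1 := by exact_mod_cast sl2_det g
  have hc : ∀ w : ℍ, ((g • w : ℍ) : ℂ) = (g 0 0 * w + g 0 1) / (g 1 0 * w + g 1 1) := fun w => by
    rw [coe_specialLinearGroup_apply]; rfl
  have hz := hd z
  have hz' : (g 1 0 : ℂ) * (starRingEnd ℂ) z + (g 1 1 : ℂ) ≠ 0 := by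
    have := (map_ne_zero (starRingEnd ℂ)).2 hz
    simpa using this
  -- The factor is the conjugate of the automorphy factor at `z` divided by the factor itself, hence
  -- of modulus 1.
  refine ⟨(g 1 0 * (starRingEnd ℂ) z + g 1 1) / (g 1 0 * z + g 1 1), div_ne_zero hz' hz, ?_⟩
  intro w
  have hw := hd w
  have hne : ∀ w z : ℍ, (w : ℂ) - (starRingEnd ℂ) (z : ℂ) ≠ 0 := by
    intro w z h
    have := congrArg Complex.im h
    simp at this
    linarith [w.im_pos, z.im_pos]
  have h1 : ((g • w : ℍ) : ℂ) - ((g • z : ℍ) : ℂ) =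
      (w - z) / ((g 1 0 * w + g 1 1) * (g 1 0 * z + g 1 1)) := by
    rw [hc, hc, div_sub_div _ _ hw hz]
    congr 1
    linear_combination ((w : ℂ) - z) * hdet
  have h2 : ((g • w : ℍ) : ℂ) - (starRingEnd ℂ) ((g • z : ℍ) : ℂ) =
      (w - (starRingEnd ℂ) z) / ((g 1 0 * w + g 1 1) * (g 1 0 * (starRingEnd ℂ) z + g 1 1)) := by
    rw [hc, hc, map_div₀]
    simp only [map_add, map_mul, Complex.conj_ofReal]
    rw [div_sub_div _ _ hw hz']
    congr 1
    linear_combination ((w : ℂ) - (starRingEnd ℂ) z) * hdet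
  have h3 := hne w z
  rw [discCoord, discCoord, h1, h2]
  generalize (g 1 0 : ℂ) * w + g 1 1 = A at *
  generalize (g 1 0 : ℂ) * z + g 1 1 = B at *
  generalize (g 1 0 : ℂ) * (starRingEnd ℂ) z + g 1 1 = B' at *
  generalize (w : ℂ) - (starRingEnd ℂ) z = D at *
  field_simp

lemma orientedAngle_smul (g : SL2R) (z p q : ℍ) :
    orientedAngle (g • z) (g • p) (g • q) = orientedAngle z p q := by
  obtain ⟨c, hc, h⟩ := discCoord_smul g z
  rw [orientedAngle, h, h, mul_div_mul_left _ _ hc, orientedAngle]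

lemma orientedAngle_I (p q : ℍ) : ∃ k : ℝ, 0 < k ∧
    orientedAngle I p q = Complex.arg (k * (discVec q / discVec p)) := by
  obtain ⟨a, ha, h1⟩ := discCoord_I p
  obtain ⟨b, hb, h2⟩ := discCoord_I q
  refine ⟨b / a, by positivity, ?_⟩
  rw [orientedAngle, h1, h2]
  congr 1
  push_cast
  rw [mul_div_mul_comm]

/-- The angle at the first vertex of a triangle is half of the rotation angle there, if the product
of the three rotations is trivial. -/
lemma orientedAngle_of_product {P Q R : ℍ} {a b c : ℝ} (ha : a ∈ Set.Ioo 0 π)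
    (hb : b ∈ Set.Ioo 0 π) (hc : c ∈ Set.Ioo 0 π) (hPQ : P ≠ Q)
    (h : rotAt P (2 * a) * rotAt Q (2 * b) * rotAt R (2 * c) = -1) :
    orientedAngle P Q R = a := by
  obtain ⟨g, hg⟩ : ∃ g : SL2R, g • P = I := ⟨P.toSL2R⁻¹, by rw [inv_smul_eq_iff, toSL2R_smul_I]⟩
  have h' : rot (2 * a) * rotAt (g • Q) (2 * b) * rotAt (g • R) (2 * c) = -1 := by
    rw [← rotAt_I, ← hg, ← conj_rotAt, ← conj_rotAt, ← conj_rotAt, conj_mul_conj, conj_mul_conj, h]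
    simp
  rw [← orientedAngle_smul g, hg]
  obtain ⟨k, hk, e⟩ := orientedAngle_I (g • Q) (g • R)
  have hQ : discVec (g • Q) ≠ 0 := fun h => hPQ (smul_left_cancel g (hg.trans (discVec_eq_zero
      h).symm))
  have h1 : rot (2 * a) * rotAt (g • Q) (2 * b) = -(rotAt (g • R) (2 * c))⁻¹ := by
    rw [eq_comm, neg_eq_iff_eq_neg, inv_eq_iff_eq_inv, eq_comm, inv_eq_iff_mul_eq_one, neg_mul, h',
        neg_neg]
  have h2 := congrArg cayleyOff h1
  rw [cayleyOff_mul, cayleyOff_neg, cayleyOff_inv, cayleyOff_rot, zero_mul, add_zero, neg_neg,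
    cayleyOff_rotAt, cayleyOff_rotAt, cayleyDiag_rot] at h2
  simp only [mul_div_cancel_left₀ _ (two_ne_zero : (2 : ℝ) ≠ 0)] at h2
  have hsb := sin_pos_of_mem_Ioo hb
  have hsc := sin_pos_of_mem_Ioo hc
  have h3 : discVec (g • R) / discVec (g • Q) = ((sin b / sin c : ℝ) : ℂ) *
      (Complex.cos a + Complex.sin a * Complex.I) := by
    have hsc' : (sin c : ℂ) ≠ 0 := by exact_mod_cast hsc.ne'
    have e : (⟨cos a, sin a⟩ : ℂ) = Complex.cos a + Complex.sin a * Complex.I := by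
      rw [← Complex.ofReal_cos, ← Complex.ofReal_sin, Complex.mk_eq_add_mul_I]
    rw [e] at h2
    rw [div_eq_iff hQ, Complex.ofReal_div, div_mul_eq_mul_div, div_mul_eq_mul_div, eq_div_iff hsc']
    linear_combination -h2
  rw [e, h3, ← mul_assoc, ← Complex.ofReal_mul, Complex.arg_mul_cos_add_sin_mul_I (by positivity)]
  exact ⟨by linarith [ha.1, pi_pos], ha.2.le⟩

/-! ### Action-angle coordinates from traces -/

/-- The centre is the root of the fixed point equation with positive imaginary part; the sign of `g
1 0` decides between `β` and `2π - β` with the opposite lift. -/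
lemma exists_rotAt {g : SL2R} {β : ℝ} (hβ : β ∈ Set.Ioo 0 (2 * π)) (ht : tr2 g = 2 * cos (β / 2))
    (hg : g 1 0 < 0) : ∃ B : ℍ, g = rotAt B β := by
  have hs := sin_half_pos hβ.1 hβ.2
  have hd := sl2_det g
  have hsc := sin_sq_add_cos_sq (β / 2)
  simp only [tr2] at ht
  have him : 0 < -sin (β / 2) / g 1 0 := div_pos_of_neg_of_neg (by linarith) hg
  refine ⟨⟨⟨-(g 1 1 - g 0 0) / (2 * g 1 0), -sin (β / 2) / g 1 0⟩, him⟩, ?_⟩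
  obtain ⟨r1, r2, r3, r4⟩ := rotAt_apply ⟨⟨-(g 1 1 - g 0 0) / (2 * g 1 0), -sin (β / 2) / g 1 0⟩,
      him⟩ β
  have hg' := hg.ne
  apply sl2_ext <;> simp only [r1, r2, r3, r4]
  · change _ = cos (β / 2) - sin (β / 2) * ((-(g 1 1 - g 0 0) / (2 * g 1 0)) / (-sin (β / 2) / g 1
        0))
    field_simp
    linarith
  · change _ = sin (β / 2) * (((-(g 1 1 - g 0 0) / (2 * g 1 0)) ^ 2 + (-sin (β / 2) / g 1 0) ^ 2) /
        (-sin (β / 2) / g 1 0))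
    field_simp
    linear_combination (g 0 0 + g 1 1 + 2 * cos (β / 2)) * ht - 4 * hd + 4 * hsc
  · change _ = -(sin (β / 2) / (-sin (β / 2) / g 1 0))
    field_simp
  · change _ = cos (β / 2) + sin (β / 2) * ((-(g 1 1 - g 0 0) / (2 * g 1 0)) / (-sin (β / 2) / g 1
        0))
    field_simp
    linarith

/-- A representative whose curve `b` is mapped to a rotation about `I`. -/
lemma HasTraces.exists_chain {α : Fin 4 → ℝ} (hα : Admissible α) {p : RepClass} {y z β : ℝ}
    (hβ : β ∈ Set.Ioo 0 (2 * π)) (h : HasTraces α p (2 * cos (β / 2)) y z) :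
    ∃ (ρ : SphereRep) (C : Fin 4 → ℍ), ρ.cls = p ∧ liftProd α C = -1 ∧ IsTriangleChain α ρ C I β ∧
      rotAt (C 0) (α 0) * rotAt (C 1) (α 1) = (rot β)⁻¹ ∧
      tr2 (rotAt (C 1) (α 1) * rotAt (C 2) (α 2)) = y ∧
      tr2 (rotAt (C 0) (α 0) * rotAt (C 2) (α 2)) = z := by
  obtain ⟨ρ, C, rfl, hC, hx, rfl, rfl⟩ := h
  obtain ⟨B, hB⟩ := exists_rotAt (g := (rotAt (C 0) (α 0) * rotAt (C 1) (α 1))⁻¹) hβ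
    (by rw [tr2_inv, hx]) (by rw [(sl2_inv _).2.2.1]; linarith [first_two_pos hα hC.2])
  set g : SL2R := B.toSL2R⁻¹ with hg
  have hgB : g • B = I := by rw [inv_smul_eq_iff, toSL2R_smul_I]
  let σ : SphereRep := (MulAut.conj (proj g)).toMonoidHom.comp ρ
  have hσ : ∀ x, σ x = proj g * ρ x * (proj g)⁻¹ := fun x => rfl
  have hC' := hC.conj g hσ
  have hcls : σ.cls = ρ.cls := (Quotient.sound ⟨proj g, hσ⟩ : ρ.cls = σ.cls).symm
  have e : rotAt (g • C 0) (α 0) * rotAt (g • C 1) (α 1) = (rot β)⁻¹ := by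
    rw [← conj_rotAt, ← conj_rotAt, conj_mul_conj, ← rotAt_I, ← hgB, ← conj_rotAt, ← hB]
    group
  refine ⟨σ, fun i => g • C i, hcls, hC'.2, ⟨fun i => ?_, hβ, ?_⟩, e, ?_, ?_⟩
  · rw [isRotation_iff]; exact hC'.1 i
  · rw [isRotation_iff, curveB, map_inv, map_mul, hC'.1, hC'.1, ← map_mul, e, map_inv, inv_inv,
      rotAt_I]
  · simp only [tr2_rotAt_mul, dist_smul]
  · simp only [tr2_rotAt_mul, dist_smul]

/-- At this value of `β` the law of cosines reads `cosh (dist (C 0) (C 1)) = 1`. -/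
lemma HasTraces.isSouthPole {α : Fin 4 → ℝ} (hα : Admissible α) {p : RepClass} {x y z β : ℝ}
    (h : HasTraces α p x y z) (hβ : β ∈ Set.Ioo 0 (2 * π)) (hx : x = 2 * cos (β / 2))
    (hβ' : β = 4 * π - α 0 - α 1) : IsSouthPole α p β := by
  subst hx
  obtain ⟨ρ, C, hp, -, hch, h01, -⟩ := h.exists_chain hα hβ
  refine ⟨⟨ρ, C, I, hp, hch, Or.inl ?_⟩, hβ'⟩
  have h1 := congrArg tr2 h01
  rw [tr2_rotAt_mul, tr2_inv, ← rotAt_I, tr2_rotAt, hβ',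
    show (4 * π - α 0 - α 1) / 2 = 2 * π - (α 0 / 2 + α 1 /
        2) by ring, cos_two_pi_sub, cos_add] at h1
  have hs := mul_pos (hα.sin_pos 0) (hα.sin_pos 1)
  have h2 : cosh (dist (C 0) (C 1)) = cosh (dist (C 0) (C 0)) := by
    rw [dist_self, cosh_zero]
    refine mul_left_cancel₀ hs.ne' ?_
    linarith
  rw [← dist_eq_zero, cosh_dist_inj h2, dist_self]

lemma HasTraces.isNorthPole {α : Fin 4 → ℝ} (hα : Admissible α) {p : RepClass} {x y z β : ℝ}
    (h : HasTraces α p x y z) (hβ : β ∈ Set.Ioo 0 (2 * π)) (hx : x = 2 * cos (β / 2))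
    (hβ' : β = α 2 + α 3 - 2 * π) : IsNorthPole α p β := by
  subst hx
  obtain ⟨ρ, C, hp, hC, hch, h01, -⟩ := h.exists_chain hα hβ
  refine ⟨⟨ρ, C, I, hp, hch, Or.inr ?_⟩, hβ'⟩
  have h1 := tr2_last_two hC
  rw [tr2_rotAt_mul, h01, tr2_inv, ← rotAt_I, tr2_rotAt, hβ',
    show (α 2 + α 3 - 2 * π) / 2 = (α 2 / 2 + α 3 / 2) - π by ring, cos_sub_pi, cos_add] at h1
  have hs := mul_pos (hα.sin_pos 2) (hα.sin_pos 3)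
  have h2 : cosh (dist (C 2) (C 3)) = cosh (dist (C 2) (C 2)) := by
    rw [dist_self, cosh_zero]
    refine mul_left_cancel₀ hs.ne' ?_
    linarith
  rw [← dist_eq_zero, cosh_dist_inj h2, dist_self]

/-- Two rotations with the same centre differ by a real factor off the diagonal. -/
lemma ne_of_cayleyOff {z w : ℍ} {s t : ℝ} {u : ℂ} (hu : u.im ≠ 0) (hne : cayleyOff (rotAt w t) ≠ 0)
    (h : cayleyOff (rotAt z s) = u * cayleyOff (rotAt w t)) : z ≠ w := by
  rintro rfl
  rw [cayleyOff_rotAt, cayleyOff_rotAt, ← mul_assoc] at h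
  rw [cayleyOff_rotAt] at hne
  have h1 := mul_right_cancel₀ (right_ne_zero_of_mul hne) h
  have h2 := congrArg Complex.im h1
  rw [Complex.ofReal_im, Complex.im_mul_ofReal] at h2
  rcases mul_eq_zero.1 h2.symm with h3 | h3
  · exact hu h3
  · rw [h3] at hne; simp at hne

/-- With `B = I`, the matrices `M0` and `M3` are `M1⁻¹` and `M2⁻¹` times a diagonal rotation, up to
sign. Their traces force the imaginary parts `a`, `b` of the diagonal entries of `M1`, `M2`. Then
`y` and `z` give the real and imaginary parts of `cayleyOff M1 * conj (cayleyOff M2)`, which is `κ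
exp (iγ)`; its argument is the angle from `C 2` to `C 1`, and `κ > 0` makes both triangles
nondegenerate. -/
theorem HasTraces.hasCoordinates {α : Fin 4 → ℝ} (hα : Admissible α) {p : RepClass} {y z β γ κ a b :
    ℝ}
    (hβ : β ∈ Set.Ioo 0 (2 * π)) (h : HasTraces α p (2 * cos (β / 2)) y z) (hκ : 0 < κ)
    (ha : sin (β / 2) * a = cos (β / 2) * cos (α 1 / 2) - cos (α 0 / 2))
    (hb : sin (β / 2) * b = -(cos (α 3 / 2) + cos (β / 2) * cos (α 2 / 2)))
    (hy : y = 2 * (cos (α 1 / 2) * cos (α 2 / 2) - a * b + κ * cos γ))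
    (hz : z = 2 * (cos (β / 2) * (cos (α 1 / 2) * cos (α 2 / 2) + a * b) +
      sin (β / 2) * (cos (α 1 / 2) * b - a * cos (α 2 / 2)) -
      κ * (cos (β / 2) * cos γ + sin (β / 2) * sin γ))) :
    HasCoordinates α p β γ := by
  obtain ⟨ρ, C, hp, hC, hch, h01, h12, h02⟩ := h.exists_chain hα hβ
  have hs := sin_half_pos hβ.1 hβ.2
  set M0 := rotAt (C 0) (α 0) with hM0
  set M1 := rotAt (C 1) (α 1) with hM1
  set M2 := rotAt (C 2) (α 2) with hM2
  set M3 := rotAt (C 3) (α 3) with hM3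
  have e0 : M0 = (rot β)⁻¹ * M1⁻¹ := by rw [← h01]; group
  have e3 : M3 = -(M2⁻¹ * rot β) := by
    have : M0 * M1 * M2 * M3 = -1 := hC
    rw [h01] at this
    have h3 : M3 = M2⁻¹ * rot β * ((rot β)⁻¹ * M2 * M3) := by group
    rw [h3, this]; simp
  have r0 : (cayleyDiag M0).re = cos (α 0 / 2) := cayleyDiag_rotAt_re _ _
  have r1 : (cayleyDiag M1).re = cos (α 1 / 2) := cayleyDiag_rotAt_re _ _
  have r2 : (cayleyDiag M2).re = cos (α 2 / 2) := cayleyDiag_rotAt_re _ _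
  have r3 : (cayleyDiag M3).re = cos (α 3 / 2) := cayleyDiag_rotAt_re _ _
  have d0 : cayleyDiag M0 = ⟨cos (β / 2), -sin (β / 2)⟩ * (starRingEnd ℂ) (cayleyDiag M1) := by
    rw [e0, cayleyDiag_mul, cayleyOff_inv (rot β), cayleyOff_rot, cayleyDiag_inv, cayleyDiag_inv,
      cayleyDiag_rot]; simp; left; exact Complex.ext rfl rfl
  have x0 : cayleyOff M0 = -⟨cos (β / 2), -sin (β / 2)⟩ * cayleyOff M1 := by
    rw [e0, cayleyOff_mul, cayleyOff_inv (rot β), cayleyOff_rot, cayleyDiag_inv, cayleyOff_inv,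
      cayleyDiag_rot]; simp; left; exact Complex.ext rfl rfl
  have d3 : cayleyDiag M3 = -((starRingEnd ℂ) (cayleyDiag M2) * ⟨cos (β / 2), sin (β / 2)⟩) := by
    rw [e3, cayleyDiag_neg, cayleyDiag_mul, cayleyOff_rot, cayleyDiag_inv, cayleyDiag_rot]; simp
  have x3 : cayleyOff M3 = ⟨cos (β / 2), -sin (β / 2)⟩ * cayleyOff M2 := by
    rw [e3, cayleyOff_neg, cayleyOff_mul, cayleyOff_rot, cayleyOff_inv, cayleyDiag_rot]
    simp [mul_comm]; left; exact Complex.ext rfl rfl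
  have ia : (cayleyDiag M1).im = a := by
    have := congrArg Complex.re d0
    rw [r0] at this
    simp [r1] at this
    refine mul_left_cancel₀ hs.ne' ?_
    linarith
  have ib : (cayleyDiag M2).im = b := by
    have := congrArg Complex.re d3
    rw [r3] at this
    simp [r2] at this
    refine mul_left_cancel₀ hs.ne' ?_
    linarith
  have hW : cayleyOff M1 * (starRingEnd ℂ) (cayleyOff M2) = ⟨κ * cos γ, κ * sin γ⟩ := by
    rw [tr2_eq_cayleyDiag, cayleyDiag_mul, Complex.add_re, Complex.mul_re, r1, r2, ia, ib,
        hy] at h12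
    rw [tr2_eq_cayleyDiag, cayleyDiag_mul, d0, x0, mul_assoc (-_), mul_assoc, hz] at h02
    generalize cayleyOff M1 * (starRingEnd ℂ) (cayleyOff M2) = W at *
    simp [r1, r2, ia, ib] at h02
    have w1 : W.re = κ * cos γ := by linarith
    refine Complex.ext w1 (mul_left_cancel₀ hs.ne' ?_)
    rw [w1] at h02
    linarith
  have hne : (⟨κ * cos γ, κ * sin γ⟩ : ℂ) ≠ 0 := by
    intro h
    have h1 := congrArg Complex.re h
    have h2 := congrArg Complex.im h
    simp [hκ.ne'] at h1 h2
    have := sin_sq_add_cos_sq γ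
    rw [h1, h2] at this
    norm_num at this
  rw [← hW] at hne
  have n1 := left_ne_zero_of_mul hne
  have n2 : cayleyOff M2 ≠ 0 := fun h => right_ne_zero_of_mul hne (by rw [h, map_zero])
  refine ⟨ρ, C, I, hp, hch, ?_, ?_, ?_⟩
  · refine ne_of_cayleyOff ?_ n1 x0
    simpa using hs.ne'
  · refine (ne_of_cayleyOff ?_ n2 x3).symm
    simpa using hs.ne'
  · obtain ⟨k, hk, e⟩ := orientedAngle_I (C 2) (C 1)
    have s1 := hα.sin_pos 1
    have s2 := hα.sin_pos 2
    rw [hM1, cayleyOff_rotAt] at hW n1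
    rw [hM2, cayleyOff_rotAt] at hW n2
    have v2 := right_ne_zero_of_mul n2
    have key : (k * (discVec (C 1) / discVec (C 2)) : ℂ) =
        ((k * κ / (sin (α 1 / 2) * sin (α 2 / 2) * Complex.normSq (discVec (C 2))) : ℝ) : ℂ) *
          (Real.Angle.cos (γ : Real.Angle) + Real.Angle.sin (γ : Real.Angle) * Complex.I) := by
      have hmk : (⟨κ * cos γ, κ * sin γ⟩ : ℂ) = κ * (cos γ + sin γ * Complex.I) := by
        rw [Complex.mk_eq_add_mul_I, Complex.ofReal_mul, Complex.ofReal_mul]; ring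
      rw [hmk, map_mul, Complex.conj_ofReal] at hW
      have c1 : (sin (α 1 / 2) : ℂ) ≠ 0 := Complex.ofReal_ne_zero.2 s1.ne'
      have c2 : (sin (α 2 / 2) : ℂ) ≠ 0 := Complex.ofReal_ne_zero.2 s2.ne'
      have c3 := (map_ne_zero (starRingEnd ℂ)).2 v2
      rw [Real.Angle.cos_coe, Real.Angle.sin_coe, Complex.ofReal_div, Complex.ofReal_mul,
        Complex.ofReal_mul, Complex.ofReal_mul, Complex.normSq_eq_conj_mul_self]
      generalize (sin (α 1 / 2) : ℂ) = S1 at *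
      generalize (sin (α 2 / 2) : ℂ) = S2 at *
      field_simp
      linear_combination (k : ℂ) * hW
    rw [e, key, Complex.arg_mul_cos_add_sin_mul_I_coe_angle]
    have := Complex.normSq_pos.2 v2
    positivity

/-! ### Representations that factor through `SL(2, ℤ)` -/

lemma cls_eq_of_conj {F : SL2Z →* SL2R} {ψ ψ' : SphereGroup →* SL2Z} {k : SL2Z}
    (h : ∀ i : Fin 3, ψ (FreeGroup.of i) = k * ψ' (FreeGroup.of i) * k⁻¹) :
    SphereRep.cls ((proj.comp F).comp ψ) = SphereRep.cls ((proj.comp F).comp ψ') := by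
  have h1 : ψ = (MulAut.conj k).toMonoidHom.comp ψ' := FreeGroup.ext_hom _ _ h
  refine (Quotient.sound ⟨proj (F k), fun x => ?_⟩ :
    SphereRep.cls ((proj.comp F).comp ψ') = SphereRep.cls ((proj.comp F).comp ψ)).symm
  rw [h1]
  change proj (F (k * ψ' x * k⁻¹)) = _
  simp only [map_mul, map_inv, MonoidHom.comp_apply]

/-- The classes in the orbit of a representation that factors through `SL(2, ℤ)`. -/
lemma smul_cls_mem {T : Fin 4 → Fin 3 → SL2Z} {c : SL2Z}
    (hT : ∀ {M g : Fin 3 → SL2Z}, (∀ i, M i = g i * parab 1 0 * (g i)⁻¹) → ∀ {h : SL2Z},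
      M 0 * M 1 * M 2 * (h * c * h⁻¹) = 1 → ∃ (k : SL2Z) (j : Fin 4), ∀ i, M i = k * T j i * k⁻¹)
    (F : SL2Z →* SL2R) {ψ : SphereGroup →* SL2Z}
    (hψ : ∀ i : Fin 3, IsConj (parab 1 0) (ψ (peripheral i.castSucc)))
    (hψ' : IsConj c (ψ (peripheral 3))) {φ : MulAut SphereGroup} (hφ : φ ∈ PMod) :
    ∃ j, φ • SphereRep.cls ((proj.comp F).comp ψ) =
      SphereRep.cls ((proj.comp F).comp (FreeGroup.lift (T j))) := by
  let χ : SphereGroup →* SL2Z := ψ.comp (φ⁻¹ : MulAut SphereGroup).toMonoidHom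
  have hχ : ∀ i, IsConj (ψ (peripheral i)) (χ (peripheral i)) := fun i =>
    ψ.map_isConj (PMod.inv_mem hφ i)
  choose g hg using fun i : Fin 3 => isConj_iff.1 ((hψ i).trans (hχ _))
  obtain ⟨h, hh⟩ := isConj_iff.1 (hψ'.trans (hχ 3))
  obtain ⟨k, j, hk⟩ := hT (M := fun i => χ (peripheral i.castSucc)) (g := g) (fun i => (hg i).symm)
    (h := h) (by
      rw [hh]
      exact (map_mul χ _ _ ▸ map_mul χ _ _ ▸ map_mul χ _ _ ▸ peripheral_prod ▸ map_one χ))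
  refine ⟨j, cls_eq_of_conj (ψ := χ) (k := k) fun i => ?_⟩
  rw [FreeGroup.lift_apply_of, ← hk i]
  fin_cases i <;> rfl

lemma ncard_orbit_le {T : Fin 4 → Fin 3 → SL2Z} {c : SL2Z}
    (hT : ∀ {M g : Fin 3 → SL2Z}, (∀ i, M i = g i * parab 1 0 * (g i)⁻¹) → ∀ {h : SL2Z},
      M 0 * M 1 * M 2 * (h * c * h⁻¹) = 1 → ∃ (k : SL2Z) (j : Fin 4), ∀ i, M i = k * T j i * k⁻¹)
    (F : SL2Z →* SL2R) {ψ : SphereGroup →* SL2Z}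
    (hψ : ∀ i : Fin 3, IsConj (parab 1 0) (ψ (peripheral i.castSucc)))
    (hψ' : IsConj c (ψ (peripheral 3))) :
    (MulAction.orbit PMod (SphereRep.cls ((proj.comp F).comp ψ))).Finite ∧
    (MulAction.orbit PMod (SphereRep.cls ((proj.comp F).comp ψ))).ncard ≤ 4 := by
  have hsub : MulAction.orbit PMod (SphereRep.cls ((proj.comp F).comp ψ)) ⊆
      Set.range fun j => SphereRep.cls ((proj.comp F).comp (FreeGroup.lift (T j))) := by
    rintro _ ⟨φ, rfl⟩
    obtain ⟨j, hj⟩ := smul_cls_mem hT F hψ hψ' φ.2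
    exact ⟨j, hj.symm⟩
  refine ⟨(Set.finite_range _).subset hsub, (Set.ncard_le_ncard hsub (Set.finite_range _)).trans ?_⟩
  rw [← Set.image_univ]
  refine (Set.ncard_image_le Set.finite_univ).trans ?_
  simp

/-! ### The four points of the orbit -/

/-- The points of an orbit of length four, in trace coordinates. -/
def HasFourPoints (α : Fin 4 → ℝ) (P s t u : ℝ) (O : Set RepClass) : Prop :=
  ∃ p q₁ q₂ q₃ : RepClass, O = {p, q₁, q₂, q₃} ∧ HasTraces α p (s * (P - 2)) t u ∧
    HasTraces α q₁ s (t * (P - 2)) u ∧ HasTraces α q₂ s t (u * (P - 2)) ∧ HasTraces α q₃ s t u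

namespace BaseAngles

variable {α : Fin 4 → ℝ} {P q : ℝ} (S : BaseAngles α P q)
include S

lemma step_B {p : RepClass} {x y z : ℝ} (h : HasTraces α p x y z) :
    HasTraces α (FourPuncturedSphere.twistB • p) x (P - x * z - y) (P - x * (P - x * z - y) - z) :=
        by
  have := h.twistB
  rwa [S.coeffB, S.coeffC] at this

lemma step_D {p : RepClass} {x y z : ℝ} (h : HasTraces α p x y z) :
    HasTraces α (FourPuncturedSphere.twistD • p) (P - y * (P - x * y - z) - x) y (P - x * y - z) :=
        by
  have := h.twistD
  rwa [S.coeffA, S.coeffC] at this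

/-- At `P = 3` the four points of the orbit would merge into `(1, 1, 1)`. -/
lemma P_ne_three : P ≠ 3 := by
  intro h
  have hP := S.hP
  have : (q - 1) * (q + 1) = 0 := by linarith
  rcases mul_eq_zero.1 this with h | h
  · exact S.q_ne (by linarith)
  · linarith [S.q_pos]

/-- The orbit of the central point. -/
lemma hasFourPoints {p : RepClass} (hp : HasTraces α p 1 1 1)
    (hfin : (MulAction.orbit PMod p).Finite) (hcard : (MulAction.orbit PMod p).ncard ≤ 4) :
    HasFourPoints α P 1 1 1 (MulAction.orbit PMod p) ∧ (MulAction.orbit PMod p).ncard = 4 := by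
  set O := MulAction.orbit PMod p with hO
  have mB : ∀ r ∈ O, twistB • r ∈ O := fun r hr =>
    MulAction.mem_orbit_of_mem_orbit (⟨twistB, twistB_mem⟩ : PMod) hr
  have mD : ∀ r ∈ O, twistD • r ∈ O := fun r hr =>
    MulAction.mem_orbit_of_mem_orbit (⟨twistD, twistD_mem⟩ : PMod) hr
  have m0 : p ∈ O := MulAction.mem_orbit_self p
  -- From `(1, 1, 1)`, one and two twists along `c₁c₂` give `(1, P - 2, 1)` and `(1, 1, P - 2)`; two
  -- twists along `c₂c₃` give `(P - 2, 1, 1)`.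
  have m1 := mB _ m0
  have m2 := mB _ m1
  have m3 := mD _ (mD _ m0)
  have h1 := S.step_B hp
  have h2 := S.step_B h1
  have h3 := S.step_D (S.step_D hp)
  generalize twistB • twistB • p = p2 at *
  generalize twistB • p = p1 at *
  generalize twistD • twistD • p = p3 at *
  have h1 : HasTraces α p1 1 (P - 2) 1 := by convert h1 using 1 <;> ring
  have h2 : HasTraces α p2 1 1 (P - 2) := by convert h2 using 1 <;> ring
  have h3 : HasTraces α p3 (P - 2) 1 1 := by convert h3 using 1 <;> ring
  have hne : P - 2 ≠ 1 := fun h => S.P_ne_three (by linarith)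
  have u := fun {p x y z x' y' z'} (h : HasTraces α p x y z) (h' : HasTraces α p x' y' z') =>
    h.unique S.adm.mem_Ioo h'
  have hsub : ({p3, p1, p2, p} : Set RepClass) ⊆ O := by
    rintro r (rfl | rfl | rfl | rfl) <;> assumption
  have hc : ({p3, p1, p2, p} : Set RepClass).ncard = 4 := by
    rw [Set.ncard_insert_of_notMem, Set.ncard_insert_of_notMem, Set.ncard_pair]
    · rintro rfl; exact hne (u h2 hp).2.2
    · rintro (rfl | rfl)
      · exact hne (u h1 h2).2.1
      · exact hne (u h1 hp).2.1
    · rintro (rfl | rfl | rfl)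
      · exact hne (u h3 h1).1
      · exact hne (u h3 h2).1
      · exact hne (u h3 hp).1
  have e : ({p3, p1, p2, p} : Set RepClass) = O := Set.eq_of_subset_of_ncard_le hsub (by omega) hfin
  refine ⟨⟨p3, p1, p2, p, e.symm, ?_, ?_, ?_, ?_⟩, by rw [← e, hc]⟩ <;> simpa

/-- The orbit of the central point is the only orbit of length four. -/
lemma eq_orbit {p : RepClass} (hp : HasFourPoints α P 1 1 1 (MulAction.orbit PMod p))
    {O : Set RepClass} (hO : IsLengthFourOrbit α O) : O = MulAction.orbit PMod p := by
  obtain ⟨r, hr, h⟩ := S.exists_leaf hO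
  obtain ⟨p0, p1, p2, p3, he, h0, h1, -, -⟩ := hp
  simp only [one_mul] at h0 h1
  obtain ⟨x, rfl⟩ := hO.1
  rw [← MulAction.orbit_eq_iff.2 hr]
  refine MulAction.orbit_eq_iff.2 ?_
  rw [he]
  rcases h with h | h
  · simp [h.eq S.adm.mem_Ioo h0]
  · simp [h.eq S.adm.mem_Ioo h1]

end BaseAngles

/-! ### Rotation triangle groups -/

lemma IsRotationTriangleGroup.map_conj {G : Subgroup PSL2R} {p q r : ℝ}
    (h : IsRotationTriangleGroup G p q r) (k : PSL2R) :
    IsRotationTriangleGroup (G.map (MulAut.conj k).toMonoidHom) p q r := by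
  obtain ⟨g, rfl⟩ := proj_surjective k
  obtain ⟨P, Q, R, a, b, c, h1, h2, h3, a1, a2, a3, r1, r2, r3, rfl⟩ := h
  rw [isRotation_iff] at r1 r2 r3
  have key : ∀ (x : PSL2R) (w : ℍ) (t : ℝ), x = proj (rotAt w t) →
      IsRotation (MulAut.conj (proj g) x) (g • w) t := by
    rintro x w t rfl
    rw [isRotation_iff, ← conj_rotAt, map_mul, map_mul, map_inv]; rfl
  refine ⟨g • P, g • Q, g • R, _, _, _, fun h => h1 (smul_left_cancel g h),
    fun h => h2 (smul_left_cancel g h), fun h => h3 (smul_left_cancel g h), ?_, ?_, ?_,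
    key _ _ _ r1, key _ _ _ r2, key _ _ _ r3, ?_⟩
  · rwa [interiorAngle, orientedAngle_smul]
  · rwa [interiorAngle, orientedAngle_smul]
  · rwa [interiorAngle, orientedAngle_smul]
  · rw [MonoidHom.map_closure, Set.image_insert_eq, Set.image_pair]; rfl

/-- Precomposition with an automorphism does not change the image, so along an orbit the image
varies only by conjugation. -/
lemma isRotationTriangleGroup_of_smul {ρ σ : SphereRep} {φ : MulAut SphereGroup}
    (h : σ.cls = φ • ρ.cls) {p q r : ℝ} (hρ : IsRotationTriangleGroup ρ.range p q r) :
    IsRotationTriangleGroup σ.range p q r := by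
  rw [smul_cls] at h
  obtain ⟨k, hk⟩ := Quotient.exact h.symm
  have e : σ = (MulAut.conj k).toMonoidHom.comp (ρ.comp (φ⁻¹ : MulAut SphereGroup).toMonoidHom) :=
    MonoidHom.ext hk
  have e2 : (ρ.comp (φ⁻¹ : MulAut SphereGroup).toMonoidHom).range = ρ.range := by
    rw [MonoidHom.range_comp, MonoidHom.range_eq_top.2 (φ⁻¹ : MulAut SphereGroup).surjective,
      ← MonoidHom.range_eq_map]
  rw [e, MonoidHom.range_comp, e2]
  exact hρ.map_conj k

lemma rotAt_add (w : ℍ) (s t : ℝ) : rotAt w s * rotAt w t = rotAt w (s + t) := by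
  have h : rot s * rot t = rot (s + t) := by
    obtain ⟨r1, r2, r3, r4⟩ := rot_apply s
    obtain ⟨s1, s2, s3, s4⟩ := rot_apply t
    obtain ⟨t1, t2, t3, t4⟩ := rot_apply (s + t)
    apply sl2_ext <;> simp only [sl2_mul, r1, r2, r3, r4, s1, s2, s3, s4, t1, t2, t3, t4, add_div,
      sin_add, cos_add] <;> ring
  rw [rotAt, rotAt, rotAt, conj_mul_conj, h]

lemma rotAt_add_two_pi (w : ℍ) (t : ℝ) : rotAt w (t + 2 * π) = -rotAt w t := by
  obtain ⟨r1, r2, r3, r4⟩ := rotAt_apply w t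
  obtain ⟨s1, s2, s3, s4⟩ := rotAt_apply w (t + 2 * π)
  have h : (t + 2 * π) / 2 = t / 2 + π := by ring
  simp only [h, sin_add_pi, cos_add_pi] at s1 s2 s3 s4
  apply sl2_ext <;> simp only [sl2_neg, r1, r2, r3, r4, s1, s2, s3, s4] <;> ring

/-- The triangle with angles `π / 2`, `π / 3` and `π - θ / 2`. -/
lemma exists_triangle {θ : ℝ} (hθ : 5 * π / 3 < θ) (hθ' : θ < 2 * π) :
    ∃ Q R : ℍ, Q ≠ I ∧ rot π * rotAt Q (2 * π / 3) = rotAt R θ := by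
  have hc : cos (θ / 2) < -(√3 / 2) := by
    have : cos (5 * π / 6) = -(√3 / 2) := by
      rw [show 5 * π / 6 = π - π / 6 by ring, cos_pi_sub, cos_pi_div_six]
    rw [← this]
    exact cos_lt_cos_of_nonneg_of_le_pi (by linarith [pi_pos]) (by linarith) (by linarith)
  have h3 : (0 : ℝ) < √3 := by positivity
  have h33 : √3 * √3 = 3 := mul_self_sqrt (by norm_num)
  -- With `Q = iY`, the product must have trace `-(√3 / 2) (Y + 1/Y) = 2 cos (θ / 2)`, that is `Y +
  -- 1/Y = K`. The condition `θ > 5π/3` is what makes `K > 2`.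
  set K := -(4 * cos (θ / 2)) / √3 with hK
  have hK2 : 2 < K := by rw [hK, lt_div_iff₀ h3]; linarith
  set D := √(K ^ 2 - 4) with hD
  have hD2 : D * D = K ^ 2 - 4 := mul_self_sqrt (by nlinarith)
  have hD0 : 0 ≤ D := sqrt_nonneg _
  have hY : 0 < (K + D) / 2 := by linarith
  set Y := (K + D) / 2 with hYd
  have hYK : Y * Y - K * Y + 1 = 0 := by rw [hYd]; linear_combination hD2 / 4
  let Q : ℍ := ⟨⟨0, Y⟩, hY⟩
  have hQ : Q ≠ I := by
    intro h
    have h1 := congrArg UpperHalfPlane.im h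
    have h2 : Y = 1 := h1.trans I_im
    linarith
  obtain ⟨r1, r2, r3, r4⟩ := rotAt_apply Q (2 * π / 3)
  obtain ⟨s1, s2, s3, s4⟩ := rot_apply π
  have e1 : (2 * π / 3) / 2 = π / 3 := by ring
  have qr : Q.re = 0 := rfl
  have qi : Q.im = Y := rfl
  simp only [e1, cos_pi_div_three, sin_pi_div_three, qr, qi] at r1 r2 r3 r4
  simp only [cos_pi_div_two, sin_pi_div_two] at s1 s2 s3 s4
  obtain ⟨R, hR⟩ := exists_rotAt (g := rot π * rotAt Q (2 * π / 3)) (β := θ)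
    ⟨by linarith [pi_pos], hθ'⟩ (by
      simp only [tr2, sl2_mul, r1, r2, r3, r4, s1, s2, s3, s4]
      have hKY : K * √3 = -(4 * cos (θ / 2)) := by rw [hK]; field_simp
      field_simp
      linear_combination (-√3) * hYK - Y * hKY) (by
      simp only [sl2_mul, r1, r3, s3, s4]; norm_num)
  exact ⟨Q, R, hQ, hR⟩

/-- The rotation of angle `2π - θ` about `R` closes the product up to `-1`, so
`orientedAngle_of_product` and its cyclic permutations give the three interior angles. The third
generator is redundant. -/
lemma isRotationTriangleGroup_closure {θ : ℝ} (hθ : 5 * π / 3 < θ) (hθ' : θ < 2 * π) {Q R : ℍ}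
    (hQ : Q ≠ I) (h : rot π * rotAt Q (2 * π / 3) = rotAt R θ) :
    IsRotationTriangleGroup (Subgroup.closure {proj (rot π), proj (rotAt Q (2 * π / 3))}) 2 3
      (1 - θ / (2 * π))⁻¹ := by
  have hpi := pi_pos
  have ea : 2 * π / 2 = 2 * (π / 2) := by ring
  have eb : 2 * π / 3 = 2 * (π / 3) := by ring
  have ec : π / (1 - θ / (2 * π))⁻¹ = π - θ / 2 := by field_simp
  have ec' : 2 * π / (1 - θ / (2 * π))⁻¹ = 2 * (π - θ / 2) := by rw [mul_div_assoc, ec]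
  have hc : rotAt R (2 * (π - θ / 2)) = -(rotAt R θ)⁻¹ := by
    have : rotAt R θ * rotAt R (2 * (π - θ / 2)) = -1 := by
      rw [rotAt_add, show θ + 2 * (π - θ / 2) = 0 + 2 * π by ring, rotAt_add_two_pi, rotAt_zero]
    rw [eq_comm, neg_eq_iff_eq_neg, inv_eq_iff_mul_eq_one, mul_neg, this, neg_neg]
  have p1 : rotAt I (2 * (π / 2)) * rotAt Q (2 * (π / 3)) * rotAt R (2 * (π - θ / 2)) = -1 := by
    rw [← eb, rotAt_I, ← ea, hc, mul_div_cancel_left₀ _ two_ne_zero, h]; simp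
  have rotate : ∀ {x y z : SL2R}, x * y * z = -1 → y * z * x = -1 := by
    intro x y z h
    have : y * z * x = x⁻¹ * (x * y * z) * x := by group
    rw [this, h]; simp
  have i1 : π / 2 ∈ Set.Ioo 0 π := ⟨by linarith, by linarith⟩
  have i2 : π / 3 ∈ Set.Ioo 0 π := ⟨by linarith, by linarith⟩
  have i3 : π - θ / 2 ∈ Set.Ioo 0 π := ⟨by linarith, by linarith⟩
  have third : ∀ {X Y Z : ℍ} {a : ℝ}, a ∈ Set.Ioo 0 π → orientedAngle X Y Z = a → Z ≠ X := by
    rintro X Y Z a ha h rfl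
    simp [orientedAngle, discCoord] at h
    exact ha.1.ne h
  have o1 := orientedAngle_of_product i1 i2 i3 hQ.symm p1
  have n1 := third i1 o1
  have o3 := orientedAngle_of_product i3 i1 i2 n1 (rotate (rotate p1))
  have n3 := third i3 o3
  have o2 := orientedAngle_of_product i2 i3 i1 n3 (rotate p1)
  refine ⟨I, Q, R, proj (rot π), proj (rotAt Q (2 * π / 3)), proj (rotAt R (2 * (π - θ / 2))),
    hQ.symm, n3, n1, ?_, ?_, ?_, ?_, ?_, ?_, ?_⟩
  · rw [interiorAngle, o1, abs_of_pos i1.1]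
  · rw [interiorAngle, o2, abs_of_pos i2.1]
  · rw [interiorAngle, o3, abs_of_pos i3.1, ec]
  · rw [isRotation_iff, rotAt_I, mul_div_cancel_left₀ _ two_ne_zero]
  · rw [isRotation_iff]
  · rw [isRotation_iff, ec']
  · refine le_antisymm (Subgroup.closure_mono ?_) ((Subgroup.closure_le _).2 ?_)
    · rintro x (rfl | rfl) <;> simp
    · have ma : proj (rot π) ∈ Subgroup.closure {proj (rot π), proj (rotAt Q (2 * π / 3))} :=
        Subgroup.subset_closure (by simp)
      have mb : proj (rotAt Q (2 * π / 3)) ∈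
          Subgroup.closure {proj (rot π), proj (rotAt Q (2 * π / 3))} :=
        Subgroup.subset_closure (by simp)
      rintro x (rfl | rfl | rfl)
      · exact ma
      · exact mb
      · rw [hc, proj_neg, map_inv, ← h, map_mul]
        exact inv_mem (mul_mem ma mb)

/-! ### The two base representations -/

/-- There is exactly one orbit of length four, its points have the given trace coordinates, and it
consists of rotation triangle groups. -/
structure HasUniqueOrbit (α : Fin 4 → ℝ) (P s t u r : ℝ) : Prop where
  unique : ∃! O : Set RepClass, IsLengthFourOrbit α O
  points : ∀ O, IsLengthFourOrbit α O → HasFourPoints α P s t u O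
  image : ∀ O, IsLengthFourOrbit α O → ∀ ρ : SphereRep, ρ.cls ∈ O →
    IsRotationTriangleGroup ρ.range 2 3 r

lemma BaseAngles.hasUniqueOrbit {α : Fin 4 → ℝ} {P q r : ℝ} (S : BaseAngles α P q)
    {T : Fin 4 → Fin 3 → SL2Z} {c : SL2Z}
    (hT : ∀ {M g : Fin 3 → SL2Z}, (∀ i, M i = g i * parab 1 0 * (g i)⁻¹) → ∀ {h : SL2Z},
      M 0 * M 1 * M 2 * (h * c * h⁻¹) = 1 → ∃ (k : SL2Z) (j : Fin 4), ∀ i, M i = k * T j i * k⁻¹)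
    {F : SL2Z →* SL2R} {ψ : SphereGroup →* SL2Z}
    (hψ : ∀ i : Fin 3, IsConj (parab 1 0) (ψ (peripheral i.castSucc)))
    (hψ' : IsConj c (ψ (peripheral 3))) (hs : Function.Surjective ψ)
    (hp : HasTraces α (SphereRep.cls ((proj.comp F).comp ψ)) 1 1 1)
    (hF : IsRotationTriangleGroup (Subgroup.closure {proj (F genS), proj (F genU)}) 2 3 r) :
    HasUniqueOrbit α P 1 1 1 r := by
  obtain ⟨h1, h2⟩ := ncard_orbit_le hT F hψ hψ'
  obtain ⟨h3, h4⟩ := S.hasFourPoints hp h1 h2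
  have h5 : IsLengthFourOrbit α
      (MulAction.orbit PMod (SphereRep.cls ((proj.comp F).comp ψ))) := by
    refine ⟨⟨_, rfl⟩, ?_, h4⟩
    rintro _ ⟨φ, rfl⟩
    obtain ⟨x, y, z, h⟩ := hp.smul φ.2
    exact h.mem_DT S.adm
  have h6 := fun O hO => S.eq_orbit h3 (O := O) hO
  refine ⟨⟨_, h5, fun O hO => h6 O hO⟩, fun O hO => by rw [h6 O hO]; exact h3, ?_⟩
  intro O hO ρ hρ
  rw [h6 O hO] at hρ
  obtain ⟨φ, hφ⟩ := hρ
  refine isRotationTriangleGroup_of_smul (φ := φ) hφ.symm ?_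
  have : ((proj.comp F).comp ψ).range = Subgroup.closure {proj (F genS), proj (F genU)} := by
    rw [MonoidHom.range_comp, MonoidHom.range_eq_top.2 hs, ← closure_genS_genU,
      MonoidHom.map_closure, Set.image_pair]
    rfl
  rwa [this]

lemma surjective_of_mem {ψ : SphereGroup →* SL2Z} (h : genS * genU ∈ ψ.range)
    (h' : genU * genS ∈ ψ.range) : Function.Surjective ψ := by
  rw [← MonoidHom.range_eq_top, eq_top_iff, ← closure_genS_genU, Subgroup.closure_le]
  have e1 : genS = genS * genU * (genU * genS) * (genS * genU) :=
    slz_ext (by decide) (by decide) (by decide) (by decide)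
  have hS : genS ∈ ψ.range := by
    rw [e1]; exact mul_mem (mul_mem h h') h
  rintro x (rfl | rfl)
  · exact hS
  · have e2 : genU = genS⁻¹ * (genS * genU) := by group
    rw [SetLike.mem_coe, e2]; exact mul_mem (inv_mem hS) h

lemma genU_inv_conj : genU⁻¹ * parab 1 0 * genU = genU⁻¹ * genS * genU * genU := by
  rw [← genS_mul_genU, ← mul_assoc]

lemma genS_inv_conj : genS⁻¹ * parab 1 0 * genS = genU * genS := by
  rw [← genS_mul_genU]; group

/-! ### Words in two matrices with `J² = b³ = -1` -/

section Relations

variable {J b : SL2R} (hJ : J * J = -1) (hb : b * b * b = -1)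
include hJ hb

lemma word_rules : b⁻¹ = -(b * b) ∧ (∀ x, J * (J * x) = -x) ∧
    (∀ x, b * (b * (b * x)) = -x) ∧ b * (b * b) = -1 := by
  refine ⟨?_, fun x => ?_, fun x => ?_, ?_⟩
  · rw [inv_eq_iff_mul_eq_one, mul_neg, ← mul_assoc, hb, neg_neg]
  · rw [← mul_assoc, hJ, neg_one_mul]
  · rw [← mul_assoc, ← mul_assoc, hb, neg_one_mul]
  · rw [← mul_assoc, hb]

lemma tr2_word (htr : tr2 b = 1) : tr2 (b * b) = -1 ∧ tr2 (J * (b * (b * J))) = 1 := by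
  obtain ⟨i2, i3, i4, i5⟩ := word_rules hJ hb
  have h1 : tr2 (b * b) = -1 := by
    have : b * b = -b⁻¹ := by rw [i2, neg_neg]
    rw [this, tr2_neg, tr2_inv, htr]
  refine ⟨h1, ?_⟩
  rw [tr2_mul_comm, mul_assoc, mul_assoc, hJ, mul_neg_one, mul_neg, tr2_neg, h1, neg_neg]

end Relations

lemma hasUniqueOrbit_of_triangle {α : Fin 4 → ℝ} {P q θ : ℝ} (S : BaseAngles α P q)
    (hθ : 5 * π / 3 < θ) (hθ' : θ < 2 * π)
    {T : Fin 4 → Fin 3 → SL2Z} {c : SL2Z}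
    (hT : ∀ {M g : Fin 3 → SL2Z}, (∀ i, M i = g i * parab 1 0 * (g i)⁻¹) → ∀ {h : SL2Z},
      M 0 * M 1 * M 2 * (h * c * h⁻¹) = 1 → ∃ (k : SL2Z) (j : Fin 4), ∀ i, M i = k * T j i * k⁻¹)
    {g : Fin 3 → SL2Z} (hg : ∀ i, IsConj (parab 1 0) (g i)) (hg' : IsConj c (g 0 * g 1 * g 2)⁻¹)
    (h0 : g 0 = genS * genU) (h1 : ∃ i, g i = genU * genS)
    (hp : ∀ {J b : SL2R} {R : ℍ} {F : SL2Z →* SL2R}, J = rotAt I π → J * J = -1 → b * b * b = -1 →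
      tr2 b = 1 → J * b = rotAt R θ → F genS = J → F genU = b →
      HasTraces α (SphereRep.cls ((proj.comp F).comp (FreeGroup.lift g))) 1 1 1) :
    HasUniqueOrbit α P 1 1 1 (1 - θ / (2 * π))⁻¹ := by
  obtain ⟨Q, R, hQ, hR⟩ := exists_triangle hθ hθ'
  have hJ : rot π * rot π = -1 := by
    rw [← rotAt_I, rotAt_add, show π + π = 0 + 2 * π by ring, rotAt_add_two_pi, rotAt_zero]
  have hb : rotAt Q (2 * π / 3) * rotAt Q (2 * π / 3) * rotAt Q (2 * π / 3) = -1 := by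
    rw [rotAt_add, rotAt_add, show 2 * π / 3 + 2 * π / 3 + 2 * π / 3 = 0 + 2 * π by ring,
      rotAt_add_two_pi, rotAt_zero]
  obtain ⟨F, hF1, hF2⟩ := exists_hom_of_relations (s := rot π) (u := rotAt Q (2 * π / 3))
    (by rw [hJ, hb]) (fun g => by rw [hJ]; simp) (by rw [hJ]; simp)
  have hl : ∀ i : Fin 3, FreeGroup.lift g (peripheral i.castSucc) = g i := fun i => by
    fin_cases i <;> exact FreeGroup.lift_apply_of
  refine S.hasUniqueOrbit hT (F := F) (ψ := FreeGroup.lift g) (fun i => ?_) ?_ ?_ ?_ ?_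
  · rw [hl]; exact hg i
  · have : FreeGroup.lift g (peripheral 3) = (g 0 * g 1 * g 2)⁻¹ := by
      rw [← hl 0, ← hl 1, ← hl 2, ← map_mul, ← map_mul, ← map_inv]; rfl
    rwa [this]
  · refine surjective_of_mem ⟨_, (hl 0).trans h0⟩ ?_
    obtain ⟨i, hi⟩ := h1
    exact ⟨_, (hl i).trans hi⟩
  · refine hp (rotAt_I π).symm hJ hb ?_ hR hF1 hF2
    rw [tr2_rotAt, show 2 * π / 3 / 2 = π / 3 by ring, cos_pi_div_three]; norm_num
  · rw [hF1, hF2]; exact isRotationTriangleGroup_closure hθ hθ' hQ hR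

lemma hasTraces_of_words {α : Fin 4 → ℝ} {C : Fin 4 → ℍ} {F : SL2Z →* SL2R} {g : Fin 3 → SL2Z}
    (h0 : F (g 0) = rotAt (C 0) (α 0)) (h1 : F (g 1) = rotAt (C 1) (α 1))
    (h2 : F (g 2) = rotAt (C 2) (α 2))
    (h3 : F (g 0) * F (g 1) * F (g 2) * rotAt (C 3) (α 3) = -1)
    (hx : tr2 (F (g 0) * F (g 1)) = 1) (hy : tr2 (F (g 1) * F (g 2)) = 1)
    (hz : tr2 (F (g 0) * F (g 2)) = 1) :
    HasTraces α (SphereRep.cls ((proj.comp F).comp (FreeGroup.lift g))) 1 1 1 := by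
  have hC : liftProd α C = -1 := by rw [liftProd, ← h0, ← h1, ← h2, h3]
  refine ⟨_, C, rfl, ⟨fun i => ?_, hC⟩, by rw [← h0, ← h1, hx], by rw [← h1, ← h2, hy],
    by rw [← h0, ← h2, hz]⟩
  have e : F.comp (FreeGroup.lift g) = liftHom α C := by
    refine FreeGroup.ext_hom _ _ fun i => ?_
    rw [liftHom, FreeGroup.lift_apply_of, MonoidHom.comp_apply, FreeGroup.lift_apply_of]
    fin_cases i <;> assumption
  have e' : ∀ x, ((proj.comp F).comp (FreeGroup.lift g)) x = proj (liftHom α C x) := fun x => by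
    rw [← e]; rfl
  rw [e']
  fin_cases i
  · exact congrArg proj (liftHom_zero α C)
  · exact congrArg proj (liftHom_one α C)
  · exact congrArg proj (liftHom_two α C)
  · exact (congrArg proj (liftHom_three hC)).trans (proj_neg _)

/-- The three conjugates of `genS * genU` are chosen with product `genS`, so that `c₄` becomes the
half-turn, and with all pairwise products of trace 1. -/
lemma hasUniqueOrbit_pi {θ q P : ℝ} (hθ : 5 * π / 3 < θ) (hθ' : θ < 2 * π)
    (S : BaseAngles ![θ, θ, θ, π] P q) :
    HasUniqueOrbit ![θ, θ, θ, π] P 1 1 1 (1 - θ / (2 * π))⁻¹ := by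
  refine hasUniqueOrbit_of_triangle S hθ hθ' (T := triplesTwo) (c := -genS)
    (g := ![genS * genU, genU⁻¹ * genS * genU * genU, genU * genS])
    (fun hM _ hN => classify_triplesTwo hM hN) (fun i => ?_) ?_ rfl ⟨2, rfl⟩ ?_
  · fin_cases i
    · exact isConj_iff.2 ⟨1, by rw [inv_one, mul_one, one_mul]; exact genS_mul_genU.symm⟩
    · exact isConj_iff.2 ⟨genU⁻¹, by rw [inv_inv]; exact genU_inv_conj⟩
    · exact isConj_iff.2 ⟨genS⁻¹, by rw [inv_inv]; exact genS_inv_conj⟩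
  · have : (-genS) = (genS * genU * (genU⁻¹ * genS * genU * genU) * (genU * genS))⁻¹ :=
      slz_ext (by decide) (by decide) (by decide) (by decide)
    exact this ▸ IsConj.refl _
  · intro J b R F hI hJ hb htr hR hS hU
    obtain ⟨i2, i3, i4, i5⟩ := word_rules hJ hb
    obtain ⟨t1, t2⟩ := tr2_word hJ hb htr
    refine hasTraces_of_words (C := ![R, b⁻¹ • R, J⁻¹ • R, I]) ?_ ?_ ?_ ?_ ?_ ?_ ?_
    · change F (genS * genU) = rotAt R θ
      rw [map_mul, hS, hU, hR]
    · change F (genU⁻¹ * genS * genU * genU) = rotAt (b⁻¹ • R) θ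
      rw [← conj_rotAt, ← hR, map_mul, map_mul, map_mul, map_inv, hS, hU, inv_inv]
      simp only [mul_assoc]
    · change F (genU * genS) = rotAt (J⁻¹ • R) θ
      rw [← conj_rotAt, ← hR, map_mul, hS, hU]; group
    · change F (genS * genU) * F (genU⁻¹ * genS * genU * genU) * F (genU * genS) * rotAt I π = -1
      simp only [map_mul, map_inv, hS, hU, ← hI, i2, i3, i4, hJ, mul_assoc, mul_neg, neg_mul,
        neg_neg]
    · change tr2 (F (genS * genU) * F (genU⁻¹ * genS * genU * genU)) = 1
      simp only [map_mul, map_inv, hS, hU, i2, i3, i4, mul_assoc, mul_neg, neg_mul,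
        neg_neg, tr2_neg, t1]
    · change tr2 (F (genU⁻¹ * genS * genU * genU) * F (genU * genS)) = 1
      simp only [map_mul, map_inv, hS, hU, i2, i4, hJ, mul_assoc, mul_neg, neg_mul,
        neg_neg, mul_one, tr2_neg, t1]
    · change tr2 (F (genS * genU) * F (genU * genS)) = 1
      simp only [map_mul, hS, hU, mul_assoc, t2]

/-- The same three conjugates in another order; the inverse of the product is now minus the cube of
a conjugate of `genS * genU`. -/
lemma hasUniqueOrbit_three {θ q P : ℝ} (hθ : 5 * π / 3 < θ) (hθ' : θ < 2 * π)
    (S : BaseAngles ![θ, θ, θ, 3 * θ - 4 * π] P q) :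
    HasUniqueOrbit ![θ, θ, θ, 3 * θ - 4 * π] P 1 1 1 (1 - θ / (2 * π))⁻¹ := by
  refine hasUniqueOrbit_of_triangle S hθ hθ' (T := triplesThree) (c := -(parab 1 0) ^ 3)
    (g := ![genS * genU, genU * genS, genU⁻¹ * genS * genU * genU])
    (fun hM _ hN => classify_triplesThree hM hN) (fun i => ?_) ?_ rfl ⟨1, rfl⟩ ?_
  · fin_cases i
    · exact isConj_iff.2 ⟨1, by rw [inv_one, mul_one, one_mul]; exact genS_mul_genU.symm⟩
    · exact isConj_iff.2 ⟨genS⁻¹, by rw [inv_inv]; exact genS_inv_conj⟩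
    · exact isConj_iff.2 ⟨genU⁻¹, by rw [inv_inv]; exact genU_inv_conj⟩
  · have : genS⁻¹ * -(parab 1 0) ^ 3 * genS⁻¹⁻¹ =
        (genS * genU * (genU * genS) * (genU⁻¹ * genS * genU * genU))⁻¹ :=
      slz_ext (by decide) (by decide) (by decide) (by decide)
    exact isConj_iff.2 ⟨genS⁻¹, this⟩
  · intro J b R F hI hJ hb htr hR hS hU
    obtain ⟨i2, i3, i4, i5⟩ := word_rules hJ hb
    obtain ⟨t1, t2⟩ := tr2_word hJ hb htr
    -- The `4π` is two full turns, each of sign `-1` in `SL(2, ℝ)`, so the cube appears without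
    -- sign.
    have e3 : rotAt (J⁻¹ • R) (3 * θ - 4 * π) = b * J * (b * J) * (b * J) := by
      have e2 : b * J = rotAt (J⁻¹ • R) θ := by rw [← conj_rotAt, ← hR]; group
      rw [e2, rotAt_add, rotAt_add, show θ + θ + θ = 3 * θ - 4 * π + 2 * π + 2 * π by ring,
        rotAt_add_two_pi, rotAt_add_two_pi, neg_neg]
    refine hasTraces_of_words (C := ![R, J⁻¹ • R, b⁻¹ • R, J⁻¹ • R]) ?_ ?_ ?_ ?_ ?_ ?_ ?_
    · change F (genS * genU) = rotAt R θ
      rw [map_mul, hS, hU, hR]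
    · change F (genU * genS) = rotAt (J⁻¹ • R) θ
      rw [← conj_rotAt, ← hR, map_mul, hS, hU]; group
    · change F (genU⁻¹ * genS * genU * genU) = rotAt (b⁻¹ • R) θ
      rw [← conj_rotAt, ← hR, map_mul, map_mul, map_mul, map_inv, hS, hU, inv_inv]
      simp only [mul_assoc]
    · change F (genS * genU) * F (genU * genS) * F (genU⁻¹ * genS * genU * genU) *
        rotAt (J⁻¹ • R) (3 * θ - 4 * π) = -1
      rw [e3]
      simp only [map_mul, map_inv, hS, hU, i2, i3, i4, hJ, mul_assoc, mul_neg, neg_mul,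
        neg_neg]
    · change tr2 (F (genS * genU) * F (genU * genS)) = 1
      simp only [map_mul, hS, hU, mul_assoc, t2]
    · change tr2 (F (genU * genS) * F (genU⁻¹ * genS * genU * genU)) = 1
      rw [map_mul, mul_assoc, hU, tr2_mul_comm]
      simp only [map_mul, map_inv, hS, hU, i2, i5, mul_assoc, mul_neg, neg_mul,
        neg_neg, mul_one, t2]
    · change tr2 (F (genS * genU) * F (genU⁻¹ * genS * genU * genU)) = 1
      simp only [map_mul, map_inv, hS, hU, i2, i3, i4, mul_assoc, mul_neg, neg_mul,
        neg_neg, tr2_neg, t1]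

/-! ### Cyclic permutation of the punctures -/

lemma cycle_smul_orbit (x : RepClass) :
    cycle • MulAction.orbit PMod x = MulAction.orbit PMod (cycle • x) := by
  ext r
  rw [Set.mem_smul_set]
  constructor
  · rintro ⟨_, ⟨φ, rfl⟩, rfl⟩
    refine ⟨⟨cycle * φ * cycle⁻¹, cycle_conj_mem φ.2⟩, ?_⟩
    change (cycle * φ * cycle⁻¹ : MulAut SphereGroup) • cycle • x = cycle • (φ : MulAut
        SphereGroup) • x
    rw [smul_smul, smul_smul, inv_mul_cancel_right]
  · rintro ⟨φ, rfl⟩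
    have h3 : cycle⁻¹ = cycle * cycle * cycle := by
      rw [inv_eq_iff_mul_eq_one, ← cycle_pow_four]; rfl
    have hm : cycle⁻¹ * φ * cycle ∈ PMod := by
      have := cycle_conj_mem (cycle_conj_mem (cycle_conj_mem φ.2))
      have e : cycle⁻¹ * (φ : MulAut SphereGroup) * cycle =
          cycle * (cycle * (cycle * φ * cycle⁻¹) * cycle⁻¹) * cycle⁻¹ := by
        have : cycle * (cycle * (cycle * (φ : MulAut SphereGroup) * cycle⁻¹) * cycle⁻¹) * cycle⁻¹ =
            (cycle * cycle * cycle) * φ * (cycle * cycle * cycle)⁻¹ := by group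
        rw [this, ← h3, inv_inv]
      rwa [e]
    refine ⟨_, ⟨⟨_, hm⟩, rfl⟩, ?_⟩
    change cycle • (cycle⁻¹ * φ * cycle : MulAut SphereGroup) • x = (φ : MulAut
        SphereGroup) • cycle • x
    rw [smul_smul, smul_smul]
    congr 1; group

lemma IsLengthFourOrbit.cycle {α : Fin 4 → ℝ} (hα : Admissible α) {O : Set RepClass}
    (h : IsLengthFourOrbit α O) : IsLengthFourOrbit (fun i => α (i + 1)) (cycle • O) := by
  obtain ⟨⟨x, rfl⟩, h2, h3⟩ := h
  refine ⟨⟨_, cycle_smul_orbit x⟩, ?_, ?_⟩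
  · rintro _ ⟨p, hp, rfl⟩
    obtain ⟨x, y, z, h⟩ := exists_hasTraces_of_DT (h2 hp)
    exact h.cycle.mem_DT hα.rotate
  · rw [← h3]; exact Set.ncard_image_of_injective _ (MulAction.injective _)

/-- Uniqueness returns to the original ordering because `cycle` has fourth power 1. The signs keep
the form `(s, t, st)`. -/
lemma HasUniqueOrbit.cycle {α : Fin 4 → ℝ} {P s t r : ℝ} (hα : Admissible α)
    (hP : coeff α 0 2 1 3 = s * t * P) (h : HasUniqueOrbit α P s t (s * t) r) :
    HasUniqueOrbit (fun i => α (i + 1)) P t (-s) (t * -s) r := by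
  obtain ⟨O, hO, huniq⟩ := h.unique
  have back : ∀ O', IsLengthFourOrbit (fun i => α (i + 1)) O' →
      O' = FourPuncturedSphere.cycle • O := by
    intro O' hO'
    have h3 := ((hO'.cycle hα.rotate).cycle hα.rotate.rotate).cycle hα.rotate.rotate.rotate
    have e : (fun i : Fin 4 => α (i + 1 + 1 + 1 + 1)) = α := by
      funext i; fin_cases i <;> rfl
    rw [e] at h3
    rw [← huniq _ h3, smul_smul, smul_smul, smul_smul]
    have : FourPuncturedSphere.cycle * FourPuncturedSphere.cycle * FourPuncturedSphere.cycle *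
        FourPuncturedSphere.cycle = 1 := cycle_pow_four
    rw [this, one_smul]
  refine ⟨⟨_, hO.cycle hα, back⟩, ?_, ?_⟩
  · intro O' hO'
    rw [back O' hO']
    obtain ⟨p, q1, q2, q3, rfl, h0, h1, h2, h3⟩ := h.points O hO
    -- The permutation exchanges the points exceptional in `x` and `y`, and the central point with
    -- the one exceptional in `z`.
    have hset : FourPuncturedSphere.cycle • ({p, q1, q2, q3} : Set RepClass) =
        {FourPuncturedSphere.cycle • q1, FourPuncturedSphere.cycle • p,
          FourPuncturedSphere.cycle • q3, FourPuncturedSphere.cycle • q2} := by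
      rw [← Set.image_smul, Set.image_insert_eq, Set.image_insert_eq, Set.image_pair,
        Set.insert_comm, Set.pair_comm (FourPuncturedSphere.cycle • q2)]
    refine ⟨_, _, _, _, hset, ?_, ?_, ?_, ?_⟩
    · convert h1.cycle using 1
      rw [hP]; ring
    · convert h0.cycle using 1
      · ring
      · rw [hP]; ring
    · convert h3.cycle using 1
      rw [hP]; ring
    · convert h2.cycle using 1
      rw [hP]; ring
  · intro O' hO' ρ hρ
    rw [back O' hO'] at hρ
    obtain ⟨x, hx, hx'⟩ := hρ
    obtain ⟨σ, rfl⟩ := Quotient.exists_rep x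
    exact isRotationTriangleGroup_of_smul hx'.symm (h.image O hO σ hx)

lemma rotate_vec {X : Type*} (a b c d : X) : (fun i : Fin 4 => ![a, b, c, d] (i + 1)) = ![b, c, d,
    a] := by
  funext i; fin_cases i <;> rfl

lemma HasUniqueOrbit.rotations {θ o P r : ℝ} (hα : Admissible ![θ, θ, θ, o])
    (hP : 4 * (cos (θ / 2) * cos (θ / 2) - cos (θ / 2) * cos (o / 2)) = P)
    (h : HasUniqueOrbit ![θ, θ, θ, o] P 1 1 1 r) :
    (Admissible ![θ, θ, o, θ] ∧ HasUniqueOrbit ![θ, θ, o, θ] P 1 (-1) (-1) r) ∧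
    (Admissible ![θ, o, θ, θ] ∧ HasUniqueOrbit ![θ, o, θ, θ] P (-1) (-1) 1 r) ∧
    (Admissible ![o, θ, θ, θ] ∧ HasUniqueOrbit ![o, θ, θ, θ] P (-1) 1 (-1) r) := by
  have a1 := hα.rotate
  rw [rotate_vec] at a1
  have a2 := a1.rotate
  rw [rotate_vec] at a2
  have a3 := a2.rotate
  rw [rotate_vec] at a3
  have h1 : HasUniqueOrbit ![θ, θ, o, θ] P 1 (-1) (-1) r := by
    have := HasUniqueOrbit.cycle hα (s := 1) (t := 1) (P := P) (r := r)
      (by rw [← hP, coeff]; simp) (by simpa using h)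
    rw [rotate_vec] at this
    simpa using this
  have h2 : HasUniqueOrbit ![θ, o, θ, θ] P (-1) (-1) 1 r := by
    have := HasUniqueOrbit.cycle a1 (s := 1) (t := -1) (P := P) (r := r)
      (by rw [← hP, coeff]; simp; ring) (by simpa using h1)
    rw [rotate_vec] at this
    simpa using this
  have h3 : HasUniqueOrbit ![o, θ, θ, θ] P (-1) 1 (-1) r := by
    have := HasUniqueOrbit.cycle a2 (s := -1) (t := -1) (P := P) (r := r)
      (by rw [← hP, coeff]; simp; ring) (by simpa using h2)
    rw [rotate_vec] at this
    simpa using this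
  exact ⟨⟨a1, h1⟩, ⟨a2, h2⟩, ⟨a3, h3⟩⟩

/-! ### The two families of peripheral angles -/

section Families

variable {θ : ℝ} (hθ : 5 * π / 3 < θ) (hθ' : θ < 2 * π)
include hθ hθ'

/-- The bound `θ > 5π/3` gives `q < 1`, hence `P > 3`. -/
lemma baseAngles_pi : BaseAngles ![θ, θ, θ, π] (4 * cos (θ / 2) ^ 2) (2 * sin (θ / 2)) := by
  have hpi := pi_pos
  have hsc := sin_sq_add_cos_sq (θ / 2)
  have hs : 0 < sin (θ / 2) := sin_half_pos (by linarith) hθ'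
  have hs' : sin (θ / 2) < 1 / 2 := by
    rw [← sin_pi_sub, ← sin_pi_div_six]
    exact sin_lt_sin_of_lt_of_le_pi_div_two (by linarith) (by linarith) (by linarith)
  have hl : 2 * cos ((θ + π) / 2) < 2 * sin (θ / 2) := by
    rw [show (θ + π) / 2 = θ / 2 + π / 2 by ring, cos_add_pi_div_two]; linarith
  refine ⟨⟨?_, ?_, ?_⟩, by linarith, by linarith, by linarith, by linarith, ?_, ?_, ?_, ?_, ?_, ?_⟩
  · intro i; fin_cases i <;> simp <;> linarith
  · intro i; fin_cases i <;> simp <;> linarith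
  · simp; linarith
  · simp [coeff]; ring
  · simp [coeff]; ring
  · simp [coeff]; ring
  · simp; ring
  · simpa using hl
  · simpa [add_comm] using hl

omit hθ hθ' in
lemma cos_three_half : cos ((3 * θ - 4 * π) / 2) = 4 * cos (θ / 2) ^ 3 - 3 * cos (θ / 2) := by
  rw [show (3 * θ - 4 * π) / 2 = 3 * (θ / 2) - 2 * π by ring, cos_sub_two_pi, cos_three_mul]

omit hθ hθ' in
lemma cos_eq_half : cos θ = 2 * cos (θ / 2) ^ 2 - 1 := by
  rw [← cos_two_mul, mul_div_cancel₀ _ two_ne_zero]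

/-- The triple angle formula makes the three linear coefficients equal; here `q > 1`, hence `P < 3`.
-/
lemma baseAngles_three : BaseAngles ![θ, θ, θ, 3 * θ - 4 * π]
    (16 * cos (θ / 2) ^ 2 - 16 * cos (θ / 2) ^ 4) (2 * cos θ) := by
  have hpi := pi_pos
  have h1 : 1 / 2 < cos θ := by
    rw [← cos_two_pi_sub, ← cos_pi_div_three]
    exact cos_lt_cos_of_nonneg_of_le_pi (by linarith) (by linarith) (by linarith)
  have h2 : cos θ < 1 := by
    have := two_cos_lt (t := θ) (by linarith) hθ'
    linarith
  have hl : 2 * cos ((θ + (3 * θ - 4 * π)) / 2) < 2 * cos θ := by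
    rw [show (θ + (3 * θ - 4 * π)) / 2 = 2 * θ - 2 * π by ring, cos_sub_two_pi, cos_two_mul]
    nlinarith
  have h3 := cos_three_half (θ := θ)
  have h4 := cos_eq_half (θ := θ)
  refine ⟨⟨?_, ?_, ?_⟩, by rw [h4]; ring, by linarith, by linarith, by linarith, ?_, ?_, ?_, ?_, ?_,
      ?_⟩
  · intro i; fin_cases i <;> simp <;> linarith
  · intro i; fin_cases i <;> simp <;> linarith
  · simp; linarith
  · simp [coeff, h3]; ring
  · simp [coeff, h3]; ring
  · simp [coeff, h3]; ring
  · simp [h3]; ring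
  · simpa using hl
  · simpa [add_comm] using hl

end Families

/-! ### Coordinates of the points of the orbits -/

/-- All factors `√3` are split off into `A`, `B`, `C`, `D`, which leaves polynomial identities in
`cos (θ / 2)` to check in each row. The map `e` tells which of the three points carries the `j`-th
angle. -/
lemma HasFourPoints.hasOrbitPoints {α : Fin 4 → ℝ} (hα : Admissible α) {P s t u κ β : ℝ}
    {O : Set RepClass} (hO : HasFourPoints α P s t u O) (hβ : β ∈ Set.Ioo 0 (2 * π))
    (hs : cos (β / 2) = s / 2) (hs' : sin (β / 2) = √3 / 2) {pole : RepClass → Prop}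
    (hpole : ∀ p, HasTraces α p (s * (P - 2)) t u → pole p) {γ : Fin 3 → ℝ} (C D : Fin 3 → ℝ)
    (hC : ∀ j, cos (γ j) = C j) (hD : ∀ j, sin (γ j) = √3 * D j) (hκ : 0 < κ)
    (e : Fin 3 → Fin 3) (he : Function.Surjective e) {A B : ℝ}
    (hA : A = s / 2 * cos (α 1 / 2) - cos (α 0 / 2)) (hB : B = -(cos (α 3 / 2) + s / 2 * cos (α 2 /
        2)))
    (hy : ∀ j, ![t * (P - 2), t, t] (e j) =
      2 * (cos (α 1 / 2) * cos (α 2 / 2) - 4 / 3 * (A * B) + κ * C j))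
    (hz : ∀ j, ![u, u * (P - 2), u] (e j) =
      s * (cos (α 1 / 2) * cos (α 2 / 2) + 4 / 3 * (A * B)) +
        2 * (cos (α 1 / 2) * B - A * cos (α 2 / 2)) - κ * (s * C j + 3 * D j)) :
    HasOrbitPoints α O β γ pole := by
  obtain ⟨p, q₁, q₂, q₃, rfl, h0, h1, h2, h3⟩ := hO
  have h33 : √3 * √3 = 3 := mul_self_sqrt (by norm_num)
  have hq : ∀ i, HasTraces α (![q₁, q₂, q₃] i) (2 * cos (β / 2)) (![t * (P - 2), t, t] i)
      (![u, u * (P - 2), u] i) := by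
    rw [hs, mul_div_cancel₀ _ two_ne_zero]
    intro i
    fin_cases i <;> assumption
  refine ⟨p, fun j => ![q₁, q₂, q₃] (e j), ?_, hpole p h0, fun j => ?_⟩
  · have : Set.range (fun j => ![q₁, q₂, q₃] (e j)) = {q₁, q₂, q₃} := by
      rw [show (fun j => ![q₁, q₂, q₃] (e j)) = ![q₁, q₂, q₃] ∘ e from rfl, he.range_comp,
        Matrix.range_cons, Matrix.range_cons, Matrix.range_cons, Matrix.range_empty]
      ext x
      simp
      tauto
    rw [this]
  -- Division by `sin (β / 2) = √3 / 2` is multiplication by `2√3 / 3`.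
  · refine (hq (e j)).hasCoordinates hα hβ hκ (a := 2 / 3 * √3 * A) (b := 2 / 3 * √3 * B)
      ?_ ?_ ?_ ?_
    · rw [hs, hs', ← hA]; linear_combination A / 3 * h33
    · rw [hs, hs', ← hB]; linear_combination B / 3 * h33
    · rw [hy, hC]; linear_combination 8 / 9 * A * B * h33
    · rw [hz, hC, hD, hs, hs']
      linear_combination (-(s * (4 / 9) * A * B) - 2 / 3 * (cos (α 1 / 2) * B - A * cos (α 2 / 2)) +
        κ * D j) * h33

lemma cos_sin_even (j : Fin 3) :
    cos ((![0, 2 * π / 3, 4 * π / 3] : Fin 3 → ℝ) j) = (![1, -(1 / 2), -(1 / 2)] : Fin 3 → ℝ) j ∧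
    sin ((![0, 2 * π / 3, 4 * π / 3] : Fin 3 → ℝ) j) =
      √3 * (![0, 1 / 2, -(1 / 2)] : Fin 3 → ℝ) j := by
  fin_cases j
  · simp
  · simp only [show 2 * π / 3 = π - π / 3 by ring]
    simp; ring
  · simp only [show 4 * π / 3 = π / 3 + π by ring]
    simp; ring

lemma cos_sin_odd (j : Fin 3) :
    cos ((![π / 3, π, 5 * π / 3] : Fin 3 → ℝ) j) = (![1 / 2, -1, 1 / 2] : Fin 3 → ℝ) j ∧
    sin ((![π / 3, π, 5 * π / 3] : Fin 3 → ℝ) j) =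
      √3 * (![1 / 2, 0, -(1 / 2)] : Fin 3 → ℝ) j := by
  fin_cases j
  · simp; ring
  · simp
  · simp only [show 5 * π / 3 = 2 * π - π / 3 by ring]
    simp; ring

section Rows

variable {θ : ℝ} (hθ : 5 * π / 3 < θ) (hθ' : θ < 2 * π)
include hθ hθ'

lemma cos_half_sq_gt : 3 / 4 < cos (θ / 2) ^ 2 := by
  have h1 : 1 / 2 < cos θ := by
    rw [← cos_two_pi_sub, ← cos_pi_div_three]
    exact cos_lt_cos_of_nonneg_of_le_pi (by linarith [pi_pos]) (by linarith [pi_pos]) (by linarith)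
  linarith [cos_eq_half (θ := θ)]

lemma kappa_pos : 0 < (3 - (16 * cos (θ / 2) ^ 2 - 16 * cos (θ / 2) ^ 4)) / 3 := by
  have := cos_half_sq_gt hθ hθ'
  nlinarith

omit hθ hθ' in
lemma beta_third : 2 * π / 3 ∈ Set.Ioo 0 (2 * π) ∧ cos (2 * π / 3 / 2) = 1 / 2 ∧
    sin (2 * π / 3 / 2) = √3 / 2 := by
  rw [show 2 * π / 3 / 2 = π / 3 by ring, cos_pi_div_three, sin_pi_div_three]
  exact ⟨⟨by linarith [pi_pos], by linarith [pi_pos]⟩, rfl, rfl⟩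

omit hθ hθ' in
lemma beta_two_thirds : 4 * π / 3 ∈ Set.Ioo 0 (2 * π) ∧ cos (4 * π / 3 / 2) = -1 / 2 ∧
    sin (4 * π / 3 / 2) = √3 / 2 := by
  rw [show 4 * π / 3 / 2 = π - π / 3 by ring, cos_pi_sub, sin_pi_sub, cos_pi_div_three,
    sin_pi_div_three]
  exact ⟨⟨by linarith [pi_pos], by linarith [pi_pos]⟩, by ring, rfl⟩

/-- In all eight rows `κ = |P - 3| / 3`. The sign of `P - 3` differs between the two families, which
shifts the three angles by `π` for the same position of the special puncture. -/
lemma orbitPoints_south_even_last {O : Set RepClass} (hα : Admissible ![θ, θ, θ, π])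
    (hO : HasFourPoints ![θ, θ, θ, π] (4 * cos (θ / 2) ^ 2) 1 1 1 O) :
    HasOrbitPoints ![θ, θ, θ, π] O (2 * π / 3) ![0, 2 * π / 3, 4 * π / 3]
      (fun p => IsSouthPole ![θ, θ, θ, π] p (4 * π - 2 * θ)) := by
  obtain ⟨hβ, hc, hs⟩ := beta_third
  refine hO.hasOrbitPoints hα hβ hc hs (fun p hp => ?_) _ _ (fun j => (cos_sin_even j).1)
    (fun j => (cos_sin_even j).2) (κ := (4 * cos (θ / 2) ^ 2 - 3) / 3) ?_ ![0, 2, 1]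
    (by decide) rfl rfl (fun j => ?_) (fun j => ?_)
  · refine hp.isSouthPole hα ⟨by linarith, by linarith⟩ ?_ (by simp; ring)
    rw [show (4 * π - 2 * θ) / 2 = 2 * π - θ by ring, cos_two_pi_sub, cos_eq_half (θ := θ)]
    ring
  · linarith [cos_half_sq_gt hθ hθ']
  · fin_cases j <;> simp <;> ring
  · fin_cases j <;> simp <;> ring

lemma orbitPoints_south_odd_third {O : Set RepClass} (hα : Admissible ![θ, θ, π, θ])
    (hO : HasFourPoints ![θ, θ, π, θ] (4 * cos (θ / 2) ^ 2) 1 (-1) (-1) O) :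
    HasOrbitPoints ![θ, θ, π, θ] O (2 * π / 3) ![π / 3, π, 5 * π / 3]
      (fun p => IsSouthPole ![θ, θ, π, θ] p (4 * π - 2 * θ)) := by
  obtain ⟨hβ, hc, hs⟩ := beta_third
  refine hO.hasOrbitPoints hα hβ hc hs (fun p hp => ?_) _ _ (fun j => (cos_sin_odd j).1)
    (fun j => (cos_sin_odd j).2) (κ := (4 * cos (θ / 2) ^ 2 - 3) / 3) ?_ ![1, 0, 2]
    (by decide) rfl rfl (fun j => ?_) (fun j => ?_)
  · refine hp.isSouthPole hα ⟨by linarith, by linarith⟩ ?_ (by simp; ring)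
    rw [show (4 * π - 2 * θ) / 2 = 2 * π - θ by ring, cos_two_pi_sub, cos_eq_half (θ := θ)]
    ring
  · linarith [cos_half_sq_gt hθ hθ']
  · fin_cases j <;> simp <;> ring
  · fin_cases j <;> simp <;> ring

lemma orbitPoints_north_even_first {O : Set RepClass} (hα : Admissible ![π, θ, θ, θ])
    (hO : HasFourPoints ![π, θ, θ, θ] (4 * cos (θ / 2) ^ 2) (-1) 1 (-1) O) :
    HasOrbitPoints ![π, θ, θ, θ] O (4 * π / 3) ![0, 2 * π / 3, 4 * π / 3]
      (fun p => IsNorthPole ![π, θ, θ, θ] p (2 * θ - 2 * π)) := by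
  obtain ⟨hβ, hc, hs⟩ := beta_two_thirds
  refine hO.hasOrbitPoints hα hβ hc hs (fun p hp => ?_) _ _ (fun j => (cos_sin_even j).1)
    (fun j => (cos_sin_even j).2) (κ := (4 * cos (θ / 2) ^ 2 - 3) / 3) ?_ ![0, 1, 2]
    (by decide) rfl rfl (fun j => ?_) (fun j => ?_)
  · refine hp.isNorthPole hα ⟨by linarith, by linarith⟩ ?_ (by simp; ring)
    rw [show (2 * θ - 2 * π) / 2 = θ - π by ring, cos_sub_pi, cos_eq_half (θ := θ)]
    ring
  · linarith [cos_half_sq_gt hθ hθ']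
  · fin_cases j <;> simp <;> ring
  · fin_cases j <;> simp <;> ring

lemma orbitPoints_north_odd_second {O : Set RepClass} (hα : Admissible ![θ, π, θ, θ])
    (hO : HasFourPoints ![θ, π, θ, θ] (4 * cos (θ / 2) ^ 2) (-1) (-1) 1 O) :
    HasOrbitPoints ![θ, π, θ, θ] O (4 * π / 3) ![π / 3, π, 5 * π / 3]
      (fun p => IsNorthPole ![θ, π, θ, θ] p (2 * θ - 2 * π)) := by
  obtain ⟨hβ, hc, hs⟩ := beta_two_thirds
  refine hO.hasOrbitPoints hα hβ hc hs (fun p hp => ?_) _ _ (fun j => (cos_sin_odd j).1)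
    (fun j => (cos_sin_odd j).2) (κ := (4 * cos (θ / 2) ^ 2 - 3) / 3) ?_ ![2, 0, 1]
    (by decide) rfl rfl (fun j => ?_) (fun j => ?_)
  · refine hp.isNorthPole hα ⟨by linarith, by linarith⟩ ?_ (by simp; ring)
    rw [show (2 * θ - 2 * π) / 2 = θ - π by ring, cos_sub_pi, cos_eq_half (θ := θ)]
    ring
  · linarith [cos_half_sq_gt hθ hθ']
  · fin_cases j <;> simp <;> ring
  · fin_cases j <;> simp <;> ring

lemma orbitPoints_north_odd_last {O : Set RepClass} (hα : Admissible ![θ, θ, θ, 3 * θ - 4 * π])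
    (hO : HasFourPoints ![θ, θ, θ, 3 * θ - 4 * π] (16 * cos (θ / 2) ^ 2 - 16 * cos (θ / 2) ^ 4) 1 1
        1 O) :
    HasOrbitPoints ![θ, θ, θ, 3 * θ - 4 * π] O (2 * π / 3) ![π / 3, π, 5 * π / 3]
      (fun p => IsNorthPole ![θ, θ, θ, 3 * θ - 4 * π] p (4 * θ - 6 * π)) := by
  obtain ⟨hβ, hc, hs⟩ := beta_third
  refine hO.hasOrbitPoints hα hβ hc hs (fun p hp => ?_) _ _ (fun j => (cos_sin_odd j).1)
    (fun j => (cos_sin_odd j).2) (κ := (3 - (16 * cos (θ / 2) ^ 2 - 16 * cos (θ / 2) ^ 4)) /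
        3) ?_ ![1, 0, 2]
    (by decide) rfl rfl (fun j => ?_) (fun j => ?_)
  · refine hp.isNorthPole hα ⟨by linarith, by linarith⟩ ?_ (by simp; ring)
    rw [show (4 * θ - 6 * π) / 2 = 2 * θ - π - 2 * π by ring, cos_sub_two_pi, cos_sub_pi,
        cos_two_mul,
      cos_eq_half (θ := θ)]
    ring
  · exact kappa_pos hθ hθ'
  · fin_cases j <;> simp [cos_three_half] <;> ring
  · fin_cases j <;> simp [cos_three_half] <;> ring

lemma orbitPoints_north_even_third {O : Set RepClass} (hα : Admissible ![θ, θ, 3 * θ - 4 * π, θ])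
    (hO : HasFourPoints ![θ, θ, 3 * θ - 4 * π,
        θ] (16 * cos (θ / 2) ^ 2 - 16 * cos (θ / 2) ^ 4) 1 (-1) (-1) O) :
    HasOrbitPoints ![θ, θ, 3 * θ - 4 * π, θ] O (2 * π / 3) ![0, 2 * π / 3, 4 * π / 3]
      (fun p => IsNorthPole ![θ, θ, 3 * θ - 4 * π, θ] p (4 * θ - 6 * π)) := by
  obtain ⟨hβ, hc, hs⟩ := beta_third
  refine hO.hasOrbitPoints hα hβ hc hs (fun p hp => ?_) _ _ (fun j => (cos_sin_even j).1)
    (fun j => (cos_sin_even j).2) (κ := (3 - (16 * cos (θ / 2) ^ 2 - 16 * cos (θ / 2) ^ 4)) /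
        3) ?_ ![0, 2, 1]
    (by decide) rfl rfl (fun j => ?_) (fun j => ?_)
  · refine hp.isNorthPole hα ⟨by linarith, by linarith⟩ ?_ (by simp; ring)
    rw [show (4 * θ - 6 * π) / 2 = 2 * θ - π - 2 * π by ring, cos_sub_two_pi, cos_sub_pi,
        cos_two_mul,
      cos_eq_half (θ := θ)]
    ring
  · exact kappa_pos hθ hθ'
  · fin_cases j <;> simp [cos_three_half] <;> ring
  · fin_cases j <;> simp [cos_three_half] <;> ring

lemma orbitPoints_south_even_second {O : Set RepClass} (hα : Admissible ![θ, 3 * θ - 4 * π, θ, θ])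
    (hO : HasFourPoints ![θ, 3 * θ - 4 * π, θ,
        θ] (16 * cos (θ / 2) ^ 2 - 16 * cos (θ / 2) ^ 4) (-1) (-1) 1 O) :
    HasOrbitPoints ![θ, 3 * θ - 4 * π, θ, θ] O (4 * π / 3) ![0, 2 * π / 3, 4 * π / 3]
      (fun p => IsSouthPole ![θ, 3 * θ - 4 * π, θ, θ] p (8 * π - 4 * θ)) := by
  obtain ⟨hβ, hc, hs⟩ := beta_two_thirds
  refine hO.hasOrbitPoints hα hβ hc hs (fun p hp => ?_) _ _ (fun j => (cos_sin_even j).1)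
    (fun j => (cos_sin_even j).2) (κ := (3 - (16 * cos (θ / 2) ^ 2 - 16 * cos (θ / 2) ^ 4)) /
        3) ?_ ![0, 1, 2]
    (by decide) rfl rfl (fun j => ?_) (fun j => ?_)
  · refine hp.isSouthPole hα ⟨by linarith, by linarith⟩ ?_ (by simp; ring)
    rw [show (8 * π - 4 * θ) / 2 = 2 * π - 2 * θ + 2 * π by ring, cos_add_two_pi, cos_two_pi_sub,
      cos_two_mul, cos_eq_half (θ := θ)]
    ring
  · exact kappa_pos hθ hθ'
  · fin_cases j <;> simp [cos_three_half] <;> ring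
  · fin_cases j <;> simp [cos_three_half] <;> ring

lemma orbitPoints_south_odd_first {O : Set RepClass} (hα : Admissible ![3 * θ - 4 * π, θ, θ, θ])
    (hO : HasFourPoints ![3 * θ - 4 * π, θ, θ,
        θ] (16 * cos (θ / 2) ^ 2 - 16 * cos (θ / 2) ^ 4) (-1) 1 (-1) O) :
    HasOrbitPoints ![3 * θ - 4 * π, θ, θ, θ] O (4 * π / 3) ![π / 3, π, 5 * π / 3]
      (fun p => IsSouthPole ![3 * θ - 4 * π, θ, θ, θ] p (8 * π - 4 * θ)) := by
  obtain ⟨hβ, hc, hs⟩ := beta_two_thirds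
  refine hO.hasOrbitPoints hα hβ hc hs (fun p hp => ?_) _ _ (fun j => (cos_sin_odd j).1)
    (fun j => (cos_sin_odd j).2) (κ := (3 - (16 * cos (θ / 2) ^ 2 - 16 * cos (θ / 2) ^ 4)) /
        3) ?_ ![2, 0, 1]
    (by decide) rfl rfl (fun j => ?_) (fun j => ?_)
  · refine hp.isSouthPole hα ⟨by linarith, by linarith⟩ ?_ (by simp; ring)
    rw [show (8 * π - 4 * θ) / 2 = 2 * π - 2 * θ + 2 * π by ring, cos_add_two_pi, cos_two_pi_sub,
      cos_two_mul, cos_eq_half (θ := θ)]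
    ring
  · exact kappa_pos hθ hθ'
  · fin_cases j <;> simp [cos_three_half] <;> ring
  · fin_cases j <;> simp [cos_three_half] <;> ring

end Rows

end FourPuncturedSphere

theorem mainTheorem3 (θ : ℝ) (hθ : 5 * π / 3 < θ) (hθ' : θ < 2 * π) :
    -- In each of the eight cases there is a unique orbit of length 4 in the component.
    (∀ α ∈ ({![θ, θ, θ, π], ![θ, θ, π, θ], ![π, θ, θ, θ], ![θ, π, θ, θ],
        ![θ, θ, θ, 3 * θ - 4 * π], ![θ, θ, 3 * θ - 4 * π, θ],
        ![θ, 3 * θ - 4 * π, θ, θ], ![3 * θ - 4 * π, θ, θ, θ]} : Set (Fin 4 → ℝ)),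
      (∃! O : Set RepClass, IsLengthFourOrbit α O) ∧
      -- The image of every representation in that orbit is a rotation triangle group.
      ∀ O, IsLengthFourOrbit α O → ∀ ρ : SphereRep, ρ.cls ∈ O →
        IsRotationTriangleGroup ρ.range 2 3 (1 - θ / (2 * π))⁻¹) ∧
    -- Coordinates of the orbit points, first family.
    (∀ (α : Fin 4 → ℝ) (O : Set RepClass), α = ![θ, θ, θ, π] →
      IsLengthFourOrbit α O →
      HasOrbitPoints α O (2 * π / 3) ![0, 2 * π / 3, 4 * π / 3]
        (fun p => IsSouthPole α p (4 * π - 2 * θ))) ∧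
    (∀ (α : Fin 4 → ℝ) (O : Set RepClass), α = ![θ, θ, π, θ] →
      IsLengthFourOrbit α O →
      HasOrbitPoints α O (2 * π / 3) ![π / 3, π, 5 * π / 3]
        (fun p => IsSouthPole α p (4 * π - 2 * θ))) ∧
    (∀ (α : Fin 4 → ℝ) (O : Set RepClass), α = ![π, θ, θ, θ] →
      IsLengthFourOrbit α O →
      HasOrbitPoints α O (4 * π / 3) ![0, 2 * π / 3, 4 * π / 3]
        (fun p => IsNorthPole α p (2 * θ - 2 * π))) ∧
    (∀ (α : Fin 4 → ℝ) (O : Set RepClass), α = ![θ, π, θ, θ] →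
      IsLengthFourOrbit α O →
      HasOrbitPoints α O (4 * π / 3) ![π / 3, π, 5 * π / 3]
        (fun p => IsNorthPole α p (2 * θ - 2 * π))) ∧
    -- Coordinates of the orbit points, second family.
    (∀ (α : Fin 4 → ℝ) (O : Set RepClass), α = ![θ, θ, θ, 3 * θ - 4 * π] →
      IsLengthFourOrbit α O →
      HasOrbitPoints α O (2 * π / 3) ![π / 3, π, 5 * π / 3]
        (fun p => IsNorthPole α p (4 * θ - 6 * π))) ∧
    (∀ (α : Fin 4 → ℝ) (O : Set RepClass), α = ![θ, θ, 3 * θ - 4 * π, θ] →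
      IsLengthFourOrbit α O →
      HasOrbitPoints α O (2 * π / 3) ![0, 2 * π / 3, 4 * π / 3]
        (fun p => IsNorthPole α p (4 * θ - 6 * π))) ∧
    (∀ (α : Fin 4 → ℝ) (O : Set RepClass), α = ![θ, 3 * θ - 4 * π, θ, θ] →
      IsLengthFourOrbit α O →
      HasOrbitPoints α O (4 * π / 3) ![0, 2 * π / 3, 4 * π / 3]
        (fun p => IsSouthPole α p (8 * π - 4 * θ))) ∧
    (∀ (α : Fin 4 → ℝ) (O : Set RepClass), α = ![3 * θ - 4 * π, θ, θ, θ] →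
      IsLengthFourOrbit α O →
      HasOrbitPoints α O (4 * π / 3) ![π / 3, π, 5 * π / 3]
        (fun p => IsSouthPole α p (8 * π - 4 * θ))) := by
  have hpi := pi_pos
  have S₁ := baseAngles_pi hθ hθ'
  have S₂ := baseAngles_three hθ hθ'
  have a₁ := S₁.adm
  have a₅ := S₂.adm
  have h₁ := hasUniqueOrbit_pi hθ hθ' S₁
  have h₅ := hasUniqueOrbit_three hθ hθ' S₂
  obtain ⟨⟨a₂, h₂⟩, ⟨a₃, h₃⟩, a₄, h₄⟩ := h₁.rotations a₁ (by rw [cos_pi_div_two]; ring)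
  obtain ⟨⟨a₆, h₆⟩, ⟨a₇, h₇⟩, a₈, h₈⟩ := h₅.rotations a₅ (by rw [cos_three_half]; ring)
  refine ⟨?_, ?_, ?_, ?_, ?_, ?_, ?_, ?_, ?_⟩
  · rintro α (rfl | rfl | rfl | rfl | rfl | rfl | rfl | rfl)
    · exact ⟨h₁.unique, h₁.image⟩
    · exact ⟨h₂.unique, h₂.image⟩
    · exact ⟨h₄.unique, h₄.image⟩
    · exact ⟨h₃.unique, h₃.image⟩
    · exact ⟨h₅.unique, h₅.image⟩
    · exact ⟨h₆.unique, h₆.image⟩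
    · exact ⟨h₇.unique, h₇.image⟩
    · exact ⟨h₈.unique, h₈.image⟩
  · rintro α O rfl hO
    exact orbitPoints_south_even_last hθ hθ' a₁ (h₁.points O hO)
  · rintro α O rfl hO
    exact orbitPoints_south_odd_third hθ hθ' a₂ (h₂.points O hO)
  · rintro α O rfl hO
    exact orbitPoints_north_even_first hθ hθ' a₄ (h₄.points O hO)
  · rintro α O rfl hO
    exact orbitPoints_north_odd_second hθ hθ' a₃ (h₃.points O hO)
  · rintro α O rfl hO
    exact orbitPoints_north_odd_last hθ hθ' a₅ (h₅.points O hO)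
  · rintro α O rfl hO
    exact orbitPoints_north_even_third hθ hθ' a₆ (h₆.points O hO)
  · rintro α O rfl hO
    exact orbitPoints_south_even_second hθ hθ' a₇ (h₇.points O hO)
  · rintro α O rfl hO
    exact orbitPoints_south_odd_first hθ hθ' a₈ (h₈.points O hO)
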